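/- For a finite set $P\subseteq\mathbb{R}^d$ and an integer $k\ge1$ let $\mathrm{opt}=\mathrm{opt}_k(P):=\inf_{C\subseteq\mathbb{R}^d,\,|C|=k}\ \max_{p\in P}\ \min_{c\in C}\|p-c\|_2$ be the optimal Euclidean $k$-Center value. A set $S\subseteq P$ is a $\rho$-covering of $P$ if every $p\in P$ has some $q\in S$ with $\|p-q\|_2\le\rho$. The machine model is a unit-cost real RAM: its finite programs may use rational constants, the operations $+,-,\cdot,/,\lfloor\cdot\rfloor$, comparisons, indirectly addressed arrays, and random instructions, each of which draws an independent uniform number of $[0,1]$ or an independent standard Gaussian number at unit cost. **Lemma.** There are a randomized real RAM algorithm, a polynomial $q$, and absolute constants $A,B$ such that the following holds for all integers $n,d,k\ge1$, all real $\beta\ge1$ and every set $P\subseteq\mathbb{R}^d$ of $n$ points. On input $P$ (given as a list of its points), $k$ and $\beta$, the algorithm always halts after at most $A\cdot n\,d\log(n+1)$ steps (so in time $O(nd\log n)$ for $n\ge2$) and outputs a set $S\subseteq P$ with $$|S|\le k\cdot q(d)\cdot\exp\bigl(d/\beta^{2/3}\bigr),$$ and with probability at least $0.991$ over its random draws, $S$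 is a $(B\,\beta\cdot\mathrm{opt})$-covering of $P$. -/

import Mathlib

open MeasureTheory ProbabilityTheory

/-! ## Coverings and the Euclidean k-center problem -/

/-- `S` is a `ρ`-covering for `P`. -/
def IsCovering {X : Type*} [PseudoMetricSpace X] (ρ : ℝ) (P S : Set X) : Prop :=
  S ⊆ P ∧ ∀ p ∈ P, ∃ q ∈ S, dist p q ≤ ρ

/-- The k-center cost `max_{p ∈ P} min_{c ∈ C} dist p c` (for finite nonempty `P` and `C`). -/
noncomputable def kCenterCost {X : Type*} [PseudoMetricSpace X] (P : Set X) (C : Finset X) : ℝ :=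
  ⨆ p : P, Metric.infDist (p : X) (C : Set X)

/-- The optimal k-center value of `P`: the centers range over all of the ambient space. -/
noncomputable def kCenterOpt {X : Type*} [PseudoMetricSpace X] (k : ℕ) (P : Set X) : ℝ :=
  ⨅ C : {C : Finset X // C.card = k}, kCenterCost P C.1

/-! ## A randomized real RAM

Unit-cost machine over the real numbers: registers and arrays hold real numbers, the operations are
`+`, `-`, `*`, `/`, `⌊·⌋`, comparison, indirect addressing of an array, and drawing an independent
uniform number of `[0,1]` or an independent standard Gaussian number.  A program is a finite
structured program; only rational constants may occur in it. -/

namespace RealRAM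

/-- A random tape: the `j`-th random draw of a run returns the first (for a uniform draw) or the
second (for a Gaussian draw) component of the `j`-th entry. -/
abbrev Tape : Type := ℕ → unitInterval × ℝ

/-- All entries of the tape are independent, uniform on `[0,1]` and standard Gaussian. -/
noncomputable def tapeMeasure : Measure Tape :=
  Measure.infinitePi fun _ : ℕ => (volume : Measure unitInterval).prod (gaussianReal 0 1)

/-- Memory of the machine: registers, arrays (array name, position), number of draws so far. -/
structure State where
  reg : ℕ → ℝ
  arr : ℕ → ℕ → ℝ
  draws : ℕ

/-- Arithmetic expressions; `get a e` reads array `a` at position `⌊e⌋₊`. -/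
inductive Expr : Type
  | const (q : ℚ) : Expr
  | reg (x : ℕ) : Expr
  | get (a : ℕ) (e : Expr) : Expr
  | add (e f : Expr) : Expr
  | sub (e f : Expr) : Expr
  | mul (e f : Expr) : Expr
  | div (e f : Expr) : Expr
  | floor (e : Expr) : Expr

namespace Expr

/-- Value of an expression (division by zero returns zero). -/
noncomputable def eval (σ : State) : Expr → ℝ
  | const q => (q : ℝ)
  | reg x => σ.reg x
  | get a e => σ.arr a ⌊e.eval σ⌋₊
  | add e f => e.eval σ + f.eval σ
  | sub e f => e.eval σ - f.eval σ
  | mul e f => e.eval σ * f.eval σ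
  | div e f => e.eval σ / f.eval σ
  | floor e => ((⌊e.eval σ⌋ : ℤ) : ℝ)

/-- Number of operations needed to evaluate an expression. -/
def cost : Expr → ℕ
  | const _ => 1
  | reg _ => 1
  | get _ e => e.cost + 1
  | add e f => e.cost + f.cost + 1
  | sub e f => e.cost + f.cost + 1
  | mul e f => e.cost + f.cost + 1
  | div e f => e.cost + f.cost + 1
  | floor e => e.cost + 1

end Expr

/-- Tests: comparisons and their Boolean combinations. -/
inductive Test : Type
  | le (e f : Expr) : Test
  | not (b : Test) : Test
  | and (b c : Test) : Test

namespace Test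

/-- The test succeeds in state `σ`. -/
def Holds (σ : State) : Test → Prop
  | le e f => e.eval σ ≤ f.eval σ
  | not b => ¬ b.Holds σ
  | and b c => b.Holds σ ∧ c.Holds σ

/-- Number of operations needed to evaluate a test. -/
def cost : Test → ℕ
  | le e f => e.cost + f.cost + 1
  | not b => b.cost + 1
  | and b c => b.cost + c.cost + 1

end Test

/-- Programs. -/
inductive Prog : Type
  | skip : Prog
  | assign (x : ℕ) (e : Expr) : Prog
  | store (a : ℕ) (i e : Expr) : Prog
  | uniform (x : ℕ) : Prog
  | gauss (x : ℕ) : Prog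
  | seq (c c' : Prog) : Prog
  | ite (b : Test) (c c' : Prog) : Prog
  | loop (b : Test) (c : Prog) : Prog

/-- Write `v` into register `x`. -/
def State.setReg (σ : State) (x : ℕ) (v : ℝ) : State where
  reg := Function.update σ.reg x v
  arr := σ.arr
  draws := σ.draws

/-- Write `v` into position `i` of array `a`. -/
def State.setArr (σ : State) (a i : ℕ) (v : ℝ) : State where
  reg := σ.reg
  arr := Function.update σ.arr a (Function.update (σ.arr a) i v)
  draws := σ.draws

/-- Write the random number `v` into register `x` and move on to the next tape entry. -/
def State.draw (σ : State) (x : ℕ) (v : ℝ) : State where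
  reg := Function.update σ.reg x v
  arr := σ.arr
  draws := σ.draws + 1

/-- `Exec ω c σ σ' t`: on the random tape `ω`, program `c` started in `σ` halts in `σ'` after
exactly `t` steps. `loop b c` repeats `c` while `b` holds. -/
inductive Exec (ω : Tape) : Prog → State → State → ℕ → Prop
  | skip (σ : State) : Exec ω .skip σ σ 1
  | assign (x : ℕ) (e : Expr) (σ : State) :
      Exec ω (.assign x e) σ (σ.setReg x (e.eval σ)) (e.cost + 1)
  | store (a : ℕ) (i e : Expr) (σ : State) :
      Exec ω (.store a i e) σ (σ.setArr a ⌊i.eval σ⌋₊ (e.eval σ)) (i.cost + e.cost + 1)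
  | uniform (x : ℕ) (σ : State) : Exec ω (.uniform x) σ (σ.draw x (ω σ.draws).1) 1
  | gauss (x : ℕ) (σ : State) : Exec ω (.gauss x) σ (σ.draw x (ω σ.draws).2) 1
  | seq {c c' : Prog} {σ σ₁ σ₂ : State} {s t : ℕ} :
      Exec ω c σ σ₁ s → Exec ω c' σ₁ σ₂ t → Exec ω (.seq c c') σ σ₂ (s + t)
  | ite_true {b : Test} {c c' : Prog} {σ σ₁ : State} {s : ℕ} :
      b.Holds σ → Exec ω c σ σ₁ s → Exec ω (.ite b c c') σ σ₁ (b.cost + s + 1)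
  | ite_false {b : Test} {c c' : Prog} {σ σ₁ : State} {s : ℕ} :
      ¬ b.Holds σ → Exec ω c' σ σ₁ s → Exec ω (.ite b c c') σ σ₁ (b.cost + s + 1)
  | loop_stop {b : Test} {c : Prog} {σ : State} :
      ¬ b.Holds σ → Exec ω (.loop b c) σ σ (b.cost + 1)
  | loop_step {b : Test} {c : Prog} {σ σ₁ σ₂ : State} {s t : ℕ} :
      b.Holds σ → Exec ω c σ σ₁ s → Exec ω (.loop b c) σ₁ σ₂ t →
        Exec ω (.loop b c) σ σ₂ (b.cost + s + t + 1)

/-- On a given tape, the final state and the number of steps of a halting run are unique. -/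
theorem Exec.unique {ω : Tape} {c : Prog} {σ σ₁ σ₂ : State} {s t : ℕ}
    (h₁ : Exec ω c σ σ₁ s) (h₂ : Exec ω c σ σ₂ t) : σ₁ = σ₂ ∧ s = t := by
  induction h₁ generalizing σ₂ t with
  | skip | assign | store | uniform | gauss => cases h₂; exact ⟨rfl, rfl⟩
  | seq _ _ ih ih' =>
    cases h₂ with
    | seq a b =>
      obtain ⟨rfl, rfl⟩ := ih a
      obtain ⟨rfl, rfl⟩ := ih' b
      exact ⟨rfl, rfl⟩
  | ite_true hb _ ih =>
    cases h₂ with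
    | ite_true _ a => obtain ⟨rfl, rfl⟩ := ih a; exact ⟨rfl, rfl⟩
    | ite_false hb' _ => exact absurd hb hb'
  | ite_false hb _ ih =>
    cases h₂ with
    | ite_true hb' _ => exact absurd hb' hb
    | ite_false _ a => obtain ⟨rfl, rfl⟩ := ih a; exact ⟨rfl, rfl⟩
  | loop_stop hb =>
    cases h₂ with
    | loop_stop _ => exact ⟨rfl, rfl⟩
    | loop_step hb' _ _ => exact absurd hb' hb
  | loop_step hb _ _ ih ih' =>
    cases h₂ with
    | loop_stop hb' => exact absurd hb hb'
    | loop_step _ a b =>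
      obtain ⟨rfl, rfl⟩ := ih a
      obtain ⟨rfl, rfl⟩ := ih' b
      exact ⟨rfl, rfl⟩

/-- Initial state for a list `p` of `n` points of `ℝ^d`, an integer `k` and a real `β`: registers
`0`, `1`, `2`, `3` hold `n`, `d`, `k`, `β`, array `0` holds the coordinates of the points row by
row, and everything else is zero. -/
noncomputable def initState {n d : ℕ} (p : Fin n → EuclideanSpace ℝ (Fin d)) (k : ℕ) (β : ℝ) :
    State where
  reg
    | 0 => n
    | 1 => d
    | 2 => k
    | 3 => β
    | _ => 0
  arr a i :=
    if h : a = 0 ∧ i / d < n ∧ 0 < d then p ⟨i / d, h.2.1⟩ ⟨i % d, Nat.mod_lt i h.2.2⟩ else 0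
  draws := 0

/-- The set of points of `ℝ^d` described by a final state: register `0` holds the length of the
list, and array `1` holds the coordinates of its points row by row. -/
def outputSet (d : ℕ) (σ : State) : Set (EuclideanSpace ℝ (Fin d)) :=
  {x | ∃ i < ⌊σ.reg 0⌋₊, ∀ j : Fin d, x j = σ.arr 1 (i * d + j)}

end RealRAM

/-! If n ≤ kd, the algorithm returns all of P: linear time, and the factor d is absorbed by the
polynomial 400 + d. Otherwise d < n, so log(nd) = O(log n), and it proceeds by a randomly shifted
grid.

Coarse estimate. All nd coordinates are sorted together as one sequence of reals. Cutting this
sequence at the gaps of length at least t labels every coordinate, hence gives every point a row of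
labels. If more than k distinct rows arise, two points served by the same center differ by at least
t in some coordinate, so t ≤ 2 opt. If at most k rows arise, one point per row serves as a center,
and points with equal rows are close because their coordinates are joined by short gaps. Binary
search over the sorted gaps finds a value W with W ≤ 2 opt ≤ W · 2^(2K+1), where 2^K is between nd
and 2nd (`Prepared.bounds`).

Grids. With D an integer between √d and 2√d, grids of width s = 64βW2^l/D with one common uniform
shift are tried for l = 0, 1, …, 2K+1, until at most 200·k·2^E cells are occupied; one input point
per occupied cell is returned. Here E is the least integer with E ≥ d/β^(2/3), so that 2^E ≤
2·exp(d/β^(2/3)). The size bound is thus enforced by the stopping test on every tape. The covering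
needs only one good level: some l fixed by the input has 2 opt ≤ W2^l ≤ 4 opt. If the test passes
there, the algorithm stops at l or earlier, and a cell has diameter at most Ds ≤ 256β·opt.

Probability. Around each of k nearly optimal centers, count the cells that meet a ball of radius r =
2 opt. A cell at scaled distance at most r/s from the center has Gaussian weight at least
exp(-λ(r/s)²), so the count is at most exp(λ(r/s)²) times the total weight of all cells
(`rowCount_cell_le`). The weight is a product over coordinates, which are independent, and averaging
over a uniform shift turns the sum over cells into an integral over ℝ. This gives expectation at
most (1 + 2√(π/λ))^d per center (`lintegral_cellWeight_le`). Since (r/s)² = O(d/β²), the exponent is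
of order λd/β² + d/√λ, balanced by λ of order β^(4/3), with value of order d/β^(2/3). The constants
make the expected count at most k·2^E (`exp_mul_pow_le_two_pow`), and Markov's inequality with
factor 200 finishes.

Machine side. A small Hoare logic (`Runs`, with syntactic write sets in `Frame`) proves termination,
time and correctness together. The preparation draws no random numbers, so the good level and the
good event are fixed before the tape is read. -/

namespace RealRAM

/-! ### Effects of programs -/

namespace Prog

/-- Registers a program may write. -/
def regs : Prog → List ℕ
  | skip => []
  | assign x _ => [x]
  | store _ _ _ => []
  | uniform x => [x]
  | gauss x => [x]
  | seq c c' => c.regs ++ c'.regs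
  | ite _ c c' => c.regs ++ c'.regs
  | loop _ c => c.regs

/-- Arrays a program may write. -/
def arrs : Prog → List ℕ
  | store a _ _ => [a]
  | seq c c' => c.arrs ++ c'.arrs
  | ite _ c c' => c.arrs ++ c'.arrs
  | loop _ c => c.arrs
  | _ => []

/-- Whether a program contains a random instruction. -/
def random : Prog → Bool
  | uniform _ => true
  | gauss _ => true
  | seq c c' => c.random || c'.random
  | ite _ c c' => c.random || c'.random
  | loop _ c => c.random
  | _ => false

/-- `for x = 0, …, b - 1 do c`, where `b` is a register. -/
def forUp (x b : ℕ) (c : Prog) : Prog :=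
  seq (assign x (.const 0)) (loop (.le (.add (.reg x) (.const 1)) (.reg b))
    (seq c (assign x (.add (.reg x) (.const 1)))))

end Prog

/-! ### Reading memory after a write -/

section simps

variable (σ : State) (x y a b i j : ℕ) (v : ℝ)

@[simp] theorem State.setReg_reg : (σ.setReg x v).reg y = if y = x then v else σ.reg y := by
  simp [State.setReg, Function.update_apply]

@[simp] theorem State.setReg_arr : (σ.setReg x v).arr = σ.arr := rfl

@[simp] theorem State.setReg_draws : (σ.setReg x v).draws = σ.draws := rfl

@[simp] theorem State.setArr_reg : (σ.setArr a i v).reg = σ.reg := rfl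

@[simp] theorem State.setArr_arr :
    (σ.setArr a i v).arr b j = if b = a ∧ j = i then v else σ.arr b j := by
  by_cases hb : b = a
  · subst hb; simp [State.setArr, Function.update_apply]
  · simp [State.setArr, hb]

@[simp] theorem State.setArr_draws : (σ.setArr a i v).draws = σ.draws := rfl

@[simp] theorem State.draw_reg : (σ.draw x v).reg y = if y = x then v else σ.reg y := by
  simp [State.draw, Function.update_apply]

@[simp] theorem State.draw_arr : (σ.draw x v).arr = σ.arr := rfl

@[simp] theorem State.draw_draws : (σ.draw x v).draws = σ.draws + 1 := rfl

theorem State.setArr_arr_of_ne (h : b ≠ a) : (σ.setArr a i v).arr b = σ.arr b := by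
  funext j; simp [h]

end simps

/-- `σ'` differs from `σ` only where `c` may write. -/
structure Frame (c : Prog) (σ σ' : State) : Prop where
  reg : ∀ y, y ∉ c.regs → σ'.reg y = σ.reg y
  arr : ∀ a, a ∉ c.arrs → σ'.arr a = σ.arr a
  draws : c.random = false → σ'.draws = σ.draws

/-- The write sets are computable lists, so for a concrete program the preservation of a register or
array reduces to a `decide`. This spares every loop invariant the listing of unchanged memory. -/
theorem Exec.frame {ω : Tape} {c : Prog} {σ σ' : State} {t : ℕ} (h : Exec ω c σ σ' t) :
    Frame c σ σ' := by
  induction h with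
  | skip σ => exact ⟨fun _ _ => rfl, fun _ _ => rfl, fun _ => rfl⟩
  | assign x e σ =>
    exact ⟨fun y hy => by simp [Prog.regs] at hy; simp [hy], fun _ _ => rfl, fun _ => rfl⟩
  | store a i e σ =>
    exact ⟨fun _ _ => rfl, fun b hb => by
      simp [Prog.arrs] at hb; exact State.setArr_arr_of_ne _ _ _ _ _ hb, fun _ => rfl⟩
  | uniform x σ | gauss x σ =>
    exact ⟨fun y hy => by simp [Prog.regs] at hy; simp [hy], fun _ _ => rfl,
      fun h => by simp [Prog.random] at h⟩
  | seq _ _ ih ih' =>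
    refine ⟨fun y hy => ?_, fun y hy => ?_, fun hy => ?_⟩
    · simp [Prog.regs] at hy; rw [ih'.reg y hy.2, ih.reg y hy.1]
    · simp [Prog.arrs] at hy; rw [ih'.arr y hy.2, ih.arr y hy.1]
    · simp [Prog.random] at hy; rw [ih'.draws hy.2, ih.draws hy.1]
  | ite_true _ _ ih =>
    refine ⟨fun y hy => ?_, fun y hy => ?_, fun hy => ?_⟩
    · simp [Prog.regs] at hy; exact ih.reg y hy.1
    · simp [Prog.arrs] at hy; exact ih.arr y hy.1
    · simp [Prog.random] at hy; exact ih.draws hy.1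
  | ite_false _ _ ih =>
    refine ⟨fun y hy => ?_, fun y hy => ?_, fun hy => ?_⟩
    · simp [Prog.regs] at hy; exact ih.reg y hy.2
    · simp [Prog.arrs] at hy; exact ih.arr y hy.2
    · simp [Prog.random] at hy; exact ih.draws hy.2
  | loop_stop _ => exact ⟨fun _ _ => rfl, fun _ _ => rfl, fun _ => rfl⟩
  | loop_step _ _ _ ih ih' =>
    refine ⟨fun y hy => ?_, fun y hy => ?_, fun hy => ?_⟩
    · rw [ih'.reg y hy, ih.reg y hy]
    · rw [ih'.arr y hy, ih.arr y hy]
    · rw [ih'.draws hy, ih.draws hy]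

/-! ### Total correctness with a time bound -/

/-- Started in `σ`, program `c` halts within `T` steps in a state that satisfies `Q`. -/
def Runs (ω : Tape) (c : Prog) (σ : State) (T : ℕ) (Q : State → Prop) : Prop :=
  ∃ σ' t, Exec ω c σ σ' t ∧ t ≤ T ∧ Q σ'

namespace Runs

variable {ω : Tape} {c c' : Prog} {σ : State} {T T₁ T₂ : ℕ} {Q Q₁ : State → Prop}

theorem mono (h : Runs ω c σ T₁ Q₁) (hT : T₁ ≤ T) (hQ : ∀ τ, Q₁ τ → Frame c σ τ → Q τ) :
    Runs ω c σ T Q := by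
  obtain ⟨τ, t, he, ht, hq⟩ := h
  exact ⟨τ, t, he, ht.trans hT, hQ τ hq he.frame⟩

theorem skip (hQ : Q σ) (hT : 1 ≤ T) : Runs ω .skip σ T Q := ⟨_, _, .skip σ, hT, hQ⟩

theorem assign {x : ℕ} {e : Expr} (v : ℝ) (hv : e.eval σ = v) (hT : e.cost + 1 ≤ T)
    (hQ : Q (σ.setReg x v)) : Runs ω (.assign x e) σ T Q := by
  subst hv; exact ⟨_, _, .assign x e σ, hT, hQ⟩

theorem store {a : ℕ} {i e : Expr} (j : ℕ) (v : ℝ) (hj : i.eval σ = j) (hv : e.eval σ = v)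
    (hT : i.cost + e.cost + 1 ≤ T) (hQ : Q (σ.setArr a j v)) : Runs ω (.store a i e) σ T Q := by
  subst hv
  refine ⟨_, _, .store a i e σ, hT, ?_⟩
  rwa [hj, Nat.floor_natCast]

theorem uniform {x : ℕ} (hT : 1 ≤ T) (hQ : Q (σ.draw x (ω σ.draws).1)) :
    Runs ω (.uniform x) σ T Q := ⟨_, _, .uniform x σ, hT, hQ⟩

theorem seq (h : Runs ω c σ T₁ Q₁)
    (h' : ∀ τ, Q₁ τ → Frame c σ τ → Runs ω c' τ T₂ Q) (hT : T₁ + T₂ ≤ T) :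
    Runs ω (.seq c c') σ T Q := by
  obtain ⟨τ, t, he, ht, hq⟩ := h
  obtain ⟨τ', t', he', ht', hq'⟩ := h' τ hq he.frame
  exact ⟨τ', t + t', .seq he he', by omega, hq'⟩

theorem seq_assign {x : ℕ} {e : Expr} (v : ℝ) (hv : e.eval σ = v) (hT : e.cost + 1 + T₂ ≤ T)
    (h : Runs ω c' (σ.setReg x v) T₂ Q) : Runs ω (.seq (.assign x e) c') σ T Q :=
  seq (Q₁ := fun τ => τ = σ.setReg x v) (assign v hv le_rfl rfl) (by rintro _ rfl _; exact h) hT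

theorem seq_store {a : ℕ} {i e : Expr} (j : ℕ) (v : ℝ) (hj : i.eval σ = j) (hv : e.eval σ = v)
    (hT : i.cost + e.cost + 1 + T₂ ≤ T) (h : Runs ω c' (σ.setArr a j v) T₂ Q) :
    Runs ω (.seq (.store a i e) c') σ T Q :=
  seq (Q₁ := fun τ => τ = σ.setArr a j v) (store j v hj hv le_rfl rfl)
    (by rintro _ rfl _; exact h) hT

theorem ite {b : Test} (ht : b.Holds σ → Runs ω c σ T₁ Q) (hf : ¬ b.Holds σ → Runs ω c' σ T₁ Q)
    (hT : b.cost + T₁ + 1 ≤ T) : Runs ω (.ite b c c') σ T Q := by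
  by_cases hb : b.Holds σ
  · obtain ⟨τ, t, he, ht, hq⟩ := ht hb
    exact ⟨τ, _, .ite_true hb he, by omega, hq⟩
  · obtain ⟨τ, t, he, ht, hq⟩ := hf hb
    exact ⟨τ, _, .ite_false hb he, by omega, hq⟩

/-- Rule for counting loops: the invariant `I i` holds whenever the counter has the value `i`. -/
theorem forUp {x b : ℕ} (N : ℕ) (I : ℕ → State → Prop) (hb : σ.reg b = N)
    (hx : x ∉ c.regs) (hbc : b ∉ c.regs) (hbx : b ≠ x)
    (h0 : I 0 (σ.setReg x 0))
    (hstep : ∀ i < N, ∀ τ, I i τ → τ.reg x = i → τ.reg b = N → Frame (.forUp x b c) σ τ →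
      Runs ω c τ T₁ fun τ' => I (i + 1) (τ'.setReg x ((i + 1 : ℕ) : ℝ)))
    (hT : N * (T₁ + 10) + 8 ≤ T)
    (hQ : ∀ τ, I N τ → τ.reg x = N → Frame (.forUp x b c) σ τ → Q τ) :
    Runs ω (.forUp x b c) σ T Q := by
  set l : Prog := .loop (.le (.add (.reg x) (.const 1)) (.reg b))
    (.seq c (.assign x (.add (.reg x) (.const 1)))) with hl
  -- Induction on the number `k` of remaining rounds. Besides the body, a round costs 5 for the
  -- test, 4 for the increment and 1 for the loop.
  have key : ∀ k i τ, i + k = N → I i τ → τ.reg x = i → τ.reg b = N →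
      Frame (.forUp x b c) σ τ →
      Runs ω l τ (k * (T₁ + 10) + 6) fun τ' => I N τ' ∧ τ'.reg x = N := by
    intro k
    induction k with
    | zero =>
      intro i τ hi hI hx' hb' _
      obtain rfl : i = N := by omega
      refine ⟨τ, _, Exec.loop_stop ?_, ?_, hI, hx'⟩
      · simp [Test.Holds, Expr.eval, hx', hb']
      · simp [Test.cost, Expr.cost]
    | succ k ih =>
      intro i τ hi hI hx' hb' hfr
      obtain ⟨τ₁, t₁, he, ht, hq⟩ := hstep i (by omega) τ hI hx' hb' hfr
      have hx1 : τ₁.reg x = i := by rw [he.frame.reg x hx, hx']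
      have hb1 : τ₁.reg b = N := by rw [he.frame.reg b hbc, hb']
      have hex : Exec ω (.seq c (.assign x (.add (.reg x) (.const 1)))) τ
          (τ₁.setReg x ((i + 1 : ℕ) : ℝ)) (t₁ + 4) := by
        have := Exec.assign (ω := ω) x (.add (.reg x) (.const 1)) τ₁
        have h2 : (Expr.add (.reg x) (.const 1)).eval τ₁ = ((i + 1 : ℕ) : ℝ) := by
          simp [Expr.eval, hx1]
        rw [h2] at this
        exact .seq he this
      have hfr2 : Frame (.forUp x b c) σ (τ₁.setReg x ((i + 1 : ℕ) : ℝ)) := by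
        refine ⟨fun y hy => ?_, fun a ha => ?_, fun hr => ?_⟩
        · rw [← hfr.reg y hy]
          simp [Prog.regs, Prog.forUp] at hy
          simp [hy, he.frame.reg y hy.2.1]
        · rw [← hfr.arr a ha]
          simp [Prog.arrs, Prog.forUp] at ha
          simp [he.frame.arr a ha]
        · rw [← hfr.draws hr]
          simp [Prog.random, Prog.forUp] at hr
          simp [he.frame.draws hr]
      obtain ⟨τ₂, t₂, he2, ht2, hq2⟩ := ih (i + 1) _ (by omega) hq (by simp)
        (by simp [hbx, hb1]) hfr2
      refine ⟨τ₂, _, .loop_step ?_ hex he2, ?_, hq2⟩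
      · simp only [Test.Holds, Expr.eval, hx', hb', Rat.cast_one]
        exact_mod_cast (by omega : i + 1 ≤ N)
      · simp only [Test.cost, Expr.cost]
        have : (k + 1) * (T₁ + 10) = k * (T₁ + 10) + (T₁ + 10) := by ring
        omega
  have hfr0 : Frame (.forUp x b c) σ (σ.setReg x 0) := by
    refine ⟨fun y hy => ?_, fun a ha => rfl, fun hr => rfl⟩
    simp [Prog.regs, Prog.forUp] at hy
    simp [hy]
  obtain ⟨τ, t, he, ht, hI, hxN⟩ := key N 0 (σ.setReg x 0) (by omega) h0 (by simp)
    (by simp [hbx, hb]) hfr0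
  have he' : Exec ω (.forUp x b c) σ τ (2 + t) := by
    refine .seq (σ₁ := σ.setReg x 0) ?_ he
    have := Exec.assign (ω := ω) x (.const 0) σ
    simpa [Expr.eval, Expr.cost] using this
  exact ⟨τ, _, he', by omega, hQ τ hI hxN he'.frame⟩

end Runs

/-! ### Counting distinct rows -/

/-- Code of the first `c` entries of row `i` of a matrix with `d` columns. -/
def rowCode (L : ℕ → ℕ) (d i : ℕ) : ℕ → ℕ
  | 0 => 0
  | c + 1 => Nat.pair (rowCode L d i c) (L (i * d + c))

theorem rowCode_eq_iff (L : ℕ → ℕ) (d i j m : ℕ) :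
    rowCode L d i m = rowCode L d j m ↔ ∀ c < m, L (i * d + c) = L (j * d + c) := by
  induction m with
  | zero => simp [rowCode]
  | succ m ih =>
    rw [rowCode, rowCode, Nat.pair_eq_pair, ih]
    constructor
    · rintro ⟨h, h'⟩ c hc
      rcases Nat.lt_succ_iff_lt_or_eq.mp hc with hc | rfl
      · exact h c hc
      · exact h'
    · exact fun h => ⟨fun c hc => h c (by omega), h m (by omega)⟩

/-- Number of distinct rows of an `n × d` matrix. -/
def rowCount (L : ℕ → ℕ) (d n : ℕ) : ℕ :=
  ((Finset.range n).image fun i => rowCode L d i d).card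

open RealRAM.Expr hiding cost
open RealRAM.Test hiding cost
open RealRAM.Prog

/-- Computes the code of the row of array `6` that starts at register `24`. -/
def codeProg : Prog :=
  seq (assign 22 (const 0)) <|
  forUp 23 1 <|
    seq (assign 25 (get 6 (add (reg 24) (reg 23)))) <|
    -- The two branches are the two cases of `Nat.pair`. Codes become huge, but arithmetic and
    -- addressing have unit cost.
    ite (le (add (reg 22) (const 1)) (reg 25))
      (assign 22 (add (mul (reg 25) (reg 25)) (reg 22)))
      (assign 22 (add (add (mul (reg 22) (reg 22)) (reg 22)) (reg 25)))

/-- Copies the point that starts at register `24` of array `0` to position `20` of the output. -/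
def copyProg : Prog :=
  seq (assign 27 (mul (reg 20) (reg 1))) <|
  forUp 23 1 <|
    store 1 (add (reg 27) (reg 23)) (get 0 (add (reg 24) (reg 23)))

/-- Counts the distinct rows of array `6` and outputs one point for each of them. -/
def countProg : Prog :=
  seq (assign 20 (const 0)) <|
  forUp 21 0 <|
    seq (assign 24 (mul (reg 21) (reg 1))) <|
    seq codeProg <|
    seq (assign 26 (get 8 (reg 22))) <|
    -- Dictionary without initialization: array `8` sends a code to its index, array `9` an index to
    -- its code. A stale entry of array `8` is harmless, since it is trusted only if it lies below
    -- the current count and array `9` confirms the code. Hence nothing is cleared between calls.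
    ite (and (and (le (const 1) (reg 20)) (le (add (reg 26) (const 1)) (reg 20)))
        (and (le (get 9 (reg 26)) (reg 22)) (le (reg 22) (get 9 (reg 26)))))
      skip <|
      seq (store 8 (reg 22) (reg 20)) <|
      seq (store 9 (reg 20) (reg 22)) <|
      seq copyProg <|
      assign 20 (add (reg 20) (const 1))

variable {ω : Tape}

theorem runs_codeProg {σ : State} {d i : ℕ} {L : ℕ → ℕ} (h1 : σ.reg 1 = d)
    (h24 : σ.reg 24 = (i * d : ℕ)) (hL : ∀ c < d, σ.arr 6 (i * d + c) = L (i * d + c)) :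
    Runs ω codeProg σ (d * 30 + 10) fun τ => τ.reg 22 = rowCode L d i d := by
  refine Runs.seq_assign (T₂ := d * 30 + 8) 0 (by simp [eval]) (by simp [Expr.cost]; omega) ?_
  refine Runs.forUp (T₁ := 20) d (fun c τ => τ.reg 22 = rowCode L d i c) (by simp [h1])
    (by decide) (by decide) (by decide) (by simp [rowCode]) ?_ (by omega) (fun τ h _ _ => h)
  intro c hc τ hI h23 _ hfr
  have h24' : τ.reg 24 = (i * d : ℕ) := by rw [hfr.reg 24 (by decide)]; simpa using h24
  have h6 : τ.arr 6 = σ.arr 6 := hfr.arr 6 (by decide)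
  refine Runs.seq_assign (T₂ := 14) (L (i * d + c)) ?_ (by simp [Expr.cost]) ?_
  · simp only [eval, h24', h23, h6]
    rw [← Nat.cast_add, Nat.floor_natCast, hL c hc]
  refine Runs.ite (T₁ := 8) ?_ ?_ (by simp [Test.cost, Expr.cost])
  · intro hb
    simp only [Holds, eval, State.setReg_reg, hI] at hb
    norm_num at hb
    have hb' : rowCode L d i c < L (i * d + c) := by exact_mod_cast hb
    refine Runs.assign _ rfl (by simp [Expr.cost]) ?_
    simp [eval, hI, rowCode, Nat.pair, hb']
  · intro hb
    simp only [Holds, eval, State.setReg_reg, hI] at hb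
    norm_num at hb
    have hb' : ¬ rowCode L d i c < L (i * d + c) := by
      rw [not_lt, ← Nat.lt_add_one_iff]; exact_mod_cast hb
    refine Runs.assign _ rfl (by simp [Expr.cost]) ?_
    simp [eval, hI, rowCode, Nat.pair, hb']

/-- The last clause protects the rows that were output before row `m`. -/
theorem runs_copyProg {σ : State} {d i m : ℕ} (h1 : σ.reg 1 = d)
    (h24 : σ.reg 24 = (i * d : ℕ)) (h20 : σ.reg 20 = m) :
    Runs ω copyProg σ (d * 20 + 12) fun τ => (∀ c < d, τ.arr 1 (m * d + c) = σ.arr 0 (i * d + c)) ∧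
      ∀ q < m * d, τ.arr 1 q = σ.arr 1 q := by
  refine Runs.seq_assign (T₂ := d * 20 + 8) (m * d : ℕ) (by simp [eval, h20, h1])
    (by simp [Expr.cost]; omega) ?_
  refine Runs.forUp (T₁ := 10) d (fun c τ => (∀ c' < c, τ.arr 1 (m * d + c') = σ.arr 0 (i * d + c'))
      ∧ ∀ q < m * d, τ.arr 1 q = σ.arr 1 q) (by simp [h1])
    (by decide) (by decide) (by decide) (by simp) ?_ (by omega) (fun τ h _ _ => h)
  rintro c hc τ ⟨hI, hI'⟩ h23 _ hfr
  have h24' : τ.reg 24 = (i * d : ℕ) := by rw [hfr.reg 24 (by decide)]; simpa using h24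
  have h27' : τ.reg 27 = (m * d : ℕ) := by rw [hfr.reg 27 (by decide)]; simp
  have h0 : τ.arr 0 = σ.arr 0 := hfr.arr 0 (by decide)
  refine Runs.store (m * d + c) (σ.arr 0 (i * d + c)) ?_ ?_ (by simp [Expr.cost]) ⟨?_, ?_⟩
  · simp [eval, h27', h23]
  · simp only [eval, h24', h23, h0]
    rw [← Nat.cast_add, Nat.floor_natCast]
  · intro c' hc'
    by_cases h : c' = c
    · subst h; simp
    · simp [h, hI c' (by omega)]
  · intro q hq
    have : q ≠ m * d + c := by omega
    simp [this, hI' q hq]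

/-- The output rows describe one point of the input for each distinct row of the matrix `L`. -/
def IsRepr (n d N : ℕ) (L : ℕ → ℕ) (x y : ℕ → ℝ) : Prop :=
  ∃ rep : ℕ → ℕ, (∀ j < N, rep j < n ∧ ∀ c < d, y (j * d + c) = x (rep j * d + c)) ∧
    ∀ i < n, ∃ j < N, ∀ c < d, L (rep j * d + c) = L (i * d + c)

/-- Nothing is assumed about the dictionary arrays `8` and `9`, so the program can be called
repeatedly, each time in time linear in the matrix. -/
theorem runs_countProg {σ : State} {n d : ℕ} {L : ℕ → ℕ} (h0 : σ.reg 0 = n) (h1 : σ.reg 1 = d)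
    (hL : ∀ q < n * d, σ.arr 6 q = L q) :
    Runs ω countProg σ (n * (d * 50 + 90) + 10) fun τ => τ.reg 20 = rowCount L d n ∧
      IsRepr n d (rowCount L d n) L (σ.arr 0) (τ.arr 1) := by
  refine Runs.seq_assign (T₂ := n * (d * 50 + 90) + 8) 0 (by simp [eval])
    (by simp [Expr.cost]; omega) ?_
  let code : ℕ → ℕ := fun i => rowCode L d i d
  refine Runs.forUp (T₁ := d * 50 + 80) n (fun i τ => ∃ (rep : ℕ → ℕ) (m : ℕ), τ.reg 20 = m ∧
      (∀ j < m, rep j < i ∧ τ.arr 9 j = code (rep j) ∧ τ.arr 8 (code (rep j)) = j ∧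
        ∀ c < d, τ.arr 1 (j * d + c) = σ.arr 0 (rep j * d + c)) ∧
      ∀ i' < i, ∃ j < m, code (rep j) = code i') (by simp [h0])
    (by decide) (by decide) (by decide) ⟨fun _ => 0, 0, by simp⟩ ?_ le_rfl ?_
  · rintro i hi τ ⟨rep, m, h20, hrep, hcov⟩ h21 _ hfr
    have h1' : τ.reg 1 = d := by rw [hfr.reg 1 (by decide)]; simpa using h1
    have h6 : τ.arr 6 = σ.arr 6 := hfr.arr 6 (by decide)
    have h0' : τ.arr 0 = σ.arr 0 := hfr.arr 0 (by decide)
    refine Runs.seq_assign (T₂ := d * 50 + 76) (i * d : ℕ) (by simp [eval, h21, h1'])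
      (by simp [Expr.cost]; omega) ?_
    refine Runs.seq (T₁ := d * 30 + 10) (T₂ := d * 20 + 66)
      (runs_codeProg (L := L) (d := d) (i := i) (by simp [h1']) (by simp) ?_) ?_ (by omega)
    · intro c hc
      rw [State.setReg_arr, h6]
      refine hL _ ?_
      calc i * d + c < i * d + d := by omega
        _ = (i + 1) * d := by ring
        _ ≤ n * d := Nat.mul_le_mul_right _ hi
    intro τ₁ h22 hfr₁
    have ha (a : ℕ) (ha : a ∉ codeProg.arrs) : τ₁.arr a = τ.arr a := by rw [hfr₁.arr a ha]; simp
    have h20₁ : τ₁.reg 20 = m := by rw [hfr₁.reg 20 (by decide)]; simpa using h20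
    have h1₁ : τ₁.reg 1 = d := by rw [hfr₁.reg 1 (by decide)]; simpa using h1'
    have h24₁ : τ₁.reg 24 = (i * d : ℕ) := by rw [hfr₁.reg 24 (by decide)]; simp
    refine Runs.seq_assign (T₂ := d * 20 + 60) (τ.arr 8 (code i)) ?_ (by simp [Expr.cost]; omega) ?_
    · simp only [eval, h22, ha 8 (by decide)]
      rw [Nat.floor_natCast]
    refine Runs.ite (T₁ := d * 20 + 30) ?_ ?_ (by simp [Test.cost, Expr.cost]; omega)
    · rintro ⟨⟨hb1, hb2⟩, hb3, hb4⟩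
      simp [Holds, eval, h20₁, h22, ha 9 (by decide)] at hb1 hb2 hb3 hb4
      refine Runs.skip ⟨rep, m, by simp [h20₁], ?_, ?_⟩ (by omega)
      · intro j hj
        obtain ⟨ha1, ha2, ha3, ha4⟩ := hrep j hj
        simp [ha 9 (by decide), ha 8 (by decide), ha 1 (by decide)]
        exact ⟨by omega, ha2, ha3, ha4⟩
      · intro i' hi'
        rcases Nat.lt_succ_iff_lt_or_eq.mp hi' with hi' | rfl
        · exact hcov i' hi'
        · set g := ⌊τ.arr 8 (code i')⌋₊ with hg
          have hgm : g < m := by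
            -- A stale dictionary entry may be negative; its address is then 0, which is valid
            -- because the test also requires a positive count.
            rcases le_or_gt 0 (τ.arr 8 (code i')) with h | h
            · have := Nat.floor_le h
              have : (g : ℝ) + 1 ≤ m := by linarith
              exact_mod_cast this
            · rw [hg, Nat.floor_of_nonpos h.le]; omega
          refine ⟨g, hgm, ?_⟩
          have h9 := (hrep g hgm).2.1
          have : (code (rep g) : ℝ) = code i' := by
            rw [← h9]; exact le_antisymm hb3 hb4
          exact_mod_cast this
    · intro hb
      have hnew : ∀ j < m, code (rep j) ≠ code i := by
        intro j hj hji
        apply hb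
        obtain ⟨ha1, ha2, ha3, ha4⟩ := hrep j hj
        rw [hji] at ha2 ha3
        simp only [Holds, eval, State.setReg_reg, State.setReg_arr, ha3]
        simp [h20₁, h22, ha 9 (by decide), ha2]
        refine ⟨⟨by omega, ?_⟩, le_rfl, le_rfl⟩
        exact_mod_cast (by omega : j + 1 ≤ m)
      refine Runs.seq_store (T₂ := d * 20 + 24) (code i) m (by simp [eval, h22, code])
        (by simp [eval, h20₁]) (by simp [Expr.cost]; omega) ?_
      refine Runs.seq_store (T₂ := d * 20 + 18) m (code i) (by simp [eval, h20₁])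
        (by simp [eval, h22, code]) (by simp [Expr.cost]; omega) ?_
      refine Runs.seq (T₁ := d * 20 + 12) (T₂ := 4) (runs_copyProg (d := d) (i := i) (m := m)
        (by simp [h1₁]) (by simp [h24₁]) (by simp [h20₁])) ?_ (by omega)
      rintro τ₂ ⟨hc1, hc2⟩ hfr₂
      have h20₂ : τ₂.reg 20 = m := by rw [hfr₂.reg 20 (by decide)]; simpa using h20₁
      have h8₂ := hfr₂.arr 8 (by decide)
      have h9₂ := hfr₂.arr 9 (by decide)
      refine Runs.assign (m + 1 : ℕ) (by simp [eval, h20₂]) (by simp [Expr.cost])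
        ⟨fun j => if j = m then i else rep j, m + 1, by simp, ?_, ?_⟩
      · intro j hj
        simp only [State.setReg_arr, h8₂, h9₂]
        by_cases hjm : j = m
        · subst hjm
          simp [code]
          intro c hc
          rw [hc1 c hc]
          simp [ha 0 (by decide), h0']
        · have hj' : j < m := by omega
          obtain ⟨ha1, ha2, ha3, ha4⟩ := hrep j hj'
          simp [hjm, hnew j hj', ha 8 (by decide), ha 9 (by decide)]
          refine ⟨by omega, ha2, ha3, fun c hc => ?_⟩
          rw [hc2, ← ha4 c hc]
          · simp [ha 1 (by decide)]
          · calc j * d + c < j * d + d := by omega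
              _ = (j + 1) * d := by ring
              _ ≤ m * d := Nat.mul_le_mul_right _ hj'
      · intro i' hi'
        rcases Nat.lt_succ_iff_lt_or_eq.mp hi' with hi' | rfl
        · obtain ⟨j, hj, hj'⟩ := hcov i' hi'
          exact ⟨j, by omega, by simpa [show j ≠ m by omega] using hj'⟩
        · exact ⟨m, by omega, by simp⟩
  · rintro τ ⟨rep, m, h20, hrep, hcov⟩ _ hfr
    have hm : rowCount L d n = m := by
      have : (Finset.range n).image code = (Finset.range m).image (fun j => code (rep j)) := by
        ext z
        simp only [Finset.mem_image, Finset.mem_range]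
        constructor
        · rintro ⟨i, hi, rfl⟩; exact hcov i hi
        · rintro ⟨j, hj, rfl⟩; exact ⟨_, (hrep j hj).1, rfl⟩
      rw [rowCount, this, Finset.card_image_of_injOn, Finset.card_range]
      -- Array `8` recovers `j` from the code of its representative, so distinct output rows have
      -- distinct codes.
      intro j hj j' hj' hjj
      simp only [Finset.coe_range, Set.mem_Iio] at hj hj'
      have h1 := (hrep j hj).2.2.1
      have h2 := (hrep j' hj').2.2.1
      simp only at hjj
      rw [hjj, h2] at h1
      exact_mod_cast h1.symm
    rw [hm]
    refine ⟨h20, rep, fun j hj => ⟨(hrep j hj).1, (hrep j hj).2.2.2⟩, fun i hi => ?_⟩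
    obtain ⟨j, hj, hj'⟩ := hcov i hi
    exact ⟨j, hj, (rowCode_eq_iff L d _ _ d).mp hj'⟩

/-! ### Merge sort -/

/-- `b` lists the first `i` entries of `u` and the first `j` entries of `v` in the order of their
keys, and these keys are at most those of the remaining entries. -/
structure MergeInv (key : ℕ → ℝ) (w : ℕ) (u v b : ℕ → ℝ) (i j : ℕ) : Prop where
  le_left : i ≤ w
  le_right : j ≤ w
  sorted : ∀ x y, x ≤ y → y < i + j → key ⌊b x⌋₊ ≤ key ⌊b y⌋₊
  left : ∀ x < i + j, ∀ y, i ≤ y → y < w → key ⌊b x⌋₊ ≤ key ⌊u y⌋₊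
  right : ∀ x < i + j, ∀ y, j ≤ y → y < w → key ⌊b x⌋₊ ≤ key ⌊v y⌋₊
  cover_left : ∀ x < i, ∃ y < i + j, b y = u x
  cover_right : ∀ x < j, ∃ y < i + j, b y = v x

namespace MergeInv

variable {key : ℕ → ℝ} {w : ℕ} {u v b b' : ℕ → ℝ} {i j : ℕ}

theorem zero : MergeInv key w u v b 0 0 := by
  constructor <;> simp

theorem symm (h : MergeInv key w u v b i j) : MergeInv key w v u b j i where
  le_left := h.le_right
  le_right := h.le_left
  sorted := by rw [add_comm]; exact h.sorted
  left := by rw [add_comm]; exact h.right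
  right := by rw [add_comm]; exact h.left
  cover_left := by rw [add_comm]; exact h.cover_right
  cover_right := by rw [add_comm]; exact h.cover_left

/-- Advances the left run; advancing the right run is the same statement after `symm`. -/
theorem step (h : MergeInv key w u v b i j) (hi : i < w)
    (hu : ∀ x y, x ≤ y → y < w → key ⌊u x⌋₊ ≤ key ⌊u y⌋₊)
    (hv : ∀ x y, x ≤ y → y < w → key ⌊v x⌋₊ ≤ key ⌊v y⌋₊)
    (huv : j < w → key ⌊u i⌋₊ ≤ key ⌊v j⌋₊)
    (hb : ∀ y < i + j, b' y = b y) (hb' : b' (i + j) = u i) : MergeInv key w u v b' (i + 1) j where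
  le_left := hi
  le_right := h.le_right
  sorted x y hxy hy := by
    rcases (by omega : y < i + j ∨ y = i + j) with hy | rfl
    · rw [hb x (by omega), hb y hy]; exact h.sorted x y hxy hy
    · rcases (by omega : x < i + j ∨ x = i + j) with hx | rfl
      · rw [hb', hb x hx]; exact h.left x hx i le_rfl hi
      · exact le_rfl
  left x hx y hy hyw := by
    rcases (by omega : x < i + j ∨ x = i + j) with hx | rfl
    · rw [hb x hx]; exact h.left x hx y (by omega) hyw
    · rw [hb']; exact hu i y (by omega) hyw
  right x hx y hy hyw := by
    rcases (by omega : x < i + j ∨ x = i + j) with hx | rfl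
    · rw [hb x hx]; exact h.right x hx y (by omega) hyw
    · rw [hb']; exact (huv (by omega)).trans (hv j y hy hyw)
  cover_left x hx := by
    rcases (by omega : x < i ∨ x = i) with hx | rfl
    · obtain ⟨y, hy, hy'⟩ := h.cover_left x hx
      exact ⟨y, by omega, by rw [hb y hy, hy']⟩
    · exact ⟨x + j, by omega, hb'⟩
  cover_right x hx := by
    obtain ⟨y, hy, hy'⟩ := h.cover_right x hx
    exact ⟨y, by omega, by rw [hb y hy, hy']⟩

end MergeInv

/-- The entries of `A` at `a, …, a + w - 1` are these numbers themselves, ordered by their keys. -/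
structure SortedRun (key A : ℕ → ℝ) (a w : ℕ) : Prop where
  sorted : ∀ x y, x ≤ y → y < w → key ⌊A (a + x)⌋₊ ≤ key ⌊A (a + y)⌋₊
  cover : ∀ q < w, ∃ x < w, A (a + x) = (a + q : ℕ)

theorem SortedRun.congr {key A A' : ℕ → ℝ} {a w : ℕ} (h : SortedRun key A a w)
    (hA : ∀ x < w, A' (a + x) = A (a + x)) : SortedRun key A' a w where
  sorted x y hxy hy := by rw [hA x (by omega), hA y hy]; exact h.sorted x y hxy hy
  cover q hq := by
    obtain ⟨x, hx, hx'⟩ := h.cover q hq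
    exact ⟨x, hx, by rw [hA x hx, hx']⟩

/-- Once both runs are exhausted, every index of either half occurs in the merged run, because it
occurs in its own half. -/
theorem MergeInv.sortedRun {key A B : ℕ → ℝ} {a w : ℕ} (h1 : SortedRun key A a w)
    (h2 : SortedRun key A (a + w) w)
    (h : MergeInv key w (fun x => A (a + x)) (fun x => A (a + w + x)) (fun x => B (a + x)) w w) :
    SortedRun key B a (2 * w) where
  sorted x y hxy hy := h.sorted x y hxy (by omega)
  cover q hq := by
    rcases lt_or_ge q w with hqw | hqw
    · obtain ⟨x, hx, hx'⟩ := h1.cover q hqw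
      obtain ⟨y, hy, hy'⟩ := h.cover_left x hx
      exact ⟨y, by omega, by rw [← hx']; exact hy'⟩
    · obtain ⟨x, hx, hx'⟩ := h2.cover (q - w) (by omega)
      obtain ⟨y, hy, hy'⟩ := h.cover_right x hx
      refine ⟨y, by omega, ?_⟩
      rw [(by omega : a + q = a + w + (q - w)), ← hx']
      exact hy'

/-- Merges two adjacent runs of array `I` of length `reg 10 / 2` that start at `reg 16` into
array `J`; array `K` holds the keys. -/
def mergeProg (K I J : ℕ) : Prog :=
  forUp 17 10 <|
    ite (and (le (add (reg 12) (const 1)) (reg 14))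
        (not (and (le (add (reg 13) (const 1)) (reg 15))
          (not (le (get K (get I (reg 12))) (get K (get I (reg 13))))))))
      (seq (store J (add (reg 16) (reg 17)) (get I (reg 12)))
        (assign 12 (add (reg 12) (const 1))))
      (seq (store J (add (reg 16) (reg 17)) (get I (reg 13)))
        (assign 13 (add (reg 13) (const 1))))

/-- Writes `0, …, M - 1` into array `I`, where register `4` holds `M`. -/
def iotaProg (I : ℕ) : Prog := forUp 6 4 (store I (reg 6) (reg 6))

/-- Copies the first `M` entries of array `J` to array `I`, where register `4` holds `M`. -/
def moveProg (I J : ℕ) : Prog := forUp 6 4 (store I (reg 6) (get J (reg 6)))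

/-- Merges all pairs of adjacent runs of length `reg 7` and doubles this length. -/
def passProg (K I J : ℕ) : Prog :=
  seq (assign 10 (mul (const 2) (reg 7))) <|
  seq (assign 9 (div (reg 4) (reg 10))) <|
  seq (forUp 11 9 <|
    seq (assign 16 (mul (reg 11) (reg 10))) <|
    seq (assign 12 (reg 16)) <|
    seq (assign 13 (add (reg 16) (reg 7))) <|
    seq (assign 14 (reg 13)) <|
    seq (assign 15 (add (reg 16) (reg 10))) <|
    mergeProg K I J) <|
  seq (moveProg I J) <|
  assign 7 (reg 10)

/-- Writes into array `I` the order of the first `M = 2 ^ k` entries of array `K`, where registers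
`4` and `5` hold `M` and `k`. -/
def sortProg (K I J : ℕ) : Prog :=
  seq (iotaProg I) <| seq (assign 7 (const 1)) <| forUp 8 5 (passProg K I J)

variable {ω : Tape}

/-- The pairs of runs are merged from left to right, so it suffices that a merge leaves the entries
below its start intact. -/
theorem runs_mergeProg {σ : State} {K I J a w : ℕ} (hKJ : K ≠ J) (hIJ : I ≠ J)
    (h10 : σ.reg 10 = (2 * w : ℕ)) (h12 : σ.reg 12 = a) (h13 : σ.reg 13 = (a + w : ℕ))
    (h14 : σ.reg 14 = (a + w : ℕ)) (h15 : σ.reg 15 = (a + 2 * w : ℕ)) (h16 : σ.reg 16 = a)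
    (hr1 : SortedRun (σ.arr K) (σ.arr I) a w) (hr2 : SortedRun (σ.arr K) (σ.arr I) (a + w) w) :
    Runs ω (mergeProg K I J) σ (w * 120 + 10) fun τ =>
      SortedRun (σ.arr K) (τ.arr J) a (2 * w) ∧ ∀ y < a, τ.arr J y = σ.arr J y := by
  refine Runs.forUp (T₁ := 50) (2 * w) (fun o τ => (∃ i j, i + j = o ∧ τ.reg 12 = (a + i : ℕ) ∧
      τ.reg 13 = (a + w + j : ℕ) ∧ MergeInv (σ.arr K) w (fun x => σ.arr I (a + x))
        (fun x => σ.arr I (a + w + x)) (fun x => τ.arr J (a + x)) i j) ∧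
      ∀ y < a, τ.arr J y = σ.arr J y)
    h10 (by simp [Prog.regs]) (by simp [Prog.regs]) (by decide)
    ⟨⟨0, 0, rfl, by simp [h12], by simp [h13], .zero⟩, by simp⟩ ?_ (by omega) ?_
  · rintro o ho τ ⟨⟨i, j, rfl, h12', h13', hinv⟩, hlow⟩ h17 _ hfr
    have hK : τ.arr K = σ.arr K := hfr.arr K (by simp [Prog.arrs, forUp, hKJ])
    have hI : τ.arr I = σ.arr I := hfr.arr I (by simp [Prog.arrs, forUp, hIJ])
    have h14' : τ.reg 14 = (a + w : ℕ) := by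
      rw [hfr.reg 14 (by simp [Prog.regs, forUp]), h14]
    have h15' : τ.reg 15 = (a + 2 * w : ℕ) := by
      rw [hfr.reg 15 (by simp [Prog.regs, forUp]), h15]
    have h16' : τ.reg 16 = a := by
      rw [hfr.reg 16 (by simp [Prog.regs, forUp]), h16]
    have hlt1 : (le (add (reg 12) (const 1)) (reg 14)).Holds τ ↔ i < w := by
      simp only [Holds, eval, h12', h14', Rat.cast_one]
      norm_cast; omega
    have hlt2 : (le (add (reg 13) (const 1)) (reg 15)).Holds τ ↔ j < w := by
      simp only [Holds, eval, h13', h15', Rat.cast_one]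
      norm_cast; omega
    have hle : (le (get K (get I (reg 12))) (get K (get I (reg 13)))).Holds τ ↔
        σ.arr K ⌊σ.arr I (a + i)⌋₊ ≤ σ.arr K ⌊σ.arr I (a + w + j)⌋₊ := by
      simp only [Holds, eval, h12', h13', hK, hI, Nat.floor_natCast]
    refine Runs.ite (T₁ := 11) ?_ ?_ (by simp [Test.cost, Expr.cost])
    · rintro ⟨hb1, hb2⟩
      rw [hlt1] at hb1
      have hb2' : j < w → σ.arr K ⌊σ.arr I (a + i)⌋₊ ≤ σ.arr K ⌊σ.arr I (a + w + j)⌋₊ := by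
        intro hj
        by_contra hcon
        exact hb2 ⟨hlt2.mpr hj, fun h => hcon (hle.mp h)⟩
      refine Runs.seq_store (T₂ := 4) (a + (i + j)) (σ.arr I (a + i)) (by simp [eval, h16', h17])
        (by simp only [eval, h12', hI, Nat.floor_natCast]) (by simp [Expr.cost]) ?_
      refine Runs.assign (a + (i + 1) : ℕ) (by simp [eval, h12']; ring) (by simp [Expr.cost])
        ⟨⟨i + 1, j, by omega, by simp, by simp [h13'], ?_⟩, ?_⟩
      · refine hinv.step hb1 hr1.sorted hr2.sorted hb2' ?_ ?_
        · intro y hy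
          have : y ≠ i + j := by omega
          simp [this]
        · simp
      · intro y hy
        have : y ≠ a + (i + j) := by omega
        simp [this, hlow y hy]
    · intro hb
      have hij : i + j < 2 * w := ho
      have hj : j < w := by
        by_contra hj
        have := hinv.le_right
        exact hb ⟨hlt1.mpr (by omega), fun h => hj (hlt2.mp h.1)⟩
      have hb2' : i < w → σ.arr K ⌊σ.arr I (a + w + j)⌋₊ ≤ σ.arr K ⌊σ.arr I (a + i)⌋₊ := by
        intro hi
        by_contra hcon
        exact hb ⟨hlt1.mpr hi, fun h => h.2 (hle.mpr (not_le.mp hcon).le)⟩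
      refine Runs.seq_store (T₂ := 4) (a + (i + j)) (σ.arr I (a + w + j))
        (by simp [eval, h16', h17])
        (by simp only [eval, h13', hI, Nat.floor_natCast]) (by simp [Expr.cost]) ?_
      refine Runs.assign (a + w + (j + 1) : ℕ) (by simp [eval, h13']; ring) (by simp [Expr.cost])
        ⟨⟨i, j + 1, by omega, by simp [h12'], by simp, ?_⟩, ?_⟩
      · refine (hinv.symm.step hj hr2.sorted hr1.sorted hb2' ?_ ?_).symm
        · intro y hy
          have : y ≠ i + j := by omega
          simp [this]
        · simp [add_comm]
      · intro y hy
        have : y ≠ a + (i + j) := by omega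
        simp [this, hlow y hy]
  · rintro τ ⟨⟨i, j, hij, _, _, hinv⟩, hlow⟩ _ _
    have := hinv.le_left
    have := hinv.le_right
    obtain rfl : i = w := by omega
    obtain rfl : j = i := by omega
    exact ⟨hinv.sortedRun hr1 hr2, hlow⟩

theorem runs_iotaProg {σ : State} {I M : ℕ} (h4 : σ.reg 4 = M) :
    Runs ω (iotaProg I) σ (M * 20 + 8) fun τ => ∀ x < M, τ.arr I x = x := by
  refine Runs.forUp (T₁ := 10) M (fun i τ => ∀ x < i, τ.arr I x = x) h4
    (by simp [Prog.regs]) (by simp [Prog.regs]) (by decide) (by simp) ?_ le_rfl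
    (fun τ h _ _ => h)
  intro i hi τ hI h6 _ _
  refine Runs.store i i (by simp [eval, h6]) (by simp [eval, h6]) (by simp [Expr.cost]) ?_
  intro x hx
  by_cases h : x = i
  · subst h; simp
  · simp [h, hI x (by omega)]

theorem runs_moveProg {σ : State} {I J M : ℕ} (hIJ : I ≠ J) (h4 : σ.reg 4 = M) :
    Runs ω (moveProg I J) σ (M * 20 + 8) fun τ => ∀ x < M, τ.arr I x = σ.arr J x := by
  refine Runs.forUp (T₁ := 10) M (fun i τ => ∀ x < i, τ.arr I x = σ.arr J x) h4
    (by simp [Prog.regs]) (by simp [Prog.regs]) (by decide) (by simp) ?_ le_rfl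
    (fun τ h _ _ => h)
  intro i hi τ hI h6 _ hfr
  have hJ : τ.arr J = σ.arr J := hfr.arr J (by simp [Prog.arrs, forUp, hIJ.symm])
  refine Runs.store i (σ.arr J i) (by simp [eval, h6]) (by simp [eval, h6, hJ])
    (by simp [Expr.cost]) ?_
  intro x hx
  by_cases h : x = i
  · subst h; simp
  · simp [h, hI x (by omega)]

theorem runs_passProg {σ : State} {K I J w b : ℕ} (hKJ : K ≠ J) (hIJ : I ≠ J)
    (hw : 0 < w) (h4 : σ.reg 4 = (b * (2 * w) : ℕ)) (h7 : σ.reg 7 = w)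
    (hr : ∀ r < 2 * b, SortedRun (σ.arr K) (σ.arr I) (r * w) w) :
    Runs ω (passProg K I J) σ (b * (2 * w) * 120 + 40) fun τ => τ.reg 7 = (2 * w : ℕ) ∧
      ∀ r < b, SortedRun (σ.arr K) (τ.arr I) (r * (2 * w)) (2 * w) := by
  have hbw : b ≤ b * w := Nat.le_mul_of_pos_right _ hw
  have hTb : b * (w * 120 + 60) + b * (2 * w) * 20 + 40 ≤ b * (2 * w) * 120 + 40 := by
    have h1 : b * (w * 120 + 60) = b * w * 120 + b * 60 := by ring
    have h2 : b * (2 * w) = 2 * (b * w) := by ring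
    rw [h1, h2]
    omega
  refine Runs.seq_assign (T₂ := b * (w * 120 + 60) + b * (2 * w) * 20 + 36) (2 * w : ℕ)
    (by simp [eval, h7]) (by simp [Expr.cost]; omega) ?_
  refine Runs.seq_assign (T₂ := b * (w * 120 + 60) + b * (2 * w) * 20 + 30) b ?_
    (by simp [Expr.cost]; omega) ?_
  -- The division is exact because the total length is a multiple of `2 * w`.
  · simp [eval, h4]; field_simp
  refine Runs.seq (T₁ := b * (w * 120 + 60) + 8) (T₂ := b * (2 * w) * 20 + 20)
    (Q₁ := fun τ => ∀ r < b, SortedRun (σ.arr K) (τ.arr J) (r * (2 * w)) (2 * w)) ?_ ?_ (by omega)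
  · refine Runs.forUp (T₁ := w * 120 + 50) b
      (fun i τ => ∀ r < i, SortedRun (σ.arr K) (τ.arr J) (r * (2 * w)) (2 * w)) (by simp)
      (by simp [Prog.regs, mergeProg, forUp]) (by simp [Prog.regs, mergeProg, forUp]) (by decide)
      (by simp) ?_ le_rfl (fun τ h _ _ => h)
    intro i hi τ hinv h11 _ hfr
    have hreg (y : ℕ) (hy : y ∉ [11, 16, 12, 13, 14, 15, 17]) (h9 : y ≠ 9) (h10 : y ≠ 10) :
        τ.reg y = σ.reg y := by
      rw [hfr.reg y (by simp at hy; simp [Prog.regs, forUp, mergeProg]; tauto)]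
      simp [h9, h10]
    have h7' : τ.reg 7 = w := by rw [hreg 7 (by decide) (by decide) (by decide), h7]
    have h10' : τ.reg 10 = (2 * w : ℕ) := by
      rw [hfr.reg 10 (by simp [Prog.regs, forUp, mergeProg])]; simp
    have hK : τ.arr K = σ.arr K := by
      rw [hfr.arr K (by simp [Prog.arrs, forUp, mergeProg, hKJ])]; simp
    have hI : τ.arr I = σ.arr I := by
      rw [hfr.arr I (by simp [Prog.arrs, forUp, mergeProg, hIJ])]; simp
    refine Runs.seq_assign (T₂ := w * 120 + 40) (i * (2 * w) : ℕ) (by simp [eval, h11, h10'])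
      (by simp [Expr.cost]; omega) ?_
    refine Runs.seq_assign (T₂ := w * 120 + 30) (i * (2 * w) : ℕ) (by simp [eval])
      (by simp [Expr.cost]; omega) ?_
    refine Runs.seq_assign (T₂ := w * 120 + 25) (i * (2 * w) + w : ℕ) (by simp [eval, h7'])
      (by simp [Expr.cost]; omega) ?_
    refine Runs.seq_assign (T₂ := w * 120 + 20) (i * (2 * w) + w : ℕ) (by simp [eval])
      (by simp [Expr.cost]; omega) ?_
    refine Runs.seq_assign (T₂ := w * 120 + 10) (i * (2 * w) + 2 * w : ℕ) (by simp [eval, h10'])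
      (by simp [Expr.cost]; omega) ?_
    refine (runs_mergeProg (a := i * (2 * w)) (w := w) hKJ hIJ (by simp [h10']) (by simp)
      (by simp) (by simp) (by simp) (by simp) ?_ ?_).mono le_rfl ?_
    · simp only [State.setReg_arr, hK, hI]
      have := hr (2 * i) (by omega)
      rwa [show 2 * i * w = i * (2 * w) by ring] at this
    · simp only [State.setReg_arr, hK, hI]
      have := hr (2 * i + 1) (by omega)
      rwa [show (2 * i + 1) * w = i * (2 * w) + w by ring] at this
    · rintro τ' ⟨h1, h2⟩ _ r hr'
      simp only [State.setReg_arr, hK] at h1 h2 ⊢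
      rcases Nat.lt_succ_iff_lt_or_eq.mp hr' with hr' | rfl
      · refine (hinv r hr').congr fun x hx => h2 _ ?_
        calc r * (2 * w) + x < r * (2 * w) + 2 * w := by omega
          _ = (r + 1) * (2 * w) := by ring
          _ ≤ i * (2 * w) := Nat.mul_le_mul_right _ hr'
      · exact h1
  · intro τ hτ hfr
    have h4' : τ.reg 4 = (b * (2 * w) : ℕ) := by
      rw [hfr.reg 4 (by simp [Prog.regs, forUp, mergeProg])]; simp [h4]
    have h10' : τ.reg 10 = (2 * w : ℕ) := by
      rw [hfr.reg 10 (by simp [Prog.regs, forUp, mergeProg])]; simp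
    refine Runs.seq (T₁ := b * (2 * w) * 20 + 8) (T₂ := 5) (runs_moveProg hIJ h4') ?_ (by omega)
    intro τ' hτ' hfr'
    have h10'' : τ'.reg 10 = (2 * w : ℕ) := by
      rw [hfr'.reg 10 (by simp [Prog.regs, forUp, moveProg]), h10']
    refine Runs.assign (2 * w : ℕ) (by simp [eval, h10'']) (by simp [Expr.cost]) ⟨by simp, ?_⟩
    intro r hr
    refine (hτ r hr).congr fun x hx => hτ' _ ?_
    calc r * (2 * w) + x < r * (2 * w) + 2 * w := by omega
      _ = (r + 1) * (2 * w) := by ring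
      _ ≤ b * (2 * w) := Nat.mul_le_mul_right _ hr

/-- Bottom-up merge sort of indices. A length that is a power of two keeps all runs of a pass
equally long; `k` passes of linear time are made. -/
theorem runs_sortProg {σ : State} {K I J k : ℕ} (hKI : K ≠ I) (hKJ : K ≠ J) (hIJ : I ≠ J)
    (h4 : σ.reg 4 = (2 ^ k : ℕ)) (h5 : σ.reg 5 = k) :
    Runs ω (sortProg K I J) σ ((k + 1) * (2 ^ k * 180)) fun τ =>
      SortedRun (σ.arr K) (τ.arr I) 0 (2 ^ k) := by
  have hpos : 0 < 2 ^ k := by positivity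
  have e : (k + 1) * (2 ^ k * 180) = k * (2 ^ k * 180) + 2 ^ k * 180 := by ring
  have e2 : k * (2 ^ k * 120 + 50) ≤ k * (2 ^ k * 180) := Nat.mul_le_mul_left _ (by omega)
  refine Runs.seq (T₁ := 2 ^ k * 20 + 8) (T₂ := k * (2 ^ k * 120 + 50) + 12) (runs_iotaProg h4) ?_
    (by omega)
  intro τ hτ hfr
  have h5' : τ.reg 5 = k := by rw [hfr.reg 5 (by simp [Prog.regs, forUp, iotaProg]), h5]
  have h4' : τ.reg 4 = (2 ^ k : ℕ) := by rw [hfr.reg 4 (by simp [Prog.regs, forUp, iotaProg]), h4]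
  have hK' : τ.arr K = σ.arr K := hfr.arr K (by simp [Prog.arrs, forUp, iotaProg, hKI])
  refine Runs.seq_assign (T₂ := k * (2 ^ k * 120 + 50) + 8) 1 (by simp [eval])
    (by simp [Expr.cost]; omega) ?_
  refine Runs.forUp (T₁ := 2 ^ k * 120 + 40) k (fun i τ => τ.reg 7 = (2 ^ i : ℕ) ∧
    ∀ r < 2 ^ (k - i), SortedRun (σ.arr K) (τ.arr I) (r * 2 ^ i) (2 ^ i)) (by simp [h5'])
    (by simp [Prog.regs, forUp, passProg, moveProg, mergeProg])
    (by simp [Prog.regs, forUp, passProg, moveProg, mergeProg]) (by decide) ?_ ?_ le_rfl ?_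
  · refine ⟨by simp, fun r hr => ⟨fun x y hxy hy => ?_, fun q hq => ⟨0, by simp, ?_⟩⟩⟩
    · obtain rfl : y = 0 := by simpa using hy
      obtain rfl : x = 0 := by omega
      exact le_rfl
    · obtain rfl : q = 0 := by simpa using hq
      simp
      exact hτ r (by simpa using hr)
  · rintro i hi τ' ⟨h7, hinv⟩ _ _ hfr'
    have hk : 2 ^ (k - i - 1) * (2 * 2 ^ i) = 2 ^ k := by
      rw [← pow_succ', ← pow_add]; congr 1; omega
    have hk2 : 2 * 2 ^ (k - i - 1) = 2 ^ (k - i) := by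
      rw [← pow_succ']; congr 1; omega
    have h4'' : τ'.reg 4 = (2 ^ k : ℕ) := by
      rw [hfr'.reg 4 (by simp [Prog.regs, forUp, passProg, moveProg, mergeProg])]
      simpa using h4'
    have hK'' : τ'.arr K = σ.arr K := by
      rw [hfr'.arr K (by simp [Prog.arrs, forUp, passProg, moveProg, mergeProg, hKI, hKJ])]
      simpa using hK'
    refine (runs_passProg (w := 2 ^ i) (b := 2 ^ (k - i - 1)) hKJ hIJ (by positivity)
      (by rw [h4'', hk]) h7 (by rw [hk2, hK'']; exact hinv)).mono (by rw [hk]) ?_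
    rintro τ'' ⟨h1, h2⟩ _
    refine ⟨by simp [h1, pow_succ'], fun r hr => ?_⟩
    rw [hK''] at h2
    have := h2 r (by rwa [show k - i - 1 = k - (i + 1) by omega])
    simpa [pow_succ'] using this
  · rintro τ' ⟨_, hinv⟩ _ _
    simpa using hinv 0 (by simp)

end RealRAM

/-! ### The optimal k-center value and partitions into rows -/

section KCenter

open RealRAM

variable {n d k : ℕ} (p : Fin n → EuclideanSpace ℝ (Fin d))

theorem kCenterCost_nonneg {X : Type*} [PseudoMetricSpace X] (P : Set X) (C : Finset X) :
    0 ≤ kCenterCost P C := Real.iSup_nonneg fun _ => Metric.infDist_nonneg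

theorem kCenterOpt_le_cost {X : Type*} [PseudoMetricSpace X] (P : Set X) (C : Finset X) :
    kCenterOpt C.card P ≤ kCenterCost P C :=
  ciInf_le (f := fun C' : {C' : Finset X // C'.card = C.card} => kCenterCost P C'.1)
    ⟨0, by rintro _ ⟨C, rfl⟩; exact kCenterCost_nonneg _ _⟩ ⟨C, rfl⟩

theorem infDist_le_kCenterCost {X : Type*} [PseudoMetricSpace X] {P : Set X} (hP : P.Finite)
    (C : Finset X) {x : X} (hx : x ∈ P) : Metric.infDist x (C : Set X) ≤ kCenterCost P C := by
  have : Finite P := hP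
  exact le_ciSup (f := fun q : P => Metric.infDist (q : X) (C : Set X))
    (Set.finite_range _).bddAbove ⟨x, hx⟩

/-- Each point is at distance at most the cost from one of the centers. -/
theorem exists_center {X : Type*} [PseudoMetricSpace X] {P : Set X} (hP : P.Finite)
    {C : Finset X} (hC : C.Nonempty) {x : X} (hx : x ∈ P) :
    ∃ c ∈ C, dist x c ≤ kCenterCost P C := by
  obtain ⟨c, hc, h⟩ := C.finite_toSet.isCompact.exists_infDist_eq_dist (by exact hC) x
  exact ⟨c, hc, h ▸ infDist_le_kCenterCost hP C hx⟩

/-- Needed since a real infimum over an empty family would be the default value 0. -/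
theorem nonempty_centers (hd : 1 ≤ d) :
    Nonempty {C : Finset (EuclideanSpace ℝ (Fin d)) // C.card = k} := by
  have : Nonempty (Fin d) := ⟨⟨0, hd⟩⟩
  have : Infinite (EuclideanSpace ℝ (Fin d)) := Module.Free.infinite ℝ _
  obtain ⟨C, hC⟩ := Infinite.exists_subset_card_eq (EuclideanSpace ℝ (Fin d)) k
  exact ⟨C, hC⟩

theorem abs_sub_apply_le_dist (x y : EuclideanSpace ℝ (Fin d)) (c : Fin d) :
    |x c - y c| ≤ dist x y := by
  rw [EuclideanSpace.dist_eq, ← Real.sqrt_sq_eq_abs]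
  apply Real.sqrt_le_sqrt
  have := Finset.single_le_sum (f := fun i => dist (x i) (y i) ^ 2) (fun i _ => sq_nonneg _)
    (Finset.mem_univ c)
  simpa [Real.dist_eq] using this

theorem dist_le_sqrt_mul {x y : EuclideanSpace ℝ (Fin d)} {R : ℝ} (hR : 0 ≤ R)
    (h : ∀ c, |x c - y c| ≤ R) : dist x y ≤ Real.sqrt d * R := by
  rw [EuclideanSpace.dist_eq, ← Real.sqrt_sq hR, ← Real.sqrt_mul (by positivity)]
  apply Real.sqrt_le_sqrt
  calc ∑ i, dist (x i) (y i) ^ 2 ≤ ∑ _i : Fin d, R ^ 2 := by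
        refine Finset.sum_le_sum fun i _ => ?_
        rw [Real.dist_eq]
        exact pow_le_pow_left₀ (abs_nonneg _) (h i) 2
    _ = d * R ^ 2 := by simp

/-- Pigeonhole: with more rows than centers, two points with different rows share a center. They are
at least `t` apart in some coordinate, and at most twice the cost apart. -/
theorem le_kCenterOpt_of_rowCount {L : ℕ → ℕ} {t : ℝ} (hd : 1 ≤ d) (hk : 1 ≤ k)
    (hL : ∀ i j : Fin n, ∀ c : Fin d, L (i * d + c) ≠ L (j * d + c) → t ≤ |p i c - p j c|)
    (hcount : k < rowCount L d n) : t ≤ 2 * kCenterOpt k (Set.range p) := by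
  have := nonempty_centers (k := k) hd
  suffices h : t / 2 ≤ kCenterOpt k (Set.range p) by linarith
  refine le_ciInf fun ⟨C, hC⟩ => ?_
  have hCne : C.Nonempty := Finset.card_pos.mp (by omega)
  choose f hfC hf using fun i : Fin n =>
    exists_center (Set.finite_range p) hCne (Set.mem_range_self i)
  have hex : ∃ i j : Fin n, f i = f j ∧ rowCode L d i d ≠ rowCode L d j d := by
    by_contra! hcon
    have hle : rowCount L d n ≤ C.card := by
      refine Finset.card_le_card_of_surjOn
        (fun c => if h : ∃ i, f i = c then rowCode L d h.choose d else 0) ?_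
      intro z hz
      simp only [Finset.coe_image, Finset.coe_range, Set.mem_image, Set.mem_Iio] at hz
      obtain ⟨i, hi, rfl⟩ := hz
      refine ⟨f ⟨i, hi⟩, hfC _, ?_⟩
      have h : ∃ i', f i' = f ⟨i, hi⟩ := ⟨_, rfl⟩
      simp only [h, dif_pos]
      exact hcon _ _ h.choose_spec
    omega
  obtain ⟨i, j, hij, hcode⟩ := hex
  rw [Ne, rowCode_eq_iff] at hcode
  push Not at hcode
  obtain ⟨c, hc, hcne⟩ := hcode
  have h1 := hL i j ⟨c, hc⟩ hcne
  have h2 := abs_sub_apply_le_dist (p i) (p j) ⟨c, hc⟩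
  have h3 := dist_triangle_right (p i) (p j) (f i)
  have h4 := hf i
  have h5 := hf j
  rw [← hij] at h5
  linarith

/-- One input point for each row serves as a center; the set is enlarged arbitrarily to have exactly
`k` elements. -/
theorem kCenterOpt_le_of_rowCount {L : ℕ → ℕ} {R : ℝ} (hn : 1 ≤ n) (hd : 1 ≤ d)
    (hL : ∀ i j : Fin n, (∀ c < d, L (i * d + c) = L (j * d + c)) → dist (p i) (p j) ≤ R)
    (hcount : rowCount L d n ≤ k) : kCenterOpt k (Set.range p) ≤ R := by
  have : Nonempty (Fin d) := ⟨⟨0, hd⟩⟩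
  have : Infinite (EuclideanSpace ℝ (Fin d)) := Module.Free.infinite ℝ _
  classical
  have hch : ∀ z ∈ (Finset.range n).image fun i => rowCode L d i d,
      ∃ i : Fin n, rowCode L d i d = z := by
    intro z hz
    obtain ⟨i, hi, rfl⟩ := Finset.mem_image.mp hz
    exact ⟨⟨i, Finset.mem_range.mp hi⟩, rfl⟩
  let g : ℕ → Fin n := fun z => if h : ∃ i : Fin n, rowCode L d i d = z then h.choose else ⟨0, hn⟩
  have hg : ∀ i : Fin n, rowCode L d (g (rowCode L d i d)) d = rowCode L d i d := by
    intro i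
    have h : ∃ i' : Fin n, rowCode L d i' d = rowCode L d i d := ⟨i, rfl⟩
    simp only [g, h, dif_pos]
    exact h.choose_spec
  obtain ⟨C, hC, hcard⟩ := Infinite.exists_superset_card_eq
    (((Finset.range n).image fun i => rowCode L d i d).image fun z => p (g z)) k
    (Finset.card_image_le.trans hcount)
  rw [← hcard]
  refine (kCenterOpt_le_cost _ _).trans ?_
  have : Nonempty (Set.range p) := ⟨⟨_, ⟨0, hn⟩, rfl⟩⟩
  refine ciSup_le ?_
  rintro ⟨_, i, rfl⟩
  have hmem : p (g (rowCode L d i d)) ∈ (C : Set (EuclideanSpace ℝ (Fin d))) := by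
    refine hC (Finset.mem_image_of_mem _ (Finset.mem_image_of_mem _ ?_))
    exact Finset.mem_range.mpr i.2
  refine (Metric.infDist_le_dist_of_mem hmem).trans (hL _ _ ?_)
  exact (rowCode_eq_iff _ _ _ _ _).mp (hg i).symm

theorem exists_ne_of_rowCount_lt {L : ℕ → ℕ} (hcount : rowCount L d n < n) :
    ∃ i j : Fin n, i ≠ j ∧ ∀ c < d, L (i * d + c) = L (j * d + c) := by
  obtain ⟨i, hi, j, hj, hij, h⟩ := Finset.exists_ne_map_eq_of_card_lt_of_maps_to
    (s := Finset.range n) (t := (Finset.range n).image fun i => rowCode L d i d)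
    (f := fun i => rowCode L d i d) (by simpa [rowCount] using hcount)
    (fun i hi => Finset.mem_coe.mpr (Finset.mem_image_of_mem _ hi))
  refine ⟨⟨i, Finset.mem_range.mp hi⟩, ⟨j, Finset.mem_range.mp hj⟩, by simpa using hij, ?_⟩
  exact (rowCode_eq_iff _ _ _ _ _).mp h

end KCenter

namespace RealRAM

/-! ### Gaps of a sorted sequence -/

/-- `ρ` lists the numbers below `M` in the order of their keys, and `π` is its inverse. -/
structure KeyOrder (key : ℕ → ℝ) (M : ℕ) (ρ π : ℕ → ℕ) : Prop where
  lt : ∀ x < M, ρ x < M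
  lt' : ∀ q < M, π q < M
  left_inv : ∀ x < M, π (ρ x) = x
  right_inv : ∀ q < M, ρ (π q) = q
  mono : ∀ x y, x ≤ y → y < M → key (ρ x) ≤ key (ρ y)

/-- A run of length `M` that contains all `M` indices is a permutation: choosing a position for each
index is injective, hence surjective on a finite set. -/
theorem SortedRun.exists_keyOrder {key A : ℕ → ℝ} {M : ℕ} (h : SortedRun key A 0 M) :
    ∃ ρ π, KeyOrder key M ρ π ∧ ∀ x < M, A x = ρ x := by
  have hc : ∀ q : Fin M, ∃ x : Fin M, A x = (q : ℕ) := by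
    intro q
    obtain ⟨x, hx, hx'⟩ := h.cover q q.2
    exact ⟨⟨x, hx⟩, by simpa using hx'⟩
  choose f hf using hc
  have hinj : Function.Injective f := by
    intro q q' hqq
    have := hf q
    rw [hqq, hf q'] at this
    exact (Fin.ext (by exact_mod_cast this)).symm
  have hsurj := Finite.surjective_of_injective hinj
  have hA : ∀ x < M, A x = (⌊A x⌋₊ : ℕ) ∧ ∃ hx : ⌊A x⌋₊ < M, f ⟨⌊A x⌋₊, hx⟩ = x := by
    intro x hx
    obtain ⟨q, hq⟩ := hsurj ⟨x, hx⟩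
    have h1 := hf q
    rw [hq] at h1
    simp only at h1
    rw [h1, Nat.floor_natCast]
    exact ⟨rfl, q.2, by simp [hq]⟩
  refine ⟨fun x => ⌊A x⌋₊, fun q => if hq : q < M then f ⟨q, hq⟩ else 0,
    ⟨fun x hx => (hA x hx).2.1, ?_, ?_, ?_, ?_⟩, fun x hx => (hA x hx).1⟩
  · intro q hq; simp [hq]
  · intro x hx
    obtain ⟨hx', e⟩ := (hA x hx).2
    simp [hx', e]
  · intro q hq; simp [hq, hf]
  · intro x y hxy hy; simpa using h.sorted x y hxy hy

/-- Gap between the keys of rank `x - 1` and `x`. -/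
def gap (key : ℕ → ℝ) (ρ : ℕ → ℕ) (x : ℕ) : ℝ :=
  if 1 ≤ x then key (ρ x) - key (ρ (x - 1)) else 0

/-- Number of entries of `G` at `0, …, x - 1` that are at least `t`. -/
noncomputable def cuts (G : ℕ → ℝ) (t : ℝ) (x : ℕ) : ℕ :=
  ((Finset.range x).filter fun y => t ≤ G y).card

theorem cuts_succ (G : ℕ → ℝ) (t : ℝ) (x : ℕ) :
    cuts G t (x + 1) = cuts G t x + if t ≤ G x then 1 else 0 := by
  rw [cuts, Finset.range_add_one, Finset.filter_insert]
  split_ifs with h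
  · rw [Finset.card_insert_of_notMem (by simp)]; rfl
  · rfl

/-- Index of the part that contains `q`, if the keys are cut at the gaps of length at least `t`. -/
noncomputable def label (key : ℕ → ℝ) (ρ π : ℕ → ℕ) (t : ℝ) (q : ℕ) : ℕ :=
  cuts (gap key ρ) t (π q + 1)

namespace KeyOrder

variable {key : ℕ → ℝ} {M : ℕ} {ρ π : ℕ → ℕ}

theorem gap_nonneg (h : KeyOrder key M ρ π) {x : ℕ} (hx : x < M) : 0 ≤ gap key ρ x := by
  rw [gap]; split_ifs
  · exact sub_nonneg.mpr (h.mono _ _ (by omega) hx)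
  · exact le_rfl

/-- Between the two ranks lies a cut, that is, a gap of length at least `t`; the remaining gaps are
nonnegative. -/
theorem le_key_sub_of_cuts_ne (h : KeyOrder key M ρ π) {t : ℝ} {x y : ℕ} (hxy : x ≤ y) (hy : y < M)
    (hne : cuts (gap key ρ) t (x + 1) ≠ cuts (gap key ρ) t (y + 1)) :
    t ≤ key (ρ y) - key (ρ x) := by
  induction y, hxy using Nat.le_induction with
  | base => exact absurd rfl hne
  | succ y hxy ih =>
    have hm := h.mono y (y + 1) (by omega) hy
    by_cases hc : cuts (gap key ρ) t (x + 1) = cuts (gap key ρ) t (y + 1)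
    · rw [cuts_succ _ _ (y + 1), hc] at hne
      have ht : t ≤ gap key ρ (y + 1) := by
        by_contra hcon; simp [hcon] at hne
      have hx := h.mono x y hxy (by omega)
      simp [gap] at ht
      linarith
    · have := ih (by omega) hc
      linarith

theorem le_abs_of_label_ne (h : KeyOrder key M ρ π) {t : ℝ} {q q' : ℕ} (hq : q < M) (hq' : q' < M)
    (hne : label key ρ π t q ≠ label key ρ π t q') : t ≤ |key q - key q'| := by
  have e := h.right_inv q hq
  have e' := h.right_inv q' hq'
  rcases le_total (π q) (π q') with hle | hle
  · have := h.le_key_sub_of_cuts_ne hle (h.lt' q' hq') hne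
    rw [e, e'] at this
    rw [abs_sub_comm]
    exact this.trans (le_abs_self _)
  · have := h.le_key_sub_of_cuts_ne hle (h.lt' q hq) hne.symm
    rw [e, e'] at this
    exact this.trans (le_abs_self _)

/-- The difference telescopes into uncut gaps. The separate bound `W` matters: in the application
`t` may be much larger than the largest gap below it. -/
theorem key_sub_le {t W : ℝ} (hW : ∀ x < M, gap key ρ x < t → gap key ρ x ≤ W) {x y : ℕ} (hxy : x ≤ y) (hy : y < M)
    (heq : cuts (gap key ρ) t (x + 1) = cuts (gap key ρ) t (y + 1)) :
    key (ρ y) - key (ρ x) ≤ (y - x : ℕ) * W := by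
  induction y, hxy using Nat.le_induction with
  | base => simp
  | succ y hxy ih =>
    have hmono : cuts (gap key ρ) t (x + 1) ≤ cuts (gap key ρ) t (y + 1) :=
      Finset.card_le_card (Finset.filter_subset_filter _ (by simpa using hxy))
    rw [cuts_succ _ _ (y + 1)] at heq
    have hlt : ¬ t ≤ gap key ρ (y + 1) := by
      intro hcon; simp only [hcon, if_true] at heq; omega
    simp only [hlt, if_false] at heq
    have h1 := ih (by omega) heq
    have h2 := hW (y + 1) hy (not_le.mp hlt)
    simp [gap] at h2
    rw [show y + 1 - x = (y - x) + 1 by omega]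
    push_cast
    linarith

theorem abs_le_of_label_eq (h : KeyOrder key M ρ π) {t W : ℝ} (hW0 : 0 ≤ W)
    (hW : ∀ x < M, gap key ρ x < t → gap key ρ x ≤ W) {q q' : ℕ} (hq : q < M) (hq' : q' < M)
    (heq : label key ρ π t q = label key ρ π t q') : |key q - key q'| ≤ M * W := by
  have e := h.right_inv q hq
  have e' := h.right_inv q' hq'
  have hl := h.lt' q hq
  have hl' := h.lt' q' hq'
  have key2 : ∀ a b, a ≤ b → b < M → ((b - a : ℕ) : ℝ) * W ≤ M * W := fun a b _ hb =>
    mul_le_mul_of_nonneg_right (by exact_mod_cast (by omega : b - a ≤ M)) hW0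
  rcases le_total (π q) (π q') with hle | hle
  · have h1 := key_sub_le hW hle hl' heq
    have h2 := h.mono _ _ hle hl'
    rw [e, e'] at h1 h2
    rw [abs_sub_comm, abs_of_nonneg (by linarith)]
    exact h1.trans (key2 _ _ hle hl')
  · have h1 := key_sub_le hW hle hl heq.symm
    have h2 := h.mono _ _ hle hl
    rw [e, e'] at h1 h2
    rw [abs_of_nonneg (by linarith)]
    exact h1.trans (key2 _ _ hle hl)

/-- At such a threshold every rank is cut, even between equal keys, so already the first column
distinguishes all rows. This starts the binary search. -/
theorem rowCount_label_of_nonpos (h : KeyOrder key M ρ π) {t : ℝ} (ht : t ≤ 0) {n d : ℕ}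
    (hd : 1 ≤ d) (hM : n * d ≤ M) : rowCount (label key ρ π t) d n = n := by
  have hlab : ∀ q < M, label key ρ π t q = π q + 1 := by
    intro q hq
    rw [label, cuts, Finset.filter_true_of_mem, Finset.card_range]
    intro y hy
    have := h.lt' q hq
    exact ht.trans (h.gap_nonneg (by simp at hy; omega))
  rw [rowCount, Finset.card_image_of_injOn, Finset.card_range]
  intro i hi j hj hij
  simp only [Finset.coe_range, Set.mem_Iio] at hi hj
  have h0 := (rowCode_eq_iff _ _ _ _ _).mp hij 0 hd
  have hb : ∀ i < n, i * d < M := fun i hi =>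
    (Nat.mul_lt_mul_of_pos_right hi hd).trans_le hM
  rw [hlab _ (by simpa using hb i hi), hlab _ (by simpa using hb j hj)] at h0
  have h1 : i * d + 0 = j * d + 0 := by
    rw [← h.right_inv (i * d + 0) (by simpa using hb i hi),
      ← h.right_inv (j * d + 0) (by simpa using hb j hj), (by omega : π (i * d + 0) = π (j * d + 0))]
  exact Nat.eq_of_mul_eq_mul_right hd (by simpa using h1)

end KeyOrder

/-! ### A coarse estimate of the optimal value -/

open RealRAM.Expr hiding cost
open RealRAM.Test hiding cost
open RealRAM.Prog

/-- Writes the gaps of the sorted sequence into array `4`. -/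
def gapProg : Prog :=
  forUp 33 4 <|
    ite (le (const 1) (reg 33))
      (store 4 (reg 33) (sub (get 0 (get 2 (reg 33))) (get 0 (get 2 (sub (reg 33) (const 1))))))
      (store 4 (reg 33) (const 0))

/-- Writes the labels for the threshold in register `30` into array `6`. -/
def labelProg : Prog :=
  seq (assign 31 (const 0)) <|
  forUp 32 4 <|
    seq (ite (le (reg 30) (get 4 (reg 32))) (assign 31 (add (reg 31) (const 1))) skip) <|
    store 6 (get 2 (reg 32)) (reg 31)

/-- Binary search for the largest gap that yields more than `k` distinct rows of labels. -/
def searchProg : Prog :=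
  seq (assign 34 (const 0)) <|
  seq (assign 35 (reg 4)) <|
  seq (forUp 36 5 <|
    seq (assign 35 (div (reg 35) (const 2))) <|
    seq (assign 30 (get 4 (get 5 (add (reg 34) (reg 35))))) <|
    seq labelProg <|
    seq countProg <|
    ite (le (add (reg 2) (const 1)) (reg 20)) (assign 34 (add (reg 34) (reg 35))) skip) <|
  assign 37 (get 4 (get 5 (reg 34)))

/-- Computes in register `37` an approximation of the optimal value, up to polynomial factors. -/
def coarseProg : Prog :=
  seq (sortProg 0 2 3) <| seq gapProg <| seq (sortProg 4 5 3) searchProg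

variable {ω : Tape}

theorem runs_gapProg {σ : State} {M : ℕ} {ρ : ℕ → ℕ} (h4 : σ.reg 4 = M)
    (hρ : ∀ x < M, σ.arr 2 x = ρ x) :
    Runs ω gapProg σ (M * 40 + 8) fun τ => ∀ x < M, τ.arr 4 x = gap (σ.arr 0) ρ x := by
  refine Runs.forUp (T₁ := 30) M (fun i τ => ∀ x < i, τ.arr 4 x = gap (σ.arr 0) ρ x) h4
    (by decide) (by decide) (by decide) (by simp) ?_ (by omega) (fun τ h _ _ => h)
  intro i hi τ hI h33 _ hfr
  have h0 : τ.arr 0 = σ.arr 0 := hfr.arr 0 (by decide)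
  have h2 : τ.arr 2 = σ.arr 2 := hfr.arr 2 (by decide)
  have hfin : ∀ v, v = gap (σ.arr 0) ρ i → ∀ x < i + 1,
      ((τ.setArr 4 i v).setReg 33 ((i + 1 : ℕ) : ℝ)).arr 4 x = gap (σ.arr 0) ρ x := by
    intro v hv x hx
    by_cases h : x = i
    · subst h; simp [hv]
    · simp [h, hI x (by omega)]
  refine Runs.ite (T₁ := 20) ?_ ?_ (by simp [Test.cost, Expr.cost])
  · intro hb
    simp [Holds, eval, h33] at hb
    refine Runs.store i _ (by simp [eval, h33]) rfl (by simp [Expr.cost]) (hfin _ ?_)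
    have hcast : (i : ℝ) - 1 = (i - 1 : ℕ) := by rw [Nat.cast_sub hb]; simp
    simp only [eval, h33, h0, h2, Rat.cast_one, hcast, Nat.floor_natCast, gap, hb, if_true]
    rw [hρ i hi, hρ (i - 1) (by omega), Nat.floor_natCast, Nat.floor_natCast]
  · intro hb
    have hi0 : i = 0 := by
      by_contra hcon
      apply hb
      simp [Holds, eval, h33]
      omega
    refine Runs.store i 0 (by simp [eval, h33]) (by simp [eval]) (by simp [Expr.cost])
      (hfin _ (by simp [gap, hi0]))

theorem runs_labelProg {σ : State} {key : ℕ → ℝ} {M : ℕ} {ρ π : ℕ → ℕ}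
    (ho : KeyOrder key M ρ π) (h4 : σ.reg 4 = M) (hρ : ∀ x < M, σ.arr 2 x = ρ x)
    (hg : ∀ x < M, σ.arr 4 x = gap key ρ x) :
    Runs ω labelProg σ (M * 40 + 10) fun τ =>
      ∀ q < M, τ.arr 6 q = label key ρ π (σ.reg 30) q := by
  refine Runs.seq_assign (T₂ := M * 40 + 8) 0 (by simp [eval]) (by simp [Expr.cost]; omega) ?_
  refine Runs.forUp (T₁ := 30) M (fun i τ => τ.reg 31 = cuts (gap key ρ) (σ.reg 30) i ∧
      ∀ x < i, τ.arr 6 (ρ x) = cuts (gap key ρ) (σ.reg 30) (x + 1)) (by simp [h4])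
    (by decide) (by decide) (by decide) (by simp [cuts]) ?_ (by omega) ?_
  · rintro i hi τ ⟨h31, hI⟩ h32 _ hfr
    have h30 : τ.reg 30 = σ.reg 30 := by rw [hfr.reg 30 (by decide)]; simp
    have h2 : τ.arr 2 = σ.arr 2 := hfr.arr 2 (by decide)
    have h4' : τ.arr 4 = σ.arr 4 := hfr.arr 4 (by decide)
    refine Runs.seq (T₁ := 10) (T₂ := 10)
      (Q₁ := fun τ' => τ'.reg 31 = cuts (gap key ρ) (σ.reg 30) (i + 1)) ?_ ?_ (by omega)
    · rw [cuts_succ]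
      refine Runs.ite (T₁ := 4) ?_ ?_ (by simp [Test.cost, Expr.cost])
      · intro hb
        simp [Holds, eval, h32, h30, h4', hg i hi] at hb
        exact Runs.assign _ rfl (by simp [Expr.cost]) (by simp [eval, h31, hb])
      · intro hb
        simp [Holds, eval, h32, h30, h4', hg i hi] at hb
        exact Runs.skip (by simp [h31, not_le.mpr hb]) (by omega)
    · intro τ₁ h31₁ hfr₁
      have h32₁ : τ₁.reg 32 = i := by rw [hfr₁.reg 32 (by decide), h32]
      have h6₁ : τ₁.arr 6 = τ.arr 6 := hfr₁.arr 6 (by decide)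
      have h2₁ : τ₁.arr 2 = σ.arr 2 := by rw [hfr₁.arr 2 (by decide), h2]
      refine Runs.store (ρ i) (cuts (gap key ρ) (σ.reg 30) (i + 1)) ?_ (by simp [eval, h31₁])
        (by simp [Expr.cost]) ⟨by simp [h31₁], fun x hx => ?_⟩
      · simp [eval, h32₁, h2₁, hρ i hi]
      · by_cases h : x = i
        · subst h; simp
        · have hne : ρ x ≠ ρ i := fun hcon => h (by
            rw [← ho.left_inv x (by omega), hcon, ho.left_inv i hi])
          simp [hne, h6₁, hI x (by omega)]
  · rintro τ ⟨_, hI⟩ _ _ q hq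
    have := hI (π q) (ho.lt' q hq)
    rwa [ho.right_inv q hq] at this

/-- Binary search keeps a rank whose gap gives more than `k` rows and a higher rank whose gap gives
at most `k` rows, or the end of the list. When they are adjacent, the lower gap yields both
estimates. No monotonicity of the row count is needed. -/
theorem runs_searchProg {σ : State} {key : ℕ → ℝ} {K n d k : ℕ} {ρ π ρ' π' : ℕ → ℕ}
    (ho : KeyOrder key (2 ^ K) ρ π) (ho' : KeyOrder (gap key ρ) (2 ^ K) ρ' π')
    (hd : 1 ≤ d) (hM : n * d ≤ 2 ^ K) (hk : 1 ≤ k) (hkn : k < n)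
    (h0 : σ.reg 0 = n) (h1 : σ.reg 1 = d) (h2 : σ.reg 2 = k)
    (h4 : σ.reg 4 = (2 ^ K : ℕ)) (h5 : σ.reg 5 = K) (hρ : ∀ x < 2 ^ K, σ.arr 2 x = ρ x)
    (hρ' : ∀ x < 2 ^ K, σ.arr 5 x = ρ' x) (hg : ∀ x < 2 ^ K, σ.arr 4 x = gap key ρ x) :
    Runs ω searchProg σ (K * (2 ^ K * 300) + 30) fun τ => 0 ≤ τ.reg 37 ∧
      (∃ L, k < rowCount L d n ∧
        ∀ q < 2 ^ K, ∀ q' < 2 ^ K, L q ≠ L q' → τ.reg 37 ≤ |key q - key q'|) ∧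
      ∃ L, rowCount L d n ≤ k ∧
        ∀ q < 2 ^ K, ∀ q' < 2 ^ K, L q = L q' → |key q - key q'| ≤ (2 ^ K : ℕ) * τ.reg 37 := by
  have hpos : 0 < 2 ^ K := by positivity
  set M := 2 ^ K with hMdef
  let t : ℕ → ℝ := fun x => gap key ρ (ρ' x)
  have hT1 : n * (d * 50 + 90) ≤ M * 140 := by
    calc n * (d * 50 + 90) ≤ n * (d * 140) := Nat.mul_le_mul_left _ (by omega)
      _ = n * d * 140 := by ring
      _ ≤ M * 140 := Nat.mul_le_mul_right _ hM
  refine Runs.seq_assign (T₂ := K * (M * 300) + 28) 0 (by simp [eval]) (by simp [Expr.cost]; omega) ?_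
  refine Runs.seq_assign (T₂ := K * (M * 300) + 26) M (by simp [eval, h4])
    (by simp [Expr.cost]; omega) ?_
  refine Runs.seq (T₁ := K * (M * 300) + 8) (T₂ := 10) (Q₁ := fun τ => ∃ pos, τ.reg 34 = (pos : ℕ) ∧
    pos + 1 ≤ M ∧ k < rowCount (label key ρ π (t pos)) d n ∧
      (pos + 1 < M → rowCount (label key ρ π (t (pos + 1))) d n ≤ k)) ?_ ?_ (by omega)
  · refine Runs.forUp (T₁ := M * 180 + 100) K (fun i τ => ∃ pos, τ.reg 34 = (pos : ℕ) ∧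
      τ.reg 35 = (2 ^ (K - i) : ℕ) ∧ pos + 2 ^ (K - i) ≤ M ∧
      k < rowCount (label key ρ π (t pos)) d n ∧ (pos + 2 ^ (K - i) < M →
        rowCount (label key ρ π (t (pos + 2 ^ (K - i)))) d n ≤ k)) (by simp [h5])
      (by decide) (by decide) (by decide) ?_ ?_ ?_ ?_
    · refine ⟨0, by simp, by simp [hMdef], by simp [hMdef], ?_, by simp [hMdef]⟩
      rw [ho.rowCount_label_of_nonpos _ hd hM]
      · exact hkn
      -- The smallest gap is at most the gap at rank 0, which is 0 by convention.
      · have := ho'.mono 0 (π' 0) (by omega) (ho'.lt' 0 hpos)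
        rw [ho'.right_inv 0 hpos] at this
        simpa [gap, t] using this
    · rintro i hi τ ⟨pos, h34, h35, hle, hlow, hhigh⟩ h36 _ hfr
      obtain ⟨w, hw⟩ : ∃ w, w = 2 ^ (K - (i + 1)) := ⟨_, rfl⟩
      have hw2 : 2 ^ (K - i) = 2 * w := by rw [hw, ← pow_succ']; congr 1; omega
      have hwpos : 0 < w := by rw [hw]; positivity
      rw [hw2] at h35 hle hhigh
      have hr (y : ℕ) (hy : y ∉ (forUp 36 5 <|
          seq (assign 35 (div (reg 35) (const 2))) <|
          seq (assign 30 (get 4 (get 5 (add (reg 34) (reg 35))))) <|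
          seq labelProg <|
          seq countProg <|
          ite (le (add (reg 2) (const 1)) (reg 20))
            (assign 34 (add (reg 34) (reg 35))) skip).regs)
          (hy1 : y ≠ 34) (hy2 : y ≠ 35) : τ.reg y = σ.reg y := by
        rw [hfr.reg y hy]; simp [hy1, hy2]
      have ha2 : τ.arr 2 = σ.arr 2 := hfr.arr 2 (by decide)
      have ha4 : τ.arr 4 = σ.arr 4 := hfr.arr 4 (by decide)
      have ha5 : τ.arr 5 = σ.arr 5 := hfr.arr 5 (by decide)
      have h0' := hr 0 (by decide) (by decide) (by decide)
      have h1' := hr 1 (by decide) (by decide) (by decide)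
      have h2' := hr 2 (by decide) (by decide) (by decide)
      have h4' := hr 4 (by decide) (by decide) (by decide)
      refine Runs.seq_assign (T₂ := M * 180 + 90) w (by simp [eval, h35])
        (by simp [Expr.cost]; omega) ?_
      refine Runs.seq_assign (T₂ := M * 180 + 80) (t (pos + w)) ?_ (by simp [Expr.cost]; omega) ?_
      · have hlt : pos + w < M := by omega
        simp only [eval, State.setReg_reg, State.setReg_arr, h34, ha4, ha5]
        norm_num
        rw [← Nat.cast_add, Nat.floor_natCast, hρ' _ hlt, Nat.floor_natCast, hg _ (ho'.lt _ hlt)]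
      refine Runs.seq (T₁ := M * 40 + 10) (T₂ := M * 140 + 50) (runs_labelProg ho
        (by simp [h4', h4]) (by simpa [ha2] using hρ) (by simpa [ha4] using hg)) ?_ (by omega)
      intro τ₁ hlab hfr₁
      simp only [State.setReg_reg, if_true] at hlab
      have hr₁ (y : ℕ) (hy : y ∉ labelProg.regs) (hy1 : y ≠ 30) (hy2 : y ≠ 35) :
          τ₁.reg y = τ.reg y := by rw [hfr₁.reg y hy]; simp [hy1, hy2]
      refine Runs.seq (T₁ := n * (d * 50 + 90) + 10) (T₂ := 30) (runs_countProg (n := n) (d := d)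
        (by rw [hr₁ 0 (by decide) (by decide) (by decide), h0', h0])
        (by rw [hr₁ 1 (by decide) (by decide) (by decide), h1', h1])
        (fun q hq => hlab q (hq.trans_le hM))) ?_ (by omega)
      rintro τ₂ ⟨h20, -⟩ hfr₂
      have h34₂ : τ₂.reg 34 = pos := by
        rw [hfr₂.reg 34 (by decide), hr₁ 34 (by decide) (by decide) (by decide), h34]
      have h35₂ : τ₂.reg 35 = w := by
        rw [hfr₂.reg 35 (by decide), hfr₁.reg 35 (by decide)]; simp
      have h2₂ : τ₂.reg 2 = k := by
        rw [hfr₂.reg 2 (by decide), hr₁ 2 (by decide) (by decide) (by decide), h2', h2]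
      have hbiff : (le (add (reg 2) (const 1)) (reg 20)).Holds τ₂ ↔
          k < rowCount (label key ρ π (t (pos + w))) d n := by
        simp only [Holds, eval, h2₂, h20, Rat.cast_one]
        norm_cast
      rw [← hw]
      refine Runs.ite (T₁ := 10) ?_ ?_ (by simp [Test.cost, Expr.cost])
      · intro hb
        rw [hbiff] at hb
        refine Runs.assign (pos + w : ℕ) (by simp [eval, h34₂, h35₂]) (by simp [Expr.cost])
          ⟨pos + w, by simp, by simp [h35₂], by omega, hb, ?_⟩
        rw [show pos + w + w = pos + 2 * w by ring]
        exact hhigh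
      · intro hb
        rw [hbiff, not_lt] at hb
        exact Runs.skip ⟨pos, by simp [h34₂], by simp [h35₂], by omega, hlow, fun _ => hb⟩ (by omega)
    · exact Nat.add_le_add_right (Nat.mul_le_mul_left _ (by omega)) 8
    · rintro τ ⟨pos, h34, -, hle, hlow, hhigh⟩ _ _
      exact ⟨pos, h34, by simpa using hle, hlow, by simpa using hhigh⟩
  · rintro τ ⟨pos, h34, hle, hlow, hhigh⟩ hfr
    have ha4 : τ.arr 4 = σ.arr 4 := hfr.arr 4 (by decide)
    have ha5 : τ.arr 5 = σ.arr 5 := hfr.arr 5 (by decide)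
    have hlt : pos < M := hle
    have ht0 : 0 ≤ t pos := ho.gap_nonneg (ho'.lt pos hlt)
    refine Runs.assign (t pos) ?_ (by simp [Expr.cost]) ⟨by simpa using ht0, ?_, ?_⟩
    · simp only [eval, h34, ha4, ha5]
      rw [Nat.floor_natCast, hρ' _ hlt, Nat.floor_natCast, hg _ (ho'.lt _ hlt)]
    · refine ⟨_, hlow, fun q hq q' hq' hne => ?_⟩
      simpa using ho.le_abs_of_label_ne hq hq' hne
    · simp only [State.setReg_reg, if_true]
      have hsmall : ∀ x < M, π' x ≤ pos → gap key ρ x ≤ t pos := by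
        intro x hx hle'
        have := ho'.mono _ _ hle' hlt
        rwa [ho'.right_inv x hx] at this
      by_cases hcase : pos + 1 < M
      · refine ⟨_, hhigh hcase, fun q hq q' hq' heq => ho.abs_le_of_label_eq ht0 ?_ hq hq' heq⟩
        intro x hx hxt
        refine hsmall x hx ?_
        by_contra hcon
        have := ho'.mono (pos + 1) (π' x) (by omega) (ho'.lt' x hx)
        rw [ho'.right_inv x hx] at this
        exact absurd this (not_le.mpr hxt)
      -- The search ended at the largest gap. Any larger threshold cuts nothing, so all rows
      -- coincide and `1 ≤ k` suffices.
      · have hall : ∀ x < M, gap key ρ x ≤ t pos := fun x hx =>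
          hsmall x hx (by have := ho'.lt' x hx; omega)
        refine ⟨label key ρ π (t pos + 1), ?_, fun q hq q' hq' heq =>
          ho.abs_le_of_label_eq ht0 (fun x hx _ => hall x hx) hq hq' heq⟩
        have hz : ∀ q < M, label key ρ π (t pos + 1) q = 0 := by
          intro q hq
          rw [label, cuts, Finset.card_eq_zero, Finset.filter_eq_empty_iff]
          intro y hy
          have h1 := ho.lt' q hq
          have h2 := hall y (by simp at hy; omega)
          linarith
        have hsub : (Finset.range n).image (fun i => rowCode (label key ρ π (t pos + 1)) d i d) ⊆
            {rowCode (label key ρ π (t pos + 1)) d 0 d} := by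
          intro z hz'
          obtain ⟨i, hi, rfl⟩ := Finset.mem_image.mp hz'
          rw [Finset.mem_singleton, rowCode_eq_iff]
          intro c hc
          have hb : ∀ i < n, i * d + c < M := fun i hi => by
            calc i * d + c < i * d + d := by omega
              _ = (i + 1) * d := by ring
              _ ≤ n * d := Nat.mul_le_mul_right _ hi
              _ ≤ M := hM
          rw [hz _ (hb i (by simpa using hi)), hz _ (hb 0 (by omega))]
        exact (Finset.card_le_card hsub).trans (by simpa using hk)

/-- Coordinates of all directions and the padding are sorted as one sequence; extra entries only add
cuts or short gaps and do not affect the estimates. The last clause supplies the origin of the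
grids. -/
theorem runs_coarseProg {σ : State} {K n d k : ℕ} (hd : 1 ≤ d) (hM : n * d ≤ 2 ^ K) (hk : 1 ≤ k) (hkn : k < n)
    (h0 : σ.reg 0 = n) (h1 : σ.reg 1 = d) (h2 : σ.reg 2 = k)
    (h4 : σ.reg 4 = (2 ^ K : ℕ)) (h5 : σ.reg 5 = K) :
    Runs ω coarseProg σ ((K + 1) * (2 ^ K * 1000)) fun τ => 0 ≤ τ.reg 37 ∧
      (∃ L, k < rowCount L d n ∧
        ∀ q < 2 ^ K, ∀ q' < 2 ^ K, L q ≠ L q' → τ.reg 37 ≤ |σ.arr 0 q - σ.arr 0 q'|) ∧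
      (∃ L, rowCount L d n ≤ k ∧ ∀ q < 2 ^ K, ∀ q' < 2 ^ K, L q = L q' →
        |σ.arr 0 q - σ.arr 0 q'| ≤ (2 ^ K : ℕ) * τ.reg 37) ∧
      ∀ q < 2 ^ K, σ.arr 0 ⌊τ.arr 2 0⌋₊ ≤ σ.arr 0 q := by
  have hpos : 0 < 2 ^ K := by positivity
  have e1 : (K + 1) * (2 ^ K * 1000) = K * (2 ^ K * 1000) + 2 ^ K * 1000 := by ring
  have e2 : (K + 1) * (2 ^ K * 180) = K * (2 ^ K * 180) + 2 ^ K * 180 := by ring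
  have e3 : K * (2 ^ K * 1000) = K * (2 ^ K * 180) + K * (2 ^ K * 180) + K * (2 ^ K * 300) +
    K * (2 ^ K * 340) := by ring
  refine Runs.seq (T₁ := (K + 1) * (2 ^ K * 180))
    (T₂ := (K + 1) * (2 ^ K * 180) + K * (2 ^ K * 300) + (2 ^ K * 40 + 50))
    (runs_sortProg (by decide) (by decide) (by decide) h4 h5) ?_ (by omega)
  intro τ hs hfr
  obtain ⟨ρ, π, ho, hρ⟩ := hs.exists_keyOrder
  have ha0 : τ.arr 0 = σ.arr 0 := hfr.arr 0 (by decide)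
  have h4' : τ.reg 4 = (2 ^ K : ℕ) := by rw [hfr.reg 4 (by decide), h4]
  refine Runs.seq (T₁ := 2 ^ K * 40 + 8)
    (T₂ := (K + 1) * (2 ^ K * 180) + K * (2 ^ K * 300) + 40) (runs_gapProg h4' hρ) ?_ (by omega)
  intro τ₁ hg hfr₁
  rw [ha0] at hg
  refine Runs.seq (T₁ := (K + 1) * (2 ^ K * 180)) (T₂ := K * (2 ^ K * 300) + 30)
    (runs_sortProg (k := K) (by decide) (by decide) (by decide)
      (by rw [hfr₁.reg 4 (by decide), h4'])
      (by rw [hfr₁.reg 5 (by decide), hfr.reg 5 (by decide), h5])) ?_ (by omega)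
  intro τ₂ hs₂ hfr₂
  obtain ⟨ρ', π', ho₂, hρ'⟩ := hs₂.exists_keyOrder
  have hr (y : ℕ) (hy : y ∉ (seq (sortProg 0 2 3) (seq gapProg (sortProg 4 5 3))).regs) :
      τ₂.reg y = σ.reg y := by
    simp only [Prog.regs, List.mem_append, not_or] at hy
    rw [hfr₂.reg y hy.2.2, hfr₁.reg y hy.2.1, hfr.reg y hy.1]
  have ho' : KeyOrder (gap (σ.arr 0) ρ) (2 ^ K) ρ' π' :=
    ⟨ho₂.lt, ho₂.lt', ho₂.left_inv, ho₂.right_inv, fun x y hxy hy => by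
      have := ho₂.mono x y hxy hy
      rwa [hg _ (ho₂.lt x (by omega)), hg _ (ho₂.lt y hy)] at this⟩
  have ha2 : τ₂.arr 2 = τ.arr 2 := by rw [hfr₂.arr 2 (by decide), hfr₁.arr 2 (by decide)]
  have ha4 : τ₂.arr 4 = τ₁.arr 4 := hfr₂.arr 4 (by decide)
  refine (runs_searchProg ho ho' hd hM hk hkn (by rw [hr 0 (by decide), h0])
    (by rw [hr 1 (by decide), h1]) (by rw [hr 2 (by decide), h2]) (by rw [hr 4 (by decide), h4])
    (by rw [hr 5 (by decide), h5]) (by rwa [ha2]) hρ' (by rwa [ha4])).mono le_rfl ?_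
  rintro τ₃ ⟨hq1, hq2, hq3⟩ hfr₃
  refine ⟨hq1, hq2, hq3, fun q hq => ?_⟩
  rw [hfr₃.arr 2 (by decide), ha2, hρ 0 hpos, Nat.floor_natCast]
  have := ho.mono 0 (π q) (by omega) (ho.lt' q hq)
  rwa [ho.right_inv q hq] at this

/-! ### Deterministic parts of a run -/

theorem Exec.of_not_random {ω ω' : Tape} {c : Prog} {σ σ' : State} {t : ℕ} (h : Exec ω c σ σ' t)
    (hc : c.random = false) : Exec ω' c σ σ' t := by
  induction h with
  | skip σ => exact .skip σ
  | assign x e σ => exact .assign x e σ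
  | store a i e σ => exact .store a i e σ
  | uniform | gauss => simp [Prog.random] at hc
  | seq _ _ ih ih' =>
    simp [Prog.random] at hc
    exact .seq (ih hc.1) (ih' hc.2)
  | ite_true hb _ ih =>
    simp [Prog.random] at hc
    exact .ite_true hb (ih hc.1)
  | ite_false hb _ ih =>
    simp [Prog.random] at hc
    exact .ite_false hb (ih hc.2)
  | loop_stop hb => exact Exec.loop_stop hb
  | loop_step hb _ _ ih ih' => exact .loop_step hb (ih hc) (ih' hc)

/-- Exchanges quantifiers: a single final state works for all tapes, so later events may be defined
in terms of it. -/
theorem Runs.of_not_random {ω : Tape} {c : Prog} {σ : State} {T : ℕ} {Q : State → Prop}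
    (h : Runs ω c σ T Q) (hc : c.random = false) :
    ∃ τ, Q τ ∧ Frame c σ τ ∧ ∀ ω', Runs ω' c σ T (· = τ) := by
  obtain ⟨τ, t, he, ht, hq⟩ := h
  exact ⟨τ, hq, he.frame, fun ω' => ⟨τ, t, he.of_not_random hc, ht, rfl⟩⟩

/-! ### Parameters of the algorithm -/

/-- Computes `m = n * d` in register `50` and a power of two `m ≤ 2 ^ K ≤ 2 * m`. -/
def sizeProg : Prog :=
  seq (assign 4 (const 1)) <|
  seq (assign 5 (const 0)) <|
  forUp 51 50 <|
    ite (le (add (reg 4) (const 1)) (reg 50))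
      (seq (assign 4 (mul (const 2) (reg 4))) (assign 5 (add (reg 5) (const 1)))) skip

/-- Computes an integer approximation of `√d`. -/
def sqrtProg : Prog :=
  seq (assign 40 (const 1)) <|
  forUp 38 1 <|
    ite (le (add (mul (reg 40) (reg 40)) (const 1)) (reg 1))
      (assign 40 (add (reg 40) (const 1))) skip

/-- Computes the bound `200 * k * 2 ^ E` on the number of cells, where `E` is the least integer
with `d ^ 3 ≤ E ^ 3 * β ^ 2`. -/
def boundProg : Prog :=
  seq (assign 41 (mul (const 200) (reg 2))) <|
  seq (assign 42 (const 0)) <|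
  -- As `β ≥ 1`, the cube condition holds at `E = d` at the latest, so `d` rounds suffice. Cubes
  -- avoid roots and exponentials, which are not machine operations.
  forUp 38 1 <|
    ite (le (mul (mul (reg 1) (reg 1)) (reg 1))
        (mul (mul (mul (reg 42) (reg 42)) (reg 42)) (mul (reg 3) (reg 3))))
      skip
      (seq (assign 41 (mul (const 2) (reg 41))) (assign 42 (add (reg 42) (const 1))))

/-- Draws `d` uniform numbers into array `7`. -/
def drawProg : Prog :=
  forUp 38 1 (seq (uniform 39) (store 7 (reg 38) (reg 39)))

variable {ω : Tape}

theorem runs_sizeProg {σ : State} {m : ℕ} (hm : 1 ≤ m) (h50 : σ.reg 50 = m) :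
    Runs ω sizeProg σ (m * 40 + 20) fun τ => ∃ K : ℕ, τ.reg 4 = (2 ^ K : ℕ) ∧ τ.reg 5 = K ∧
      m ≤ 2 ^ K ∧ 2 ^ K ≤ 2 * m := by
  refine Runs.seq_assign (T₂ := m * 40 + 16) 1 (by simp [eval]) (by simp [Expr.cost]; omega) ?_
  refine Runs.seq_assign (T₂ := m * 40 + 8) 0 (by simp [eval]) (by simp [Expr.cost]; omega) ?_
  refine Runs.forUp (T₁ := 30) m (fun i τ => ∃ K : ℕ, τ.reg 4 = (2 ^ K : ℕ) ∧ τ.reg 5 = K ∧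
      (m ≤ 2 ^ K ∨ i ≤ K) ∧ 2 ^ K ≤ 2 * m) (by simp [h50])
    (by decide) (by decide) (by decide) ⟨0, by simp, by simp, by simp, by omega⟩ ?_ (by omega) ?_
  · rintro i hi τ ⟨K, h4, h5, hK, hK'⟩ h51 h50' hfr
    have hbiff : (le (add (reg 4) (const 1)) (reg 50)).Holds τ ↔ 2 ^ K < m := by
      simp only [Holds, eval, h4, h50', Rat.cast_one]
      norm_cast
    refine Runs.ite (T₁ := 20) ?_ ?_ (by simp [Test.cost, Expr.cost])
    · intro hb
      rw [hbiff] at hb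
      refine Runs.seq_assign (T₂ := 10) (2 ^ (K + 1) : ℕ) (by simp [eval, h4, pow_succ'])
        (by simp [Expr.cost]) ?_
      refine Runs.assign (K + 1 : ℕ) (by simp [eval, h5]) (by simp [Expr.cost])
        ⟨K + 1, by simp, by simp, by omega, by rw [pow_succ']; omega⟩
    · intro hb
      rw [hbiff] at hb
      exact Runs.skip ⟨K, by simp [h4], by simp [h5], by omega, hK'⟩ (by omega)
  · rintro τ ⟨K, h4, h5, hK, hK'⟩ _ _
    refine ⟨K, h4, h5, ?_, hK'⟩
    have := Nat.lt_two_pow_self (n := K)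
    omega

theorem runs_sqrtProg {σ : State} {d : ℕ} (hd : 1 ≤ d) (h1 : σ.reg 1 = d) :
    Runs ω sqrtProg σ (d * 40 + 20) fun τ => ∃ D : ℕ, τ.reg 40 = D ∧ 1 ≤ D ∧ d ≤ D * D ∧
      D * D ≤ 4 * d := by
  refine Runs.seq_assign (T₂ := d * 40 + 8) 1 (by simp [eval]) (by simp [Expr.cost]; omega) ?_
  refine Runs.forUp (T₁ := 30) d (fun i τ => ∃ D : ℕ, τ.reg 40 = D ∧ 1 ≤ D ∧
      (d ≤ D * D ∨ i + 1 ≤ D) ∧ D * D ≤ 4 * d) (by simp [h1])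
    (by decide) (by decide) (by decide) ⟨1, by simp, by simp, by simp, by omega⟩ ?_ (by omega) ?_
  · rintro i hi τ ⟨D, h40, hD1, hD, hD'⟩ _ h1' hfr
    have hbiff : (le (add (mul (reg 40) (reg 40)) (const 1)) (reg 1)).Holds τ ↔ D * D < d := by
      simp only [Holds, eval, h40, h1', Rat.cast_one]
      norm_cast
    refine Runs.ite (T₁ := 10) ?_ ?_ (by simp [Test.cost, Expr.cost])
    · intro hb
      rw [hbiff] at hb
      exact Runs.assign (D + 1 : ℕ) (by simp [eval, h40]) (by simp [Expr.cost])
        ⟨D + 1, by simp, by omega, by omega, by nlinarith⟩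
    · intro hb
      rw [hbiff] at hb
      exact Runs.skip ⟨D, by simp [h40], hD1, by omega, hD'⟩ (by omega)
  · rintro τ ⟨D, h40, hD1, hD, hD'⟩ _ _
    refine ⟨D, h40, hD1, ?_, hD'⟩
    rcases hD with h | h
    · exact h
    · nlinarith

theorem runs_boundProg {σ : State} {d k : ℕ} {β : ℝ} (hβ : 1 ≤ β) (h1 : σ.reg 1 = d)
    (h2 : σ.reg 2 = k) (h3 : σ.reg 3 = β) :
    Runs ω boundProg σ (d * 60 + 30) fun τ => ∃ E : ℕ, τ.reg 41 = 200 * k * 2 ^ E ∧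
      (d : ℝ) ^ 3 ≤ (E : ℝ) ^ 3 * β ^ 2 ∧
      (E = 0 ∨ ((E : ℝ) - 1) ^ 3 * β ^ 2 < (d : ℝ) ^ 3) := by
  refine Runs.seq_assign (T₂ := d * 60 + 20) (200 * k) (by simp [eval, h2])
    (by simp [Expr.cost]; omega) ?_
  refine Runs.seq_assign (T₂ := d * 60 + 8) 0 (by simp [eval]) (by simp [Expr.cost]; omega) ?_
  refine Runs.forUp (T₁ := 40) d (fun i τ => ∃ E : ℕ, τ.reg 42 = E ∧ τ.reg 41 = 200 * k * 2 ^ E ∧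
      ((d : ℝ) ^ 3 ≤ (E : ℝ) ^ 3 * β ^ 2 ∨ i ≤ E) ∧
      (E = 0 ∨ ((E : ℝ) - 1) ^ 3 * β ^ 2 < (d : ℝ) ^ 3)) (by simp [h1])
    (by decide) (by decide) (by decide) ⟨0, by simp, by simp, by simp, by simp⟩ ?_ (by omega) ?_
  · rintro i hi τ ⟨E, h42, h41, hE, hE'⟩ _ h1' hfr
    have h3' : τ.reg 3 = β := by rw [hfr.reg 3 (by decide)]; simp [h3]
    have hbiff : (le (mul (mul (reg 1) (reg 1)) (reg 1))
        (mul (mul (mul (reg 42) (reg 42)) (reg 42)) (mul (reg 3) (reg 3)))).Holds τ ↔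
        (d : ℝ) ^ 3 ≤ (E : ℝ) ^ 3 * β ^ 2 := by
      simp only [Holds, eval, h42, h1', h3']
      rw [show (d : ℝ) * d * d = d ^ 3 by ring, show (E : ℝ) * E * E * (β * β) = E ^ 3 * β ^ 2 by
        ring]
    refine Runs.ite (T₁ := 15) ?_ ?_ (by simp [Test.cost, Expr.cost])
    · intro hb
      rw [hbiff] at hb
      exact Runs.skip ⟨E, by simp [h42], by simp [h41], Or.inl hb, hE'⟩ (by omega)
    · intro hb
      rw [hbiff] at hb
      refine Runs.seq_assign (T₂ := 10) (200 * k * 2 ^ (E + 1)) (by simp [eval, h41]; ring)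
        (by simp [Expr.cost]) ?_
      refine Runs.assign (E + 1 : ℕ) (by simp [eval, h42]) (by simp [Expr.cost])
        ⟨E + 1, by simp, by simp, Or.inr ?_, Or.inr (by simpa using hb)⟩
      rcases hE with h | h
      · exact absurd h hb
      · omega
  · rintro τ ⟨E, h42, h41, hE, hE'⟩ _ _
    refine ⟨E, h41, ?_, hE'⟩
    rcases hE with h | h
    · exact h
    · have h1 : (d : ℝ) ^ 3 ≤ (E : ℝ) ^ 3 :=
        pow_le_pow_left₀ (by positivity) (by exact_mod_cast h) 3
      have h2 : (1 : ℝ) ≤ β ^ 2 := one_le_pow₀ hβ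
      exact h1.trans (le_mul_of_one_le_right (by positivity) h2)

theorem runs_drawProg {σ : State} {d : ℕ} (h1 : σ.reg 1 = d) (h0 : σ.draws = 0) :
    Runs ω drawProg σ (d * 20 + 10) fun τ => ∀ c < d, τ.arr 7 c = (ω c).1 := by
  refine Runs.forUp (T₁ := 10) d (fun i τ => τ.draws = i ∧ ∀ c < i, τ.arr 7 c = (ω c).1) (by simp [h1])
    (by decide) (by decide) (by decide) ⟨by simp [h0], by simp⟩ ?_ (by omega)
    (fun τ h _ _ => h.2)
  rintro i hi τ ⟨hdr, hI⟩ h38 _ hfr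
  refine Runs.seq (T₁ := 1) (T₂ := 5) (Q₁ := fun τ' => τ' = τ.draw 39 (ω τ.draws).1)
    (Runs.uniform le_rfl rfl) ?_ (by omega)
  rintro _ rfl _
  refine Runs.store i (ω i).1 (by simp [eval, h38]) (by simp [eval, hdr]) (by simp [Expr.cost])
    ⟨by simp [hdr], fun c hc => ?_⟩
  by_cases h : c = i
  · subst h; simp
  · simp [h, hI c (by omega)]

/-! ### Grids of increasing width -/

/-- Index, in the direction of its coordinate, of the cell that contains entry `q` of `x`, for the
grid of width `s` with origin `y` and shift `u`. -/
noncomputable def cell (x : ℕ → ℝ) (y s : ℝ) (u : ℕ → ℝ) (d q : ℕ) : ℕ :=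
  ⌊(x q - y) / s + u (q % d)⌋₊

/-- Computes the cells of all points for the grid whose width is in register `43`. -/
def cellProg : Prog :=
  forUp 48 0 <|
    seq (assign 53 (mul (reg 48) (reg 1))) <|
    forUp 49 1 <|
      store 6 (add (reg 53) (reg 49))
        (floor (add (div (sub (get 0 (add (reg 53) (reg 49))) (reg 45)) (reg 43)) (get 7 (reg 49))))

/-- Doubles the width of the grid until at most `reg 41` cells are occupied. -/
def levelsProg : Prog :=
  -- The division by the approximate `√d` makes the diameter of a cell at most `64 * β * W`, with
  -- `W` the coarse estimate.
  seq (assign 43 (div (mul (mul (const 64) (reg 3)) (reg 37)) (reg 40))) <|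
  seq (assign 44 (const 0)) <|
  -- The smallest key as origin makes all cell indices natural numbers.
  seq (assign 45 (get 0 (get 2 (const 0)))) <|
  seq (assign 46 (add (mul (const 2) (reg 5)) (const 2))) <|
  seq (forUp 47 46 <|
    ite (le (reg 44) (const 0))
      (seq cellProg <|
        seq countProg <|
        ite (le (reg 20) (reg 41)) (assign 44 (const 1)) (assign 43 (mul (const 2) (reg 43))))
      skip) <|
  -- If no level passed the test, the output is empty: the size bound survives and only the covering
  -- fails.
  ite (le (const 1) (reg 44)) (assign 0 (reg 20)) (assign 0 (const 0))

theorem runs_cellProg {σ : State} {n d : ℕ} {u : ℕ → ℝ} (h0 : σ.reg 0 = n) (h1 : σ.reg 1 = d)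
    (hs : 0 ≤ σ.reg 43) (hy : ∀ q < n * d, σ.reg 45 ≤ σ.arr 0 q)
    (hu : ∀ c < d, σ.arr 7 c = u c) (hu0 : ∀ c < d, 0 ≤ u c) :
    Runs ω cellProg σ (n * (d * 40 + 40) + 8) fun τ =>
      ∀ q < n * d, τ.arr 6 q = cell (σ.arr 0) (σ.reg 45) (σ.reg 43) u d q := by
  refine Runs.forUp (T₁ := d * 40 + 30) n (fun i τ =>
      ∀ q < i * d, τ.arr 6 q = cell (σ.arr 0) (σ.reg 45) (σ.reg 43) u d q) h0
    (by decide) (by decide) (by decide) (by simp) ?_ le_rfl (fun τ h _ _ => h)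
  intro i hi τ hI h48 _ hfr
  have h1' : τ.reg 1 = d := by rw [hfr.reg 1 (by decide), h1]
  refine Runs.seq_assign (T₂ := d * 40 + 8) (i * d : ℕ) (by simp [eval, h48, h1'])
    (by simp [Expr.cost]; omega) ?_
  refine Runs.forUp (T₁ := 30) d (fun j τ =>
      ∀ q < i * d + j, τ.arr 6 q = cell (σ.arr 0) (σ.reg 45) (σ.reg 43) u d q) (by simp [h1'])
    (by decide) (by decide) (by decide) (by simpa using hI) ?_ (by omega) ?_
  · intro j hj τ' hI' h49 _ hfr'
    have hlt : i * d + j < n * d := by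
      calc i * d + j < i * d + d := by omega
        _ = (i + 1) * d := by ring
        _ ≤ n * d := Nat.mul_le_mul_right _ hi
    have h53 : τ'.reg 53 = (i * d : ℕ) := by rw [hfr'.reg 53 (by decide)]; simp
    have h45 : τ'.reg 45 = σ.reg 45 := by
      rw [hfr'.reg 45 (by decide)]; simp [hfr.reg 45 (by decide)]
    have h43 : τ'.reg 43 = σ.reg 43 := by
      rw [hfr'.reg 43 (by decide)]; simp [hfr.reg 43 (by decide)]
    have ha0 : τ'.arr 0 = σ.arr 0 := by
      rw [hfr'.arr 0 (by decide)]; simp [hfr.arr 0 (by decide)]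
    have ha7 : τ'.arr 7 = σ.arr 7 := by
      rw [hfr'.arr 7 (by decide)]; simp [hfr.arr 7 (by decide)]
    refine Runs.store (i * d + j) (cell (σ.arr 0) (σ.reg 45) (σ.reg 43) u d (i * d + j))
      (by simp [eval, h53, h49]) ?_ (by simp [Expr.cost]) ?_
    · simp only [eval, h53, h49, h45, h43, ha0, ha7, ← Nat.cast_add, Nat.floor_natCast, hu j hj]
      have hmod : (i * d + j) % d = j := by
        rw [Nat.mul_comm, Nat.mul_add_mod, Nat.mod_eq_of_lt hj]
      have hnn : 0 ≤ (σ.arr 0 (i * d + j) - σ.reg 45) / σ.reg 43 + u j :=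
        add_nonneg (div_nonneg (sub_nonneg.mpr (hy _ hlt)) hs) (hu0 j hj)
      rw [cell, hmod, natCast_floor_eq_intCast_floor hnn]
    · intro q hq
      by_cases h : q = i * d + j
      · subst h; simp
      · simp [h, hI' q (by omega)]
  · intro τ' h _ _ q hq
    exact h q (by rw [← Nat.succ_mul]; exact hq)

theorem runs_levelsProg {σ : State} {n d K : ℕ} {u : ℕ → ℝ} {s y : ℝ} (hd : 1 ≤ d)
    (h0 : σ.reg 0 = n) (h1 : σ.reg 1 = d) (h5 : σ.reg 5 = K)
    (hs : 64 * σ.reg 3 * σ.reg 37 / σ.reg 40 = s) (hs0 : 0 ≤ s)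
    (hy : σ.arr 0 ⌊σ.arr 2 0⌋₊ = y) (hy' : ∀ q < n * d, y ≤ σ.arr 0 q)
    (hu : ∀ c < d, σ.arr 7 c = u c) (hu0 : ∀ c < d, 0 ≤ u c) :
    Runs ω levelsProg σ ((2 * K + 2) * (n * d * 220 + 100) + 80) fun τ =>
      (τ.reg 0 = 0 ∧ ∀ l < 2 * K + 2,
        σ.reg 41 < rowCount (cell (σ.arr 0) y (s * 2 ^ l) u d) d n) ∨
      ∃ l, τ.reg 0 = rowCount (cell (σ.arr 0) y (s * 2 ^ l) u d) d n ∧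
        (rowCount (cell (σ.arr 0) y (s * 2 ^ l) u d) d n : ℝ) ≤ σ.reg 41 ∧
        (∀ l' < l, σ.reg 41 < rowCount (cell (σ.arr 0) y (s * 2 ^ l') u d) d n) ∧
        IsRepr n d (rowCount (cell (σ.arr 0) y (s * 2 ^ l) u d) d n)
          (cell (σ.arr 0) y (s * 2 ^ l) u d) (σ.arr 0) (τ.arr 1) := by
  set N : ℕ → ℕ := fun l => rowCount (cell (σ.arr 0) y (s * 2 ^ l) u d) d n with hN
  have hT1 : n * (d * 40 + 40) ≤ n * d * 80 := by
    calc n * (d * 40 + 40) ≤ n * (d * 80) := Nat.mul_le_mul_left _ (by omega)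
      _ = n * d * 80 := by ring
  have hT2 : n * (d * 50 + 90) ≤ n * d * 140 := by
    calc n * (d * 50 + 90) ≤ n * (d * 140) := Nat.mul_le_mul_left _ (by omega)
      _ = n * d * 140 := by ring
  refine Runs.seq_assign (T₂ := (2 * K + 2) * (n * d * 220 + 100) + 60) s
    (by rw [← hs]; simp [eval]) (by simp [Expr.cost]; omega) ?_
  refine Runs.seq_assign (T₂ := (2 * K + 2) * (n * d * 220 + 100) + 50) 0
    (by simp [eval]) (by simp [Expr.cost]; omega) ?_
  refine Runs.seq_assign (T₂ := (2 * K + 2) * (n * d * 220 + 100) + 40) y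
    (by rw [← hy]; simp [eval]) (by simp [Expr.cost]; omega) ?_
  refine Runs.seq_assign (T₂ := (2 * K + 2) * (n * d * 220 + 100) + 30) (2 * K + 2 : ℕ)
    (by simp [eval, h5]) (by simp [Expr.cost]; omega) ?_
  refine Runs.seq (T₁ := (2 * K + 2) * (n * d * 220 + 100) + 8) (T₂ := 20) (Q₁ := fun τ =>
    (τ.reg 44 = 0 ∧ ∀ l < 2 * K + 2, σ.reg 41 < N l) ∨
      (τ.reg 44 = 1 ∧ ∃ l, τ.reg 20 = N l ∧ (N l : ℝ) ≤ σ.reg 41 ∧ (∀ l' < l, σ.reg 41 < N l') ∧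
        IsRepr n d (N l) (cell (σ.arr 0) y (s * 2 ^ l) u d) (σ.arr 0) (τ.arr 1))) ?_ ?_ (by omega)
  · refine Runs.forUp (T₁ := n * d * 220 + 90) (2 * K + 2) (fun i τ =>
      (τ.reg 44 = 0 ∧ τ.reg 43 = s * 2 ^ i ∧ ∀ l < i, σ.reg 41 < N l) ∨
      (τ.reg 44 = 1 ∧ ∃ l, τ.reg 20 = N l ∧ (N l : ℝ) ≤ σ.reg 41 ∧ (∀ l' < l, σ.reg 41 < N l') ∧
        IsRepr n d (N l) (cell (σ.arr 0) y (s * 2 ^ l) u d) (σ.arr 0) (τ.arr 1)))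
      (by simp) (by decide) (by decide) (by decide) (Or.inl (by simp)) ?_ le_rfl ?_
    · intro i hi τ hI h47 _ hfr
      have hr (y : ℕ) (hy : y ∉ levelsProg.regs) : τ.reg y = σ.reg y := by
        simp only [levelsProg, Prog.regs, List.mem_append, not_or, List.mem_singleton] at hy
        rw [hfr.reg y hy.2.2.2.2.1]
        simp [hy.1, hy.2.1, hy.2.2.1, hy.2.2.2.1]
      have h45 : τ.reg 45 = y := by rw [hfr.reg 45 (by decide)]; simp
      have h0' : τ.reg 0 = n := by rw [hfr.reg 0 (by decide)]; simp [h0]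
      have h1' : τ.reg 1 = d := by rw [hr 1 (by decide), h1]
      have h41 : τ.reg 41 = σ.reg 41 := hr 41 (by decide)
      have ha0 : τ.arr 0 = σ.arr 0 := hfr.arr 0 (by decide)
      have ha7 : τ.arr 7 = σ.arr 7 := hfr.arr 7 (by decide)
      refine Runs.ite (T₁ := n * d * 220 + 70) ?_ ?_ (by simp [Test.cost, Expr.cost]; omega)
      · intro hb
        rcases hI with ⟨h44, h43, hI⟩ | ⟨h44, -⟩
        swap
        · exfalso; simp [Holds, eval, h44] at hb; linarith
        refine Runs.seq (T₁ := n * (d * 40 + 40) + 8) (T₂ := n * d * 140 + 40)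
          (runs_cellProg (u := u) h0' h1' (by rw [h43]; positivity) (by rwa [h45, ha0])
            (by rwa [ha7]) hu0) ?_ (by omega)
        intro τ₁ hcell hfr₁
        rw [ha0, h45, h43] at hcell
        refine Runs.seq (T₁ := n * (d * 50 + 90) + 10) (T₂ := 20)
          (runs_countProg (n := n) (d := d) (by rw [hfr₁.reg 0 (by decide), h0'])
            (by rw [hfr₁.reg 1 (by decide), h1']) hcell) ?_ (by omega)
        rintro τ₂ ⟨h20, hrepr⟩ hfr₂
        rw [hfr₁.arr 0 (by decide), ha0] at hrepr
        have h41₂ : τ₂.reg 41 = σ.reg 41 := by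
          rw [hfr₂.reg 41 (by decide), hfr₁.reg 41 (by decide), h41]
        have h43₂ : τ₂.reg 43 = s * 2 ^ i := by
          rw [hfr₂.reg 43 (by decide), hfr₁.reg 43 (by decide), h43]
        have h44₂ : τ₂.reg 44 = 0 := by
          rw [hfr₂.reg 44 (by decide), hfr₁.reg 44 (by decide), h44]
        have hbiff : (le (reg 20) (reg 41)).Holds τ₂ ↔ (N i : ℝ) ≤ σ.reg 41 := by
          simp only [Holds, eval, h20, h41₂, hN]
        refine Runs.ite (T₁ := 10) ?_ ?_ (by simp [Test.cost, Expr.cost])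
        · intro hb
          rw [hbiff] at hb
          exact Runs.assign 1 (by simp [eval]) (by simp [Expr.cost])
            (Or.inr ⟨by simp, i, by simp [h20, hN], hb, hI, hrepr⟩)
        · intro hb
          rw [hbiff, not_le] at hb
          refine Runs.assign (s * 2 ^ (i + 1)) (by simp [eval, h43₂, pow_succ']; ring)
            (by simp [Expr.cost]) (Or.inl ⟨by simp [h44₂], by simp, fun l hl => ?_⟩)
          rcases Nat.lt_succ_iff_lt_or_eq.mp hl with hl | rfl
          · exact hI l hl
          · exact hb
      · intro hb
        rcases hI with ⟨h44, -⟩ | h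
        · exfalso; simp [Holds, eval, h44] at hb
        · exact Runs.skip (Or.inr (by simpa using h)) (by omega)
    · rintro τ (⟨h44, -, h⟩ | h) _ _
      · exact Or.inl ⟨h44, h⟩
      · exact Or.inr h
  · rintro τ (⟨h44, h⟩ | ⟨h44, l, h20, h⟩) _
    · refine Runs.ite (T₁ := 10) (fun hb => ?_) (fun _ => ?_) (by simp [Test.cost, Expr.cost])
      · exfalso; simp [Holds, eval, h44] at hb; linarith
      · exact Runs.assign 0 (by simp [eval]) (by simp [Expr.cost]) (Or.inl ⟨by simp, h⟩)
    · refine Runs.ite (T₁ := 10) (fun _ => ?_) (fun hb => ?_) (by simp [Test.cost, Expr.cost])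
      · exact Runs.assign (N l) (by simp [eval, h20]) (by simp [Expr.cost])
          (Or.inr ⟨l, by simp [hN], h⟩)
      · exfalso; simp [Holds, eval, h44] at hb

end RealRAM

open scoped ENNReal

/-! ### Random grids -/

/-- A Gaussian function of the distance to the unit interval. -/
noncomputable def bump (l y : ℝ) : ℝ≥0∞ :=
  ENNReal.ofReal (Real.exp (-l * max 0 (max (-y) (y - 1)) ^ 2))

theorem measurable_bump (l : ℝ) : Measurable (bump l) := by
  unfold bump
  fun_prop

theorem lintegral_gaussian {l : ℝ} (hl : 0 < l) :
    ∫⁻ y : ℝ, ENNReal.ofReal (Real.exp (-l * y ^ 2)) = ENNReal.ofReal (Real.sqrt (Real.pi / l)) := by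
  rw [← integral_gaussian, ofReal_integral_eq_lintegral_ofReal (integrable_exp_neg_mul_sq hl)]
  exact Filter.Eventually.of_forall fun _ => (Real.exp_pos _).le

/-- The bump is at most the indicator of the unit interval plus one full Gaussian at each endpoint;
using full instead of half Gaussians costs only a constant. -/
theorem lintegral_bump_le {l : ℝ} (hl : 0 < l) :
    ∫⁻ y, bump l y ≤ ENNReal.ofReal (1 + 2 * Real.sqrt (Real.pi / l)) := by
  let g : ℝ → ℝ≥0∞ := fun y => ENNReal.ofReal (Real.exp (-l * y ^ 2))
  have hg : Measurable g := by fun_prop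
  have hle : ∀ y, bump l y ≤ (Set.Icc (0 : ℝ) 1).indicator 1 y + g y + g (y - 1) := by
    intro y
    rcases lt_or_ge y 0 with h | h
    · have e : max 0 (max (-y) (y - 1)) = -y := by
        rw [max_eq_left (by linarith : y - 1 ≤ -y), max_eq_right (by linarith)]
      have : bump l y = g y := by simp [bump, e, g]
      rw [this, add_right_comm]
      exact le_add_self
    rcases le_or_gt y 1 with h1 | h1
    · have : bump l y ≤ 1 := by
        rw [bump, ENNReal.ofReal_le_one, Real.exp_le_one_iff]
        have := sq_nonneg (max 0 (max (-y) (y - 1)))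
        nlinarith
      rw [Set.indicator_of_mem (Set.mem_Icc.mpr ⟨h, h1⟩), add_assoc]
      exact this.trans le_self_add
    · have e : max 0 (max (-y) (y - 1)) = y - 1 := by
        rw [max_eq_right (by linarith : -y ≤ y - 1), max_eq_right (by linarith)]
      have : bump l y = g (y - 1) := by simp [bump, e, g]
      rw [this]
      exact le_add_self
  calc ∫⁻ y, bump l y ≤ ∫⁻ y, ((Set.Icc (0 : ℝ) 1).indicator 1 y + g y + g (y - 1)) :=
        lintegral_mono hle
    _ = 1 + ENNReal.ofReal (Real.sqrt (Real.pi / l)) + ENNReal.ofReal (Real.sqrt (Real.pi / l)) := by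
        rw [lintegral_add_right _ (by fun_prop), lintegral_add_right _ hg,
          lintegral_sub_right_eq_self g 1, lintegral_gaussian hl,
          lintegral_indicator_one measurableSet_Icc]
        simp
    _ = ENNReal.ofReal (1 + 2 * Real.sqrt (Real.pi / l)) := by
        rw [two_mul, ← add_assoc, ENNReal.ofReal_add (by positivity) (by positivity),
          ENNReal.ofReal_add (by positivity) (by positivity), ENNReal.ofReal_one]

/-- Unfolding: the translates by `m` of a unit interval of shifts are disjoint pieces of the line,
so sum and average combine to an integral over part of ℝ. -/
theorem lintegral_tsum_bump_le (l a : ℝ) :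
    ∫⁻ u : unitInterval, ∑' m : ℕ, bump l (a + u - m) ≤ ∫⁻ y, bump l y := by
  have hm := measurable_bump l
  have h1 : ∫⁻ u : unitInterval, ∑' m : ℕ, bump l (a + u - m) =
      ∫⁻ u in Set.Icc (0 : ℝ) 1, ∑' m : ℕ, bump l (a + u - m) :=
    lintegral_subtype_comap measurableSet_Icc (fun u : ℝ => ∑' m : ℕ, bump l (a + u - m))
  -- Half-open intervals make the translates disjoint.
  rw [h1, setLIntegral_congr Ico_ae_eq_Icc.symm, lintegral_tsum (fun m => by fun_prop)]
  have h2 : ∀ m : ℕ, ∫⁻ u in Set.Ico (0 : ℝ) 1, bump l (a + u - m) =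
      ∫⁻ y in Set.Ico (a - m) (a - m + 1), bump l y := by
    intro m
    rw [← (measurePreserving_add_left volume (a - m)).setLIntegral_comp_preimage_emb
      (measurableEmbedding_addLeft _) (bump l)]
    have : (fun x => a - m + x) ⁻¹' Set.Ico (a - m) (a - m + 1) = Set.Ico (0 : ℝ) 1 := by
      ext x; simp
    rw [this]
    congr 1 with x
    congr 1
    ring
  simp_rw [h2]
  rw [← lintegral_iUnion (fun _ => measurableSet_Ico)]
  · exact setLIntegral_le_lintegral _ _
  · intro m m' hmm
    rw [Function.onFun, Set.disjoint_left]
    rintro x ⟨hx1, hx2⟩ ⟨hx3, hx4⟩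
    have h3 : (m : ℝ) < m' + 1 := by linarith
    have h4 : (m' : ℝ) < m + 1 := by linarith
    have h5 : m < m' + 1 := by exact_mod_cast h3
    have h6 : m' < m + 1 := by exact_mod_cast h4
    omega

/-! ### Expected number of occupied cells -/

namespace RealRAM

instance : IsProbabilityMeasure tapeMeasure := by unfold tapeMeasure; infer_instance

/-- Weighted number of the cells of a randomly shifted grid of unit width near the points `a`. -/
noncomputable def cellWeight {ι : Type*} (C : Finset ι) (d : ℕ) (l : ℝ) (a : ι → Fin d → ℝ)
    (ω : Tape) : ℝ≥0∞ :=
  ∑ j ∈ C, ∏ c : Fin d, ∑' m : ℕ, bump l (a j c + ((ω c).1 : ℝ) - m)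

theorem measurable_cellWeight {ι : Type*} (C : Finset ι) (d : ℕ) (l : ℝ) (a : ι → Fin d → ℝ) :
    Measurable (cellWeight C d l a) := by
  have hm := measurable_bump l
  unfold cellWeight
  refine Finset.measurable_fun_sum _ fun j _ => Finset.measurable_fun_prod _ fun c _ => ?_
  refine Measurable.tsum fun m => hm.comp ?_
  fun_prop

theorem lintegral_cellWeight_le {ι : Type*} (C : Finset ι) (d : ℕ) {l : ℝ} (hl : 0 < l)
    (a : ι → Fin d → ℝ) : ∫⁻ ω, cellWeight C d l a ω ∂tapeMeasure ≤
      C.card * ENNReal.ofReal (1 + 2 * Real.sqrt (Real.pi / l)) ^ d := by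
  have hm := measurable_bump l
  let h : ι → Fin d → unitInterval × ℝ → ℝ≥0∞ := fun j c z =>
    ∑' m : ℕ, bump l (a j c + (z.1 : ℝ) - m)
  have hh : ∀ j c, Measurable (h j c) := fun j c =>
    Measurable.tsum fun m => hm.comp (by fun_prop)
  have hprod : ∀ j, ∫⁻ ω, ∏ c : Fin d, h j c (ω c) ∂tapeMeasure ≤
      ENNReal.ofReal (1 + 2 * Real.sqrt (Real.pi / l)) ^ d := by
    intro j
    have hind : iIndepFun (fun (c : Fin d) (ω : Tape) => h j c (ω c)) tapeMeasure := by
      -- The tape is indexed by ℕ: the family is extended by zero beyond `d` and then restricted to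
      -- the first `d` entries.
      have := iIndepFun_infinitePi
        (P := fun _ : ℕ => (volume : Measure unitInterval).prod (gaussianReal 0 1))
        (X := fun i z => if hi : i < d then h j ⟨i, hi⟩ z else 0) (fun i => by
          by_cases hi : i < d
          · simpa [hi] using hh j ⟨i, hi⟩
          · simp [hi])
      have h2 := this.precomp (g := fun c : Fin d => (c : ℕ)) Fin.val_injective
      simp only [Fin.is_lt, dif_pos, Fin.eta] at h2
      exact h2
    rw [lintegral_prod_eq_prod_lintegral_of_indepFun _ _ hind
      (fun c => (hh j c).comp (measurable_pi_apply _))]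
    calc ∏ c : Fin d, ∫⁻ ω, h j c (ω c) ∂tapeMeasure
        ≤ ∏ _c : Fin d, ENNReal.ofReal (1 + 2 * Real.sqrt (Real.pi / l)) := by
          refine Finset.prod_le_prod' fun c _ => ?_
          have hmp : MeasurePreserving (fun ω : Tape => (ω c).1) tapeMeasure volume :=
            (measurePreserving_fst (μ := (volume : Measure unitInterval))
              (ν := gaussianReal 0 1)).comp (measurePreserving_eval_infinitePi _ (c : ℕ))
          rw [hmp.lintegral_comp (f := fun u : unitInterval =>
            ∑' m : ℕ, bump l (a j c + (u : ℝ) - m))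
            (Measurable.tsum fun m => hm.comp (by fun_prop))]
          exact (lintegral_tsum_bump_le l _).trans (lintegral_bump_le hl)
      _ = _ := by simp
  change ∫⁻ ω, ∑ j ∈ C, ∏ c : Fin d, h j c (ω c) ∂tapeMeasure ≤ _
  have hmeas : ∀ j ∈ C, Measurable fun ω : Tape => ∏ c : Fin d, h j c (ω c) := fun j _ =>
    Finset.measurable_fun_prod _ fun c _ => (hh j c).comp (measurable_pi_apply (c : ℕ))
  rw [lintegral_finsetSum C hmeas]
  calc ∑ j ∈ C, ∫⁻ ω, ∏ c : Fin d, h j c (ω c) ∂tapeMeasure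
      ≤ ∑ _j ∈ C, ENNReal.ofReal (1 + 2 * Real.sqrt (Real.pi / l)) ^ d :=
        Finset.sum_le_sum fun j _ => hprod j
    _ = _ := by simp

variable {n d : ℕ} (p : Fin n → EuclideanSpace ℝ (Fin d))

/-- The number of occupied cells of the shifted grid is bounded by the weight of the centers. -/
theorem rowCount_cell_le {x : ℕ → ℝ} {y s l r : ℝ} {ω : Tape}
    {C : Finset (EuclideanSpace ℝ (Fin d))} (hx : ∀ (i : Fin n) (c : Fin d), x (i * d + c) = p i c)
    (hy : ∀ (i : Fin n) (c : Fin d), y ≤ p i c) (hs : 0 < s) (hl : 0 ≤ l)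
    (hC : ∀ i, ∃ z ∈ C, dist (p i) z ≤ r) :
    (rowCount (cell x y s (fun c => (ω c).1) d) d n : ℝ≥0∞) ≤
      ENNReal.ofReal (Real.exp (l * (r / s) ^ 2)) *
        cellWeight C d l (fun z c => (z c - y) / s) ω := by
  set L := cell x y s (fun c => ((ω c).1 : ℝ)) d with hLdef
  let v : Fin n → Fin d → ℕ := fun i c => L (i * d + c)
  have hv : ∀ i c, (v i c : ℝ) ≤ (p i c - y) / s + (ω c).1 ∧
      (p i c - y) / s + (ω c).1 < v i c + 1 := by
    intro i c
    have hmod : ((i : ℕ) * d + c) % d = c := by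
      rw [Nat.mul_comm, Nat.mul_add_mod, Nat.mod_eq_of_lt c.2]
    have e : v i c = ⌊(p i c - y) / s + ((ω c).1 : ℝ)⌋₊ := by
      simp only [v, hLdef, cell, hmod, hx]
    rw [e]
    exact ⟨Nat.floor_le (add_nonneg (div_nonneg (sub_nonneg.mpr (hy i c)) hs.le) (ω c).1.2.1),
      Nat.lt_floor_add_one _⟩
  have hcard : rowCount L d n ≤ (Finset.univ.image v).card := by
    refine Finset.card_le_card_of_surjOn
      (fun w => if h : ∃ i, v i = w then rowCode L d h.choose d else 0) ?_
    intro z hz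
    simp only [Finset.coe_image, Finset.coe_range, Set.mem_image, Set.mem_Iio] at hz
    obtain ⟨i, hi, rfl⟩ := hz
    refine ⟨v ⟨i, hi⟩, by simp, ?_⟩
    have h : ∃ i', v i' = v ⟨i, hi⟩ := ⟨_, rfl⟩
    simp only [h, dif_pos]
    rw [rowCode_eq_iff]
    intro c hc
    exact congrFun h.choose_spec ⟨c, hc⟩
  let f : EuclideanSpace ℝ (Fin d) → Fin d → ℕ → ℝ≥0∞ := fun z c m =>
    bump l ((z c - y) / s + ((ω c).1 : ℝ) - m)
  set A := ENNReal.ofReal (Real.exp (l * (r / s) ^ 2)) with hA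
  -- An occupied cell contains a point within `r` of a center, so this center is within `r / s` of
  -- the cell in scaled units, and the factor `A` compensates its Gaussian weight.
  have hone : ∀ w ∈ Finset.univ.image v, 1 ≤ ∑ z ∈ C, A * ∏ c, f z c (w c) := by
    intro w hw
    obtain ⟨i, -, rfl⟩ := Finset.mem_image.mp hw
    obtain ⟨z, hz, hzr⟩ := hC i
    refine le_trans ?_ (Finset.single_le_sum (f := fun z => A * ∏ c, f z c (v i c))
      (fun _ _ => zero_le) hz)
    simp only [f, bump, hA]
    rw [← ENNReal.ofReal_prod_of_nonneg (fun _ _ => (Real.exp_pos _).le), ← Real.exp_sum,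
      ← ENNReal.ofReal_mul (Real.exp_pos _).le, ← Real.exp_add, ENNReal.one_le_ofReal,
      Real.one_le_exp_iff, ← Finset.mul_sum]
    have hδ : ∀ c : Fin d, max 0 (max (-((z c - y) / s + ((ω c).1 : ℝ) - v i c))
        ((z c - y) / s + ((ω c).1 : ℝ) - v i c - 1)) ^ 2 ≤ (dist (p i c) (z c)) ^ 2 / s ^ 2 := by
      intro c
      obtain ⟨h1, h2⟩ := hv i c
      rw [← div_pow]
      refine pow_le_pow_left₀ (le_max_left _ _) ?_ 2
      have e : (p i c - y) / s = (z c - y) / s + (p i c - z c) / s := by ring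
      have h3 := le_abs_self ((p i c - z c) / s)
      have h4 := neg_abs_le ((p i c - z c) / s)
      rw [abs_div, abs_of_pos hs] at h3 h4
      rw [Real.dist_eq]
      refine max_le (by positivity) (max_le ?_ ?_) <;> linarith
    have hsum := Finset.sum_le_sum fun c (_ : c ∈ Finset.univ) => hδ c
    rw [← Finset.sum_div] at hsum
    have hdist : ∑ c, dist (p i c) (z c) ^ 2 ≤ r ^ 2 := by
      rw [← EuclideanSpace.dist_sq_eq]
      exact pow_le_pow_left₀ dist_nonneg hzr 2
    have hfin : ∑ c, max 0 (max (-((z c - y) / s + ((ω c).1 : ℝ) - v i c))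
        ((z c - y) / s + ((ω c).1 : ℝ) - v i c - 1)) ^ 2 ≤ (r / s) ^ 2 := by
      rw [div_pow]
      exact hsum.trans (div_le_div_of_nonneg_right hdist (by positivity))
    have := mul_le_mul_of_nonneg_left hfin hl
    linarith
  -- All occupied cells lie in a finite box, over which the sum of products is a product of sums.
  obtain ⟨R, hR⟩ : ∃ R, ∀ i c, v i c < R :=
    ⟨(∑ i, ∑ c, v i c) + 1, fun i c => Nat.lt_succ_of_le
      ((Finset.single_le_sum (f := fun c => v i c) (fun _ _ => Nat.zero_le _)
        (Finset.mem_univ c)).trans (Finset.single_le_sum (f := fun i => ∑ c, v i c)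
        (fun _ _ => Nat.zero_le _) (Finset.mem_univ i)))⟩
  calc (rowCount L d n : ℝ≥0∞) ≤ ((Finset.univ.image v).card : ℝ≥0∞) := by exact_mod_cast hcard
    _ = ∑ w ∈ Finset.univ.image v, 1 := by simp
    _ ≤ ∑ w ∈ Finset.univ.image v, ∑ z ∈ C, A * ∏ c, f z c (w c) := Finset.sum_le_sum hone
    _ = ∑ z ∈ C, A * ∑ w ∈ Finset.univ.image v, ∏ c, f z c (w c) := by
        rw [Finset.sum_comm]
        simp_rw [Finset.mul_sum]
    _ ≤ ∑ z ∈ C, A * ∏ c, ∑' m, f z c m := by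
        refine Finset.sum_le_sum fun z _ => mul_le_mul_right ?_ _
        calc ∑ w ∈ Finset.univ.image v, ∏ c, f z c (w c)
            ≤ ∑ w ∈ Fintype.piFinset fun _ : Fin d => Finset.range R, ∏ c, f z c (w c) := by
              refine Finset.sum_le_sum_of_subset fun w hw => ?_
              obtain ⟨i, -, rfl⟩ := Finset.mem_image.mp hw
              simpa using hR i
          _ = ∏ c, ∑ m ∈ Finset.range R, f z c m := (Finset.prod_univ_sum _ _).symm
          _ ≤ ∏ c, ∑' m, f z c m := Finset.prod_le_prod' fun c _ => ENNReal.sum_le_tsum _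
    _ = A * cellWeight C d l (fun z c => (z c - y) / s) ω := by
        rw [cellWeight, Finset.mul_sum]

/-! ### Numerical estimates -/

/-- Here `b` stands for `β ^ (2/3)`. The parameter `64 * b ^ 2` makes both factors exponentials of a
multiple of `d / b`; their coefficients 1/16 and 0.4432 (at least `√π / 4`) add up to less than `log
2`. -/
theorem exp_mul_pow_le_two_pow {b ρ : ℝ} {d E : ℕ} (hb : 1 ≤ b) (hE : (d : ℝ) ≤ E * b)
    (hρ : ρ ^ 2 ≤ d / (1024 * b ^ 3)) :
    Real.exp (64 * b ^ 2 * ρ ^ 2) * (1 + 2 * Real.sqrt (Real.pi / (64 * b ^ 2))) ^ d ≤ 2 ^ E := by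
  have hb0 : 0 < b := by linarith
  have hdb : (d : ℝ) / b ≤ E := by rwa [div_le_iff₀ hb0]
  have h1 : 64 * b ^ 2 * ρ ^ 2 ≤ E / 16 := by
    calc 64 * b ^ 2 * ρ ^ 2 ≤ 64 * b ^ 2 * (d / (1024 * b ^ 3)) := by gcongr
      _ = d / b / 16 := by field_simp; ring
      _ ≤ E / 16 := by gcongr
  have hpi : Real.sqrt Real.pi ≤ 1.7725 := by
    rw [Real.sqrt_le_left (by norm_num)]
    have := Real.pi_lt_d4
    norm_num at this ⊢
    linarith
  have h2 : 1 + 2 * Real.sqrt (Real.pi / (64 * b ^ 2)) ≤ Real.exp (0.4432 / b) := by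
    have e : Real.sqrt (Real.pi / (64 * b ^ 2)) = Real.sqrt Real.pi / (8 * b) := by
      rw [Real.sqrt_div Real.pi_pos.le, show 64 * b ^ 2 = (8 * b) ^ 2 by ring,
        Real.sqrt_sq (by positivity)]
    rw [e]
    have h3 : 2 * (Real.sqrt Real.pi / (8 * b)) ≤ 0.4432 / b := by
      rw [show 2 * (Real.sqrt Real.pi / (8 * b)) = Real.sqrt Real.pi / 4 / b by field_simp; norm_num]
      gcongr
      norm_num at hpi ⊢
      linarith
    have := Real.add_one_le_exp (0.4432 / b)
    linarith
  calc Real.exp (64 * b ^ 2 * ρ ^ 2) * (1 + 2 * Real.sqrt (Real.pi / (64 * b ^ 2))) ^ d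
      ≤ Real.exp (E / 16) * Real.exp (0.4432 / b) ^ d := by gcongr
    _ = Real.exp (E / 16 + 0.4432 * (d / b)) := by
        rw [← Real.exp_nat_mul, ← Real.exp_add]; congr 1; ring
    _ ≤ Real.exp (E * Real.log 2) := by
        rw [Real.exp_le_exp]
        have := Real.log_two_gt_d9
        have hE0 : (0 : ℝ) ≤ E := E.cast_nonneg
        norm_num at this ⊢
        nlinarith
    _ = 2 ^ E := by rw [Real.exp_nat_mul, Real.exp_log (by norm_num)]

/-- Rounding `d / b` up to `E` costs one factor 2; otherwise `2 ≤ e` is used. -/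
theorem two_pow_le_two_mul_exp {b : ℝ} {d E : ℕ} (hb : 1 ≤ b)
    (hE : E = 0 ∨ ((E : ℝ) - 1) ^ 3 * b ^ 3 < (d : ℝ) ^ 3) :
    (2 : ℝ) ^ E ≤ 2 * Real.exp (d / b) := by
  have hb0 : 0 < b := by linarith
  rcases Nat.eq_zero_or_pos E with rfl | hpos
  · have := Real.one_le_exp (show (0 : ℝ) ≤ d / b by positivity)
    rw [pow_zero]; linarith
  · obtain ⟨m, rfl⟩ : ∃ m, E = m + 1 := ⟨E - 1, by omega⟩
    have h := hE.resolve_left (by omega)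
    push_cast at h
    rw [add_sub_cancel_right, ← mul_pow] at h
    have h1 : (m : ℝ) * b < d := lt_of_pow_lt_pow_left₀ 3 (by positivity) h
    have h2 : (m : ℝ) ≤ d / b := by rw [le_div_iff₀ hb0]; exact h1.le
    have h3 : (2 : ℝ) ≤ Real.exp 1 := by have := Real.add_one_le_exp 1; linarith
    calc (2 : ℝ) ^ (m + 1) = 2 * 2 ^ m := by ring
      _ ≤ 2 * Real.exp 1 ^ m := by gcongr
      _ = 2 * Real.exp m := by rw [← Real.exp_nat_mul, mul_one]
      _ ≤ 2 * Real.exp (d / b) := by gcongr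

open RealRAM.Expr hiding cost
open RealRAM.Test hiding cost
open RealRAM.Prog

/-! ### The algorithm -/

/-- The deterministic part of the algorithm. -/
def prepProg : Prog := seq sizeProg <| seq coarseProg <| seq sqrtProg boundProg

/-- Covers the input by few of its points. -/
def coverProg : Prog :=
  seq (assign 50 (mul (reg 0) (reg 1))) <|
  -- Returning the input here guarantees `d < n` in the other branch, where the time `n * d * log (n
  -- * d)` is needed in terms of `log n`.
  ite (le (reg 0) (mul (reg 2) (reg 1)))
    (forUp 51 50 (store 1 (reg 51) (get 0 (reg 51))))
    (seq prepProg (seq drawProg levelsProg))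

variable {ω : Tape}

/-- What the deterministic part of the algorithm achieves. -/
structure Prepared (n d k : ℕ) (β : ℝ) (x : ℕ → ℝ) (τ : State) (K D E : ℕ) : Prop where
  le_pow : n * d ≤ 2 ^ K
  pow_le : 2 ^ K ≤ 2 * (n * d)
  reg5 : τ.reg 5 = K
  reg37_nonneg : 0 ≤ τ.reg 37
  lower : ∃ L, k < rowCount L d n ∧
    ∀ q < 2 ^ K, ∀ q' < 2 ^ K, L q ≠ L q' → τ.reg 37 ≤ |x q - x q'|
  upper : ∃ L, rowCount L d n ≤ k ∧ ∀ q < 2 ^ K, ∀ q' < 2 ^ K, L q = L q' →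
    |x q - x q'| ≤ (2 ^ K : ℕ) * τ.reg 37
  min : ∀ q < 2 ^ K, x ⌊τ.arr 2 0⌋₊ ≤ x q
  reg40 : τ.reg 40 = D
  one_le : 1 ≤ D
  le_sq : d ≤ D * D
  sq_le : D * D ≤ 4 * d
  reg41 : τ.reg 41 = 200 * k * 2 ^ E
  le_cube : (d : ℝ) ^ 3 ≤ (E : ℝ) ^ 3 * β ^ 2
  cube_lt : E = 0 ∨ ((E : ℝ) - 1) ^ 3 * β ^ 2 < (d : ℝ) ^ 3

theorem runs_prepProg {σ : State} {n d k : ℕ} {β : ℝ} (hn : 1 ≤ n) (hd : 1 ≤ d) (hk : 1 ≤ k)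
    (hkn : k < n) (hβ : 1 ≤ β) (h0 : σ.reg 0 = n) (h1 : σ.reg 1 = d) (h2 : σ.reg 2 = k)
    (h3 : σ.reg 3 = β) (h50 : σ.reg 50 = (n * d : ℕ)) :
    Runs ω prepProg σ ((Nat.log 2 (2 * (n * d)) + 1) * (n * d * 2300)) fun τ =>
      ∃ K D E, Prepared n d k β (σ.arr 0) τ K D E := by
  set m := n * d with hm
  have hm1 : 1 ≤ m := Nat.mul_pos hn hd
  have hdm : d ≤ m := Nat.le_mul_of_pos_left _ hn
  set l := Nat.log 2 (2 * m) with hl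
  have e1 : (l + 1) * (m * 2300) = (l + 1) * (m * 2000) + l * (m * 300) + m * 300 := by ring
  refine Runs.seq (T₁ := m * 40 + 20) (T₂ := (l + 1) * (m * 2000) + (d * 100 + 60))
    (runs_sizeProg hm1 h50) ?_ (by omega)
  rintro τ ⟨K, h4, h5, hK, hK'⟩ hfr
  have hKl : K ≤ l := Nat.le_log_of_pow_le (by norm_num) hK'
  have hr (y : ℕ) (hy : y ∉ sizeProg.regs) : τ.reg y = σ.reg y := hfr.reg y hy
  have ha : τ.arr 0 = σ.arr 0 := hfr.arr 0 (by decide)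
  have hT : (K + 1) * (2 ^ K * 1000) ≤ (l + 1) * (m * 2000) :=
    Nat.mul_le_mul (by omega) (by omega)
  refine Runs.seq (T₁ := (K + 1) * (2 ^ K * 1000)) (T₂ := d * 100 + 60)
    (runs_coarseProg hd hK hk hkn (by rw [hr 0 (by decide), h0]) (by rw [hr 1 (by decide), h1])
      (by rw [hr 2 (by decide), h2]) h4 h5) ?_ (by omega)
  rintro τ₁ ⟨hc1, hc2, hc3, hc4⟩ hfr₁
  rw [ha] at hc2 hc3 hc4
  refine Runs.seq (T₁ := d * 40 + 20) (T₂ := d * 60 + 30)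
    (runs_sqrtProg hd (by rw [hfr₁.reg 1 (by decide), hr 1 (by decide), h1])) ?_ (by omega)
  rintro τ₂ ⟨D, hD1, hD2, hD3, hD4⟩ hfr₂
  refine (runs_boundProg (k := k) hβ
    (by rw [hfr₂.reg 1 (by decide), hfr₁.reg 1 (by decide), hr 1 (by decide), h1])
    (by rw [hfr₂.reg 2 (by decide), hfr₁.reg 2 (by decide), hr 2 (by decide), h2])
    (by rw [hfr₂.reg 3 (by decide), hfr₁.reg 3 (by decide), hr 3 (by decide), h3])).mono le_rfl ?_
  rintro τ₃ ⟨E, hE1, hE2, hE3⟩ hfr₃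
  have h37 : τ₃.reg 37 = τ₁.reg 37 := by rw [hfr₃.reg 37 (by decide), hfr₂.reg 37 (by decide)]
  have ha2 : τ₃.arr 2 = τ₁.arr 2 := by rw [hfr₃.arr 2 (by decide), hfr₂.arr 2 (by decide)]
  refine ⟨K, D, E, hK, hK', ?_, by rwa [h37], by rwa [h37], by rwa [h37], by rwa [ha2], ?_, hD2, hD3,
    hD4, hE1, hE2, hE3⟩
  · rw [hfr₃.reg 5 (by decide), hfr₂.reg 5 (by decide), hfr₁.reg 5 (by decide), h5]
  · rw [hfr₃.reg 40 (by decide), hD1]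

/-! ### Correctness -/

section Correctness

variable {n d k : ℕ} (p : Fin n → EuclideanSpace ℝ (Fin d)) {β : ℝ}

theorem mul_add_lt (i : Fin n) (c : Fin d) : (i : ℕ) * d + c < n * d := by
  calc (i : ℕ) * d + c < i * d + d := by omega
    _ = (i + 1) * d := by ring
    _ ≤ n * d := Nat.mul_le_mul_right _ i.2

theorem initState_arr_zero (k : ℕ) (β : ℝ) (i : Fin n) (c : Fin d) :
    (initState p k β).arr 0 (i * d + c) = p i c := by
  have hd : 0 < d := c.pos
  have h1 : ((i : ℕ) * d + c) / d = i := by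
    rw [Nat.add_comm, Nat.add_mul_div_right _ _ hd, Nat.div_eq_of_lt c.2, zero_add]
  have h2 : ((i : ℕ) * d + c) % d = c := by
    rw [Nat.mul_comm, Nat.mul_add_mod, Nat.mod_eq_of_lt c.2]
  simp [initState, h1, h2, hd]

theorem outputSet_subset_and_ncard_le {τ : State} {N : ℕ} (h0 : τ.reg 0 = N)
    (h : ∀ i < N, ∃ a : Fin n, ∀ c : Fin d, τ.arr 1 (i * d + c) = p a c) :
    outputSet d τ ⊆ Set.range p ∧ (outputSet d τ).ncard ≤ N := by
  have hsub : outputSet d τ ⊆ (fun i : ℕ => WithLp.toLp 2 fun c : Fin d => τ.arr 1 (i * d + c)) ''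
      (Finset.range N : Set ℕ) := by
    rintro x ⟨i, hi, hx⟩
    rw [h0, Nat.floor_natCast] at hi
    refine ⟨i, by simpa using hi, ?_⟩
    ext c
    simp [hx c]
  constructor
  · rintro x ⟨i, hi, hx⟩
    rw [h0, Nat.floor_natCast] at hi
    obtain ⟨a, ha⟩ := h i hi
    refine ⟨a, ?_⟩
    ext c
    rw [hx c, ha c]
  · calc (outputSet d τ).ncard ≤ _ := Set.ncard_le_ncard hsub ((Finset.finite_toSet _).image _)
      _ ≤ (Finset.range N : Set ℕ).ncard := Set.ncard_image_le (Finset.finite_toSet _)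
      _ = N := by rw [Set.ncard_coe_finset, Finset.card_range]

theorem kCenterOpt_nonneg {X : Type*} [PseudoMetricSpace X] (k : ℕ) (P : Set X) :
    0 ≤ kCenterOpt k P := Real.iInf_nonneg fun _ => kCenterCost_nonneg _ _

theorem Prepared.bounds {τ : State} {x : ℕ → ℝ} {K D E : ℕ}
    (h : Prepared n d k β x τ K D E) (hp : Function.Injective p)
    (hx : ∀ (i : Fin n) (c : Fin d), x (i * d + c) = p i c) (hn : 1 ≤ n) (hd : 1 ≤ d) (hk : 1 ≤ k)
    (hkn : k < n) : 0 < τ.reg 37 ∧ τ.reg 37 ≤ 2 * kCenterOpt k (Set.range p) ∧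
      2 * kCenterOpt k (Set.range p) ≤ τ.reg 37 * 2 ^ (2 * K + 1) := by
  have hlt (i : Fin n) (c : Fin d) : (i : ℕ) * d + c < 2 ^ K := (mul_add_lt i c).trans_le h.le_pow
  obtain ⟨L, hL1, hL2⟩ := h.lower
  obtain ⟨L', hL1', hL2'⟩ := h.upper
  refine ⟨?_, ?_, ?_⟩
  -- If the estimate were 0, two of the `n` points would share one of at most `k < n` rows and agree
  -- in all coordinates, contrary to distinctness.
  · refine h.reg37_nonneg.lt_of_ne fun h0 => ?_
    obtain ⟨i, j, hij, hrow⟩ := exists_ne_of_rowCount_lt (hL1'.trans_lt hkn)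
    refine hij (hp ?_)
    ext c
    have := hL2' _ (hlt i c) _ (hlt j c) (hrow c c.2)
    rw [← h0, mul_zero, hx, hx] at this
    exact sub_eq_zero.mp (abs_nonpos_iff.mp this)
  · refine le_kCenterOpt_of_rowCount p hd hk (fun i j c hne => ?_) hL1
    rw [← hx, ← hx]
    exact hL2 _ (hlt i c) _ (hlt j c) hne
  · have hW := h.reg37_nonneg
    have hup : kCenterOpt k (Set.range p) ≤ Real.sqrt d * ((2 ^ K : ℕ) * τ.reg 37) := by
      refine kCenterOpt_le_of_rowCount p hn hd (fun i j hrow => ?_) hL1'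
      refine dist_le_sqrt_mul (by positivity) fun c => ?_
      rw [← hx, ← hx]
      exact hL2' _ (hlt i c) _ (hlt j c) (hrow c c.2)
    have hdK : Real.sqrt d ≤ 2 ^ K := by
      rw [Real.sqrt_le_left (by positivity)]
      have h1 : d ≤ 2 ^ K := (Nat.le_mul_of_pos_left _ hn).trans h.le_pow
      have h2 : (d : ℝ) ≤ 2 ^ K := by exact_mod_cast h1
      have h3 : (1 : ℝ) ≤ 2 ^ K := one_le_pow₀ (by norm_num)
      nlinarith
    have : Real.sqrt d * ((2 ^ K : ℕ) * τ.reg 37) ≤ 2 ^ K * (2 ^ K * τ.reg 37) := by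
      push_cast
      gcongr
    calc 2 * kCenterOpt k (Set.range p) ≤ 2 * (2 ^ K * (2 ^ K * τ.reg 37)) := by linarith
      _ = τ.reg 37 * 2 ^ (2 * K + 1) := by ring

/-- The least level that reaches `2 * o` overshoots by at most a factor 2. -/
theorem exists_level {W o : ℝ} {K : ℕ} (hW : W ≤ 2 * o) (hK : 2 * o ≤ W * 2 ^ (2 * K + 1))
    (ho : 0 ≤ o) : ∃ l < 2 * K + 2, 2 * o ≤ W * 2 ^ l ∧ W * 2 ^ l ≤ 4 * o := by
  classical
  have hex : ∃ l, 2 * o ≤ W * 2 ^ l := ⟨_, hK⟩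
  refine ⟨Nat.find hex, Nat.lt_succ_of_le (Nat.find_le hK), Nat.find_spec hex, ?_⟩
  rcases Nat.eq_zero_or_pos (Nat.find hex) with h | h
  · rw [h, pow_zero]; linarith
  · have := Nat.find_min hex (Nat.sub_lt h one_pos)
    obtain ⟨m, hm⟩ : ∃ m, Nat.find hex = m + 1 := ⟨Nat.find hex - 1, by omega⟩
    rw [hm] at this ⊢
    simp only [Nat.add_sub_cancel, not_le] at this
    rw [pow_succ]
    linarith

/-- Markov's inequality: the factor 200 leaves failure probability at most 0.005. -/
theorem le_measureReal_of_lintegral_le {F : Tape → ENNReal} (hF : Measurable F) {a : ENNReal}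
    (ha : a ≠ 0) (ha' : a ≠ ⊤) (h : ∫⁻ ω, F ω ∂tapeMeasure ≤ a) :
    (0.991 : ℝ) ≤ tapeMeasure.real {ω | F ω ≤ 200 * a} := by
  have hmeas : MeasurableSet {ω | F ω ≤ 200 * a} := measurableSet_le hF measurable_const
  have h1 : tapeMeasure {ω | F ω ≤ 200 * a}ᶜ ≤ ENNReal.ofReal (1 / 200) := by
    calc tapeMeasure {ω | F ω ≤ 200 * a}ᶜ ≤ tapeMeasure {ω | 200 * a ≤ F ω} :=
          measure_mono fun ω (hω : ¬ F ω ≤ 200 * a) => (not_le.mp hω).le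
      _ ≤ (∫⁻ ω, F ω ∂tapeMeasure) / (200 * a) :=
          meas_ge_le_lintegral_div hF.aemeasurable (by simp [ha]) (ENNReal.mul_ne_top (by simp) ha')
      _ ≤ a / (200 * a) := by gcongr
      _ = 1 * a / (200 * a) := by rw [one_mul]
      _ = 1 / 200 := ENNReal.mul_div_mul_right _ _ ha ha'
      _ = ENNReal.ofReal (1 / 200) := by
          rw [ENNReal.ofReal_div_of_pos (by norm_num), ENNReal.ofReal_one,
            show ENNReal.ofReal 200 = 200 by simp]
  have h2 : tapeMeasure.real {ω | F ω ≤ 200 * a}ᶜ ≤ 1 / 200 :=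
    ENNReal.toReal_le_of_le_ofReal (by norm_num) h1
  rw [probReal_compl_eq_one_sub hmeas] at h2
  linarith

theorem abs_sub_le_of_cell_eq {x : ℕ → ℝ} {y s : ℝ} {u : ℕ → ℝ} {q q' : ℕ} (hs : 0 < s)
    (hq : y ≤ x q) (hq' : y ≤ x q') (hmod : q % d = q' % d) (hu : 0 ≤ u (q % d))
    (h : cell x y s u d q = cell x y s u d q') : |x q - x q'| ≤ s := by
  rw [cell, cell, ← hmod] at h
  have h1 := Nat.floor_le (add_nonneg (div_nonneg (sub_nonneg.mpr hq) hs.le) hu)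
  have h2 := Nat.lt_floor_add_one ((x q - y) / s + u (q % d))
  have h3 := Nat.floor_le (add_nonneg (div_nonneg (sub_nonneg.mpr hq') hs.le) hu)
  have h4 := Nat.lt_floor_add_one ((x q' - y) / s + u (q % d))
  rw [h] at h1 h2
  have e : (x q - y) / s - (x q' - y) / s = (x q - x q') / s := by ring
  have h5 : |(x q - x q') / s| ≤ 1 := by rw [← e, abs_le]; constructor <;> linarith
  rwa [abs_div, abs_of_pos hs, div_le_one hs] at h5

/-- The number of occupied cells at a level that fits the optimal value is small, with high
probability. -/
theorem exists_measurableSet_rowCount_le {x : ℕ → ℝ} {y W b : ℝ} {D E l : ℕ} (hd : 1 ≤ d)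
    (hk : 1 ≤ k) (hβ : 1 ≤ β) (hb : 1 ≤ b) (hbβ : b ^ 3 = β ^ 2)
    (hx : ∀ (i : Fin n) (c : Fin d), x (i * d + c) = p i c)
    (hy : ∀ (i : Fin n) (c : Fin d), y ≤ p i c) (hopt : 0 < kCenterOpt k (Set.range p))
    (hl : 2 * kCenterOpt k (Set.range p) ≤ W * 2 ^ l) (hD : 1 ≤ D) (hD' : D * D ≤ 4 * d)
    (hE : (d : ℝ) ^ 3 ≤ (E : ℝ) ^ 3 * β ^ 2) :
    ∃ G : Set Tape, MeasurableSet G ∧ (0.991 : ℝ) ≤ tapeMeasure.real G ∧ ∀ ω ∈ G,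
      (rowCount (cell x y (64 * β * W / D * 2 ^ l) (fun c => (ω c).1) d) d n : ℝ) ≤
        200 * k * 2 ^ E := by
  set o := kCenterOpt k (Set.range p) with ho
  set s := 64 * β * W / D * 2 ^ l with hs
  have hb0 : 0 < b := by linarith
  have hD0 : (0 : ℝ) < D := by exact_mod_cast hD
  have hWl : 0 < W * 2 ^ l := by linarith
  have hseq : s = 64 * β / D * (W * 2 ^ l) := by rw [hs]; ring
  have hs0 : 0 < s := by rw [hseq]; positivity
  have := nonempty_centers (k := k) hd
  -- Cost below `2 * o` avoids showing that the infimum is attained; positivity of `o` makes this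
  -- possible.
  obtain ⟨⟨C, hC⟩, hcost⟩ := exists_lt_of_ciInf_lt
    (show (⨅ C : {C : Finset (EuclideanSpace ℝ (Fin d)) // C.card = k},
      kCenterCost (Set.range p) C.1) < 2 * o by change o < 2 * o; linarith)
  have hCne : C.Nonempty := Finset.card_pos.mp (by omega)
  have hcen : ∀ i, ∃ z ∈ C, dist (p i) z ≤ 2 * o := fun i => by
    obtain ⟨z, hz, hzd⟩ := exists_center (Set.finite_range p) hCne (Set.mem_range_self i)
    exact ⟨z, hz, hzd.trans hcost.le⟩
  have hρ : (2 * o / s) ^ 2 ≤ d / (1024 * b ^ 3) := by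
    have h1 : 2 * o / s ≤ D / (64 * β) := by
      rw [div_le_div_iff₀ hs0 (by positivity), hseq]
      calc 2 * o * (64 * β) ≤ W * 2 ^ l * (64 * β) := by gcongr
        _ = D * (64 * β / D * (W * 2 ^ l)) := by field_simp
    have h2 : (D : ℝ) * D ≤ 4 * d := by exact_mod_cast hD'
    calc (2 * o / s) ^ 2 ≤ (D / (64 * β)) ^ 2 := by gcongr
      _ = D * D / (4096 * β ^ 2) := by ring
      _ ≤ 4 * d / (4096 * β ^ 2) := by gcongr
      _ = d / (1024 * b ^ 3) := by rw [hbβ]; field_simp; norm_num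
  have hdE : (d : ℝ) ≤ E * b := by
    refine le_of_pow_le_pow_left₀ (n := 3) (by norm_num) (by positivity) ?_
    rwa [mul_pow, hbβ]
  have hnum := exp_mul_pow_le_two_pow hb hdE hρ
  let A := ENNReal.ofReal (Real.exp (64 * b ^ 2 * (2 * o / s) ^ 2))
  let F : Tape → ENNReal := fun ω =>
    A * cellWeight C d (64 * b ^ 2) (fun z c => (z c - y) / s) ω
  have hF : Measurable F := (measurable_cellWeight _ _ _ _).const_mul _
  have hint : ∫⁻ ω, F ω ∂tapeMeasure ≤ ENNReal.ofReal (k * 2 ^ E) := by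
    calc ∫⁻ ω, F ω ∂tapeMeasure
        = A * ∫⁻ ω, cellWeight C d (64 * b ^ 2) (fun z c => (z c - y) / s) ω ∂tapeMeasure :=
          lintegral_const_mul _ (measurable_cellWeight _ _ _ _)
      _ ≤ A * (C.card * ENNReal.ofReal (1 + 2 * Real.sqrt (Real.pi / (64 * b ^ 2))) ^ d) :=
          mul_le_mul_right (lintegral_cellWeight_le C d (by positivity) _) _
      _ = ENNReal.ofReal (k * (Real.exp (64 * b ^ 2 * (2 * o / s) ^ 2) *
            (1 + 2 * Real.sqrt (Real.pi / (64 * b ^ 2))) ^ d)) := by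
          rw [hC, ENNReal.ofReal_mul (by positivity), ENNReal.ofReal_mul (Real.exp_pos _).le,
            ENNReal.ofReal_pow (by positivity), ENNReal.ofReal_natCast]
          ring
      _ ≤ ENNReal.ofReal (k * 2 ^ E) := by gcongr
  have hk0 : (0 : ℝ) < k := by exact_mod_cast hk
  refine ⟨{ω | F ω ≤ 200 * ENNReal.ofReal (k * 2 ^ E)}, measurableSet_le hF measurable_const,
    le_measureReal_of_lintegral_le hF (ENNReal.ofReal_pos.mpr (by positivity)).ne'
      ENNReal.ofReal_ne_top hint, fun ω hω => ?_⟩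
  have h1 := (rowCount_cell_le (ω := ω) (l := 64 * b ^ 2) p hx hy hs0 (by positivity) hcen).trans hω
  rw [show (200 : ENNReal) = ENNReal.ofReal 200 by simp, ← ENNReal.ofReal_mul (by norm_num),
    ← ENNReal.ofReal_natCast, ENNReal.ofReal_le_ofReal_iff (by positivity)] at h1
  linarith

/-- A point for each occupied cell covers all points. -/
theorem isCovering_of_isRepr {x : ℕ → ℝ} {y s : ℝ} {u : ℕ → ℝ} {τ : State} {D : ℕ} {R : ℝ}
    (hs : 0 < s) (hx : ∀ (i : Fin n) (c : Fin d), x (i * d + c) = p i c)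
    (hy : ∀ (i : Fin n) (c : Fin d), y ≤ p i c) (hu : ∀ c, 0 ≤ u c) (hD : d ≤ D * D)
    (hR : D * s ≤ R) (h0 : τ.reg 0 = rowCount (cell x y s u d) d n)
    (hrep : IsRepr n d (rowCount (cell x y s u d) d n) (cell x y s u d) x (τ.arr 1)) :
    IsCovering R (Set.range p) (outputSet d τ) := by
  obtain ⟨rep, h1, h2⟩ := hrep
  refine ⟨(outputSet_subset_and_ncard_le p h0 fun i hi => ⟨⟨rep i, (h1 i hi).1⟩, fun c => ?_⟩).1, ?_⟩
  · rw [(h1 i hi).2 c c.2, ← hx]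
  rintro _ ⟨i, rfl⟩
  obtain ⟨j, hj, hrow⟩ := h2 i i.2
  refine ⟨p ⟨rep j, (h1 j hj).1⟩, ⟨j, by rwa [h0, Nat.floor_natCast], fun c => ?_⟩, ?_⟩
  · rw [(h1 j hj).2 c c.2, ← hx]
  · have hdist : dist (p i) (p ⟨rep j, (h1 j hj).1⟩) ≤ Real.sqrt d * s := by
      refine dist_le_sqrt_mul hs.le fun c => ?_
      have hx' := hx ⟨rep j, (h1 j hj).1⟩ c
      rw [← hx i c, ← hx']
      refine abs_sub_le_of_cell_eq (d := d) hs (by rw [hx]; exact hy _ _)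
        (by rw [hx']; exact hy _ _) ?_ (hu _) (hrow c c.2).symm
      simp
    have hsq : Real.sqrt d ≤ D := by
      rw [Real.sqrt_le_left (by positivity)]
      have : (d : ℝ) ≤ D * D := by exact_mod_cast hD
      nlinarith
    exact hdist.trans ((mul_le_mul_of_nonneg_right hsq hs.le).trans hR)

/-- Uses `2 * m ≤ (n + 1) ^ 3`, together with `log 2 ≤ log (n + 1)` for the summand 1. -/
theorem log_add_one_le {m : ℕ} (hn : 1 ≤ n) (hm1 : 1 ≤ m) (hm : m ≤ n * n) :
    (Nat.log 2 (2 * m) : ℝ) + 1 ≤ 6 * Real.log (n + 1) := by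
  have h1 : 2 ^ Nat.log 2 (2 * m) ≤ 2 * m := Nat.pow_log_le_self 2 (by omega)
  have hn' : (1 : ℝ) ≤ n := by exact_mod_cast hn
  have h2 : (2 : ℝ) ^ (Nat.log 2 (2 * m)) ≤ (n + 1) ^ 3 := by
    have h3 : (2 : ℝ) ^ (Nat.log 2 (2 * m)) ≤ 2 * m := by exact_mod_cast h1
    have h4 : (m : ℝ) ≤ n * n := by exact_mod_cast hm
    nlinarith [sq_nonneg (n : ℝ)]
  have h5 := Real.log_le_log (by positivity) h2
  rw [Real.log_pow, Real.log_pow] at h5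
  have h6 := Real.log_two_gt_d9
  have h7 : Real.log 2 ≤ Real.log (n + 1) := Real.log_le_log (by norm_num) (by linarith)
  have h8 : (0 : ℝ) ≤ Nat.log 2 (2 * m) := Nat.cast_nonneg _
  norm_num at h5 h6
  nlinarith

end Correctness

/-! ### Time, size and covering radius of the whole algorithm -/

variable {n d k : ℕ} (p : Fin n → EuclideanSpace ℝ (Fin d)) {β : ℝ}

/-- The algorithm returns the input if it has at most `k * d` points. -/
theorem runs_coverProg_of_le {ω : Tape} (hsmall : n ≤ k * d) :
    Runs ω coverProg (initState p k β) (n * d * 20 + 30) fun τ =>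
      τ.reg 0 = n ∧ ∀ (i : Fin n) (c : Fin d), τ.arr 1 (i * d + c) = p i c := by
  refine Runs.seq_assign (T₂ := n * d * 20 + 20) (n * d : ℕ) (by simp [eval, initState])
    (by simp [Expr.cost]; omega) ?_
  refine Runs.ite (T₁ := n * d * 20 + 8) (fun _ => ?_) (fun hb => ?_)
    (by simp [Test.cost, Expr.cost]; omega)
  · refine Runs.forUp (T₁ := 10) (n * d) (fun i τ =>
      ∀ q < i, τ.arr 1 q = (initState p k β).arr 0 q) (by simp)
      (by decide) (by decide) (by decide) (by simp) ?_ (by omega) ?_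
    · intro i hi τ hI h51 _ hfr
      have ha : τ.arr 0 = (initState p k β).arr 0 := by rw [hfr.arr 0 (by decide)]; simp
      refine Runs.store i _ (by simp [eval, h51]) rfl (by simp [Expr.cost]) fun q hq => ?_
      by_cases h : q = i
      · subst h; simp [eval, h51, ha]
      · simp [h, hI q (by omega)]
    · intro τ hτ _ hfr
      refine ⟨by rw [hfr.reg 0 (by decide)]; simp [initState], fun i c => ?_⟩
      rw [hτ _ (mul_add_lt i c), initState_arr_zero]
  · refine absurd ?_ hb
    simp [Holds, eval, initState]
    exact_mod_cast hsmall

/-- The state of the algorithm before its random draws does not depend on the tape. -/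
theorem exists_prepared (hn : 1 ≤ n) (hd : 1 ≤ d) (hk : 1 ≤ k) (hβ : 1 ≤ β) (hkn : k < n) :
    ∃ (τ : State) (K D E : ℕ), Prepared n d k β ((initState p k β).arr 0) τ K D E ∧
      Frame prepProg ((initState p k β).setReg 50 (n * d : ℕ)) τ ∧
      ∀ ω, Runs ω prepProg ((initState p k β).setReg 50 (n * d : ℕ))
        ((Nat.log 2 (2 * (n * d)) + 1) * (n * d * 2300)) (· = τ) := by
  have h := runs_prepProg (ω := fun _ => (0, 0)) (σ := (initState p k β).setReg 50 (n * d : ℕ))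
    (n := n) (d := d) (k := k) (β := β) hn hd hk hkn hβ (by simp [initState])
    (by simp [initState]) (by simp [initState]) (by simp [initState]) (by simp)
  obtain ⟨τ, ⟨K, D, E, hprep⟩, hfr, hruns⟩ := h.of_not_random (by decide)
  exact ⟨τ, K, D, E, hprep, hfr, hruns⟩

/-- A run of the algorithm on more than `k * d` points. -/
theorem runs_coverProg_of_lt {ω : Tape} (hn : 1 ≤ n) (hd : 1 ≤ d) (hβ : 1 ≤ β) (hbig : k * d < n)
    {τ : State} {K D E : ℕ} (hprep : Prepared n d k β ((initState p k β).arr 0) τ K D E)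
    (hfr : Frame prepProg ((initState p k β).setReg 50 (n * d : ℕ)) τ)
    (hruns : Runs ω prepProg ((initState p k β).setReg 50 (n * d : ℕ))
        ((Nat.log 2 (2 * (n * d)) + 1) * (n * d * 2300)) (· = τ)) :
    let x := (initState p k β).arr 0
    let L := fun l => cell x (x ⌊τ.arr 2 0⌋₊) (64 * β * τ.reg 37 / D * 2 ^ l)
      (fun c => ((ω c).1 : ℝ)) d
    Runs ω coverProg (initState p k β) ((Nat.log 2 (2 * (n * d)) + 1) * (n * d * 4000)) fun τ' =>
      (τ'.reg 0 = 0 ∧ ∀ l < 2 * K + 2, (200 * k * 2 ^ E : ℝ) < rowCount (L l) d n) ∨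
      ∃ l, τ'.reg 0 = rowCount (L l) d n ∧ (rowCount (L l) d n : ℝ) ≤ 200 * k * 2 ^ E ∧
        (∀ l' < l, (200 * k * 2 ^ E : ℝ) < rowCount (L l') d n) ∧
        IsRepr n d (rowCount (L l) d n) (L l) x (τ'.arr 1) := by
  intro x L
  have hm1 : 1 ≤ n * d := Nat.mul_pos hn hd
  have hdm : d ≤ n * d := Nat.le_mul_of_pos_left _ hn
  set m := n * d with hm
  set g := Nat.log 2 (2 * m) with hg
  have hKg : K ≤ g := Nat.le_log_of_pow_le (by norm_num) hprep.pow_le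
  have e1 : (g + 1) * (m * 4000) = (g + 1) * (m * 2300) + g * (m * 1700) + m * 1700 := by ring
  have e2 : (2 * K + 2) * (m * 220 + 100) ≤ g * (m * 1700) + m * 640 := by
    calc (2 * K + 2) * (m * 220 + 100) ≤ (2 * g + 2) * (m * 320) :=
          Nat.mul_le_mul (by omega) (by omega)
      _ = g * (m * 640) + m * 640 := by ring
      _ ≤ g * (m * 1700) + m * 640 := by gcongr; norm_num
  have hreg (y : ℕ) (hy : y ∉ prepProg.regs) (hy' : y ≠ 50) :
      τ.reg y = (initState p k β).reg y := by rw [hfr.reg y hy]; simp [hy']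
  have ha : τ.arr 0 = x := hfr.arr 0 (by decide)
  refine Runs.seq_assign (T₂ := (g + 1) * (m * 2300) + (2 * K + 2) * (m * 220 + 100) + d * 20 + 120)
    (n * d : ℕ) (by simp [eval, initState]) (by simp [Expr.cost]; omega) ?_
  refine Runs.ite (T₁ := (g + 1) * (m * 2300) + (2 * K + 2) * (m * 220 + 100) + d * 20 + 100)
    (fun hb => ?_) (fun _ => ?_) (by simp [Test.cost, Expr.cost]; omega)
  · simp [Holds, eval, initState] at hb
    exact absurd (by exact_mod_cast hb : n ≤ k * d) (by omega)
  refine Runs.seq (T₂ := (2 * K + 2) * (m * 220 + 100) + d * 20 + 100) hruns ?_ (by omega)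
  intro τ₀ hτ _
  rw [hτ]
  refine Runs.seq (T₁ := d * 20 + 10) (T₂ := (2 * K + 2) * (m * 220 + 100) + 80)
    (runs_drawProg (by rw [hreg 1 (by decide) (by decide)]; simp [initState])
      (by rw [hfr.draws (by decide)]; simp [initState])) ?_ (by omega)
  intro τ₁ hu hfr₁
  have hreg₁ (y : ℕ) (hy : y ∉ (seq prepProg drawProg).regs) (hy' : y ≠ 50) :
      τ₁.reg y = (initState p k β).reg y := by
    simp only [Prog.regs, List.mem_append, not_or] at hy
    rw [hfr₁.reg y hy.2, hreg y hy.1 hy']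
  have ha₁ : τ₁.arr 0 = x := by rw [hfr₁.arr 0 (by decide), ha]
  have h37 : τ₁.reg 37 = τ.reg 37 := hfr₁.reg 37 (by decide)
  have hlt : m ≤ 2 ^ K := hprep.le_pow
  have hW := hprep.reg37_nonneg
  have h := runs_levelsProg (ω := ω) (σ := τ₁) (n := n) (d := d) (K := K)
    (u := fun c => ((ω c).1 : ℝ)) (s := 64 * β * τ.reg 37 / D) (y := x ⌊τ.arr 2 0⌋₊) hd
    (by rw [hreg₁ 0 (by decide) (by decide)]; simp [initState])
    (by rw [hreg₁ 1 (by decide) (by decide)]; simp [initState])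
    (by rw [hfr₁.reg 5 (by decide), hprep.reg5])
    (by rw [h37, hreg₁ 3 (by decide) (by decide), hfr₁.reg 40 (by decide), hprep.reg40]
        simp [initState])
    (by positivity) (by rw [ha₁, hfr₁.arr 2 (by decide)])
    (fun q hq => by rw [ha₁]; exact hprep.min q (hq.trans_le hlt)) hu
    (fun c _ => (ω c).1.2.1)
  rw [ha₁, hfr₁.reg 41 (by decide), hprep.reg41] at h
  exact h.mono le_rfl fun _ h _ => h

theorem coverProg_spec_of_le (hn : 1 ≤ n) (hd : 1 ≤ d) (hk : 1 ≤ k) (hβ : 1 ≤ β)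
    (hsmall : n ≤ k * d) (ω : Tape) : ∃ (σ : State) (t : ℕ),
      Exec ω coverProg (initState p k β) σ t ∧
      (t : ℝ) ≤ 24000 * (n * d * Real.log (n + 1)) ∧ outputSet d σ ⊆ Set.range p ∧
      ((outputSet d σ).ncard : ℝ) ≤ k * (400 + d) * Real.exp (d / β ^ (2 / 3 : ℝ)) ∧
      IsCovering (256 * (β * kCenterOpt k (Set.range p))) (Set.range p) (outputSet d σ) := by
  obtain ⟨σ, t, hex, ht, h0, h1⟩ := runs_coverProg_of_le (ω := ω) (k := k) (β := β) p hsmall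
  obtain ⟨hsub, hcard⟩ := outputSet_subset_and_ncard_le p h0 fun i hi => ⟨⟨i, hi⟩, h1 ⟨i, hi⟩⟩
  have hopt := kCenterOpt_nonneg k (Set.range p)
  refine ⟨σ, t, hex, ?_, hsub, ?_, hsub, ?_⟩
  · have hlog : (1 / 2 : ℝ) ≤ Real.log (n + 1) := by
      have h2 : Real.log 2 ≤ Real.log (n + 1) := Real.log_le_log (by norm_num) (by
        have : (1 : ℝ) ≤ n := by exact_mod_cast hn
        linarith)
      have := Real.log_two_gt_d9
      norm_num at this ⊢
      linarith
    have hm1 : (1 : ℝ) ≤ n * d := by exact_mod_cast Nat.mul_pos hn hd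
    have ht' : (t : ℝ) ≤ n * d * 20 + 30 := by exact_mod_cast ht
    nlinarith
  · have h2 : (1 : ℝ) ≤ Real.exp (d / β ^ (2 / 3 : ℝ)) := Real.one_le_exp (by positivity)
    have h3 : ((outputSet d σ).ncard : ℝ) ≤ k * d := by exact_mod_cast hcard.trans hsmall
    have h4 : (0 : ℝ) ≤ k := k.cast_nonneg
    have h5 : (k : ℝ) * d ≤ k * (400 + d) := by nlinarith
    exact (h3.trans h5).trans (le_mul_of_one_le_right (by positivity) h2)
  · rintro _ ⟨i, rfl⟩
    refine ⟨p i, ⟨i, by rw [h0, Nat.floor_natCast]; exact i.2, fun c => (h1 i c).symm⟩, ?_⟩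
    rw [dist_self]
    positivity

theorem coverProg_spec_of_lt (hn : 1 ≤ n) (hd : 1 ≤ d) (hk : 1 ≤ k) (hβ : 1 ≤ β)
    (hbig : k * d < n) (hp : Function.Injective p) :
    ∃ G : Set Tape, MeasurableSet G ∧ (0.991 : ℝ) ≤ tapeMeasure.real G ∧
      ∀ ω, ∃ (σ : State) (t : ℕ), Exec ω coverProg (initState p k β) σ t ∧
        (t : ℝ) ≤ 24000 * (n * d * Real.log (n + 1)) ∧ outputSet d σ ⊆ Set.range p ∧
        ((outputSet d σ).ncard : ℝ) ≤ k * (400 + d) * Real.exp (d / β ^ (2 / 3 : ℝ)) ∧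
        (ω ∈ G → IsCovering (256 * (β * kCenterOpt k (Set.range p))) (Set.range p)
          (outputSet d σ)) := by
  have hkn : k < n := (Nat.le_mul_of_pos_right _ hd).trans_lt hbig
  have hdn : d < n := (Nat.le_mul_of_pos_left _ hk).trans_lt hbig
  obtain ⟨τ, K, D, E, hprep, hfr, hruns⟩ := exists_prepared p hn hd hk hβ hkn
  set x := (initState p k β).arr 0 with hxdef
  have hx : ∀ (i : Fin n) (c : Fin d), x (i * d + c) = p i c := initState_arr_zero p k β
  set y := x ⌊τ.arr 2 0⌋₊ with hydef
  have hy : ∀ (i : Fin n) (c : Fin d), y ≤ p i c := fun i c => by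
    rw [← hx]
    exact hprep.min _ ((mul_add_lt i c).trans_le hprep.le_pow)
  obtain ⟨hW, hWopt, hoptW⟩ := hprep.bounds p hp hx hn hd hk hkn
  set o := kCenterOpt k (Set.range p) with ho
  have hopt : 0 < o := by linarith
  obtain ⟨l, hl, hl1, hl2⟩ := exists_level hWopt hoptW hopt.le
  have hβ0 : 0 < β := by linarith
  set b := β ^ (2 / 3 : ℝ) with hbdef
  have hb : 1 ≤ b := Real.one_le_rpow hβ (by norm_num)
  have hbβ : b ^ 3 = β ^ 2 := by
    rw [hbdef, ← Real.rpow_natCast, ← Real.rpow_mul hβ0.le, ← Real.rpow_natCast]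
    norm_num
  -- The level `l` depends only on the input, so one event for this level suffices and no union
  -- bound over levels is needed.
  obtain ⟨G, hG, hGm, hGcount⟩ := exists_measurableSet_rowCount_le p hd hk hβ hb hbβ hx hy hopt hl1
    hprep.one_le hprep.sq_le hprep.le_cube
  refine ⟨G, hG, hGm, fun ω => ?_⟩
  obtain ⟨σ, t, hex, ht, hpost⟩ := runs_coverProg_of_lt (ω := ω) p hn hd hβ hbig hprep hfr (hruns ω)
  have htime : (t : ℝ) ≤ 24000 * (n * d * Real.log (n + 1)) := by
    have h1 := log_add_one_le hn (Nat.mul_pos hn hd) (Nat.mul_le_mul_left n hdn.le)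
    have h2 : (t : ℝ) ≤ (Nat.log 2 (2 * (n * d)) + 1) * (n * d * 4000) := by exact_mod_cast ht
    calc (t : ℝ) ≤ (Nat.log 2 (2 * (n * d)) + 1) * (n * d * 4000) := h2
      _ ≤ 6 * Real.log (n + 1) * (n * d * 4000) := by gcongr
      _ = 24000 * (n * d * Real.log (n + 1)) := by ring
  have hsize : (200 * k * 2 ^ E : ℝ) ≤ k * (400 + d) * Real.exp (d / b) := by
    have h1 := two_pow_le_two_mul_exp (d := d) (E := E) hb (by rw [hbβ]; exact hprep.cube_lt)
    calc (200 * k * 2 ^ E : ℝ) ≤ 200 * k * (2 * Real.exp (d / b)) := by gcongr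
      _ = k * (400 + 0) * Real.exp (d / b) := by ring
      _ ≤ k * (400 + d) * Real.exp (d / b) := by gcongr; positivity
  rcases hpost with ⟨h0, hall⟩ | ⟨l', h0, hle, hall, hrepr⟩
  · obtain ⟨hsub, hcard⟩ := outputSet_subset_and_ncard_le p (τ := σ) (N := 0) (by simpa using h0)
      (by simp)
    refine ⟨σ, t, hex, htime, hsub, ?_, fun hω => ?_⟩
    · rw [Nat.le_zero.mp hcard, Nat.cast_zero]; positivity
    · exact absurd (hGcount ω hω) (not_le.mpr (hall l hl))
  · obtain ⟨hsub, hcard⟩ := outputSet_subset_and_ncard_le p h0 fun i hi => by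
      obtain ⟨rep, hrep, -⟩ := hrepr
      exact ⟨⟨rep i, (hrep i hi).1⟩, fun c => by rw [(hrep i hi).2 c c.2, ← hx]⟩
    refine ⟨σ, t, hex, htime, hsub, ?_, fun hω => ?_⟩
    · have h1 : ((outputSet d σ).ncard : ℝ) ≤ _ := Nat.cast_le.mpr hcard
      exact (h1.trans hle).trans hsize
    -- On the good event level `l` passes the test, so the run cannot have continued beyond it;
    -- stopping earlier only gives smaller cells.
    · have hll : l' ≤ l := by
        by_contra hcon
        exact absurd (hGcount ω hω) (not_le.mpr (hall l (by omega)))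
      have hD0 : (0 : ℝ) < D := by exact_mod_cast hprep.one_le
      refine isCovering_of_isRepr p (D := D) (by positivity) hx hy (fun c => (ω c).1.2.1)
        hprep.le_sq ?_ h0 hrepr
      calc (D : ℝ) * (64 * β * τ.reg 37 / D * 2 ^ l') = 64 * β * (τ.reg 37 * 2 ^ l') := by
            field_simp
        _ ≤ 64 * β * (τ.reg 37 * 2 ^ l) := by gcongr; norm_num
        _ ≤ 64 * β * (4 * o) := by gcongr
        _ = 256 * (β * o) := by ring

end RealRAM

theorem mainTheorem4 :
    ∃ (c : RealRAM.Prog) (A B : ℝ) (q : Polynomial ℝ),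
      ∀ (n d k : ℕ) (β : ℝ) (p : Fin n → EuclideanSpace ℝ (Fin d)),
        1 ≤ n → 1 ≤ d → 1 ≤ k → 1 ≤ β → Function.Injective p →
        ∃ G : Set RealRAM.Tape,
          MeasurableSet G ∧ (0.991 : ℝ) ≤ RealRAM.tapeMeasure.real G ∧
          ∀ ω : RealRAM.Tape, ∃ (σ : RealRAM.State) (t : ℕ),
            RealRAM.Exec ω c (RealRAM.initState p k β) σ t ∧
            (t : ℝ) ≤ A * (n * d * Real.log (n + 1)) ∧
            RealRAM.outputSet d σ ⊆ Set.range p ∧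
            ((RealRAM.outputSet d σ).ncard : ℝ) ≤
              k * q.eval (d : ℝ) * Real.exp (d / β ^ (2 / 3 : ℝ)) ∧
            (ω ∈ G →
              IsCovering (B * (β * kCenterOpt k (Set.range p))) (Set.range p)
                (RealRAM.outputSet d σ)) := by
  refine ⟨RealRAM.coverProg, 24000, 256, Polynomial.C 400 + Polynomial.X,
    fun n d k β p hn hd hk hβ hp => ?_⟩
  simp only [Polynomial.eval_add, Polynomial.eval_C, Polynomial.eval_X]
  rcases le_or_gt n (k * d) with hsmall | hbig
  · refine ⟨Set.univ, MeasurableSet.univ, by simp; norm_num, fun ω => ?_⟩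
    obtain ⟨σ, t, h1, h2, h3, h4, h5⟩ :=
      RealRAM.coverProg_spec_of_le p hn hd hk hβ hsmall ω
    exact ⟨σ, t, h1, h2, h3, h4, fun _ => h5⟩
  · exact RealRAM.coverProg_spec_of_lt p hn hd hk hβ hbig hp
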